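/- Let $a\in[-1,1)\setminus\{0\}$. For $x=(x_1,x_2)\in\mathbb R^2$ let $\mathbf A_0(x)=(-x_2,0)$ and let $\sigma(x)=1$ if $x_2>0$, $\sigma(x)=a$ if $x_2\le 0$. Let $\beta_a=\inf \mathrm{sp}(\mathcal L_a)$ be the bottom of the spectrum of the self-adjoint operator $\mathcal L_a=-(\nabla-i\sigma\mathbf A_0)^2$ in $L^2(\mathbb R^2)$, with domain the set of $u\in L^2(\mathbb R^2)$ for which $(\nabla-i\sigma\mathbf A_0)u$ and $(\nabla-i\sigma\mathbf A_0)^2u$, taken in the sense of distributions, are in $L^2(\mathbb R^2)$. For $R>0$ let $S_R=(-R/2,R/2)\times\mathbb R$ and $$\mathcal D_R=\Big\{u\in L^2(S_R;\mathbb C)\,:\,(\nabla-i\sigma\mathbf A_0)u\in L^2(S_R),\ u=0 \text{ on } x_1=\pm R/2 \text{ (in the sense of traces)}\Big\},$$ and for $b>0$ let $$\mathfrak g_a(b,R)=\inf_{u\in\mathcal D_R}\int_{S_R}\Big(b\,|(\nabla-i\sigma\mathbf A_0)u|^2-|u|^2+\tfrac12|u|^4\Big)\,dx .$$ Then the following holds.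 \begin{enumerate} \item For all $b\ge 1/|a|$ and $R>0$, $\mathfrak g_a(b,R)$ is finite and $\mathfrak g_a(b,R)\le 0$. \item If $a\in(0,1)$, then $\mathfrak g_a(b,R)=0$ for all $b\ge 1/|a|$ and $R>0$. \item If $a\in[-1,0)$, then for every $b\ge 1/|a|$ there is a real number $\mathfrak e_a(b)\le 0$ such that $\lim_{R\to+\infty}\mathfrak g_a(b,R)/R=\mathfrak e_a(b)$. Furthermore, $\mathfrak e_a(b)=0$ if and only if $b\ge 1/\beta_a$. \item If $a\in[-1,0)$, then the function $[1/|a|,+\infty)\ni b\mapsto \mathfrak e_a(b)$ is non-decreasing and continuous. \item There is a universal constant $C>0$ (independent of $a$, $b$ and $R$) such that, for all $a\in[-1,0)$, $b\ge 1/|a|$ and $R\ge 4$, $$\mathfrak e_a(b)\le \frac{\mathfrak g_a(b,R)}{R}\le \mathfrak e_a(b)+C\,\frac{b^2}{R^{1/3}} .$$ \end{enumerate} -/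

import Mathlib

open MeasureTheory Set Filter Topology

noncomputable section

namespace StepGL

/-- The step function `σ` on the plane: `1` in the upper half-plane, `a` in the lower one. -/
def step (a : ℝ) (x : ℝ × ℝ) : ℝ := if 0 < x.2 then 1 else a

/-- First component of the magnetic potential `σ A₀`, where `A₀(x) = (-x₂, 0)`;
the second component is zero. -/
def pot (a : ℝ) (x : ℝ × ℝ) : ℝ := step a x * (-x.2)

/-- Real-valued smooth compactly supported test functions on the plane. -/
def IsTest (φ : ℝ × ℝ → ℝ) : Prop :=
  ContDiff ℝ (⊤ : ℕ∞) φ ∧ HasCompactSupport φ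

/-- Classical partial derivatives of a test function. -/
def d1 (φ : ℝ × ℝ → ℝ) (x : ℝ × ℝ) : ℝ := fderiv ℝ φ x (1, 0)

def d2 (φ : ℝ × ℝ → ℝ) (x : ℝ × ℝ) : ℝ := fderiv ℝ φ x (0, 1)

/-- `(v₁, v₂) = (∇ - i σ A₀) u` in the sense of distributions on the open set `Ω`, that is,
`v₁ = ∂₁ u - i (pot a) u` and `v₂ = ∂₂ u`. -/
def IsWeakMagGrad (a : ℝ) (Ω : Set (ℝ × ℝ)) (u v₁ v₂ : ℝ × ℝ → ℂ) : Prop :=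
  ∀ φ : ℝ × ℝ → ℝ, IsTest φ → tsupport φ ⊆ Ω →
    (∫ x in Ω, φ x • v₁ x =
      ∫ x in Ω, (-(d1 φ x • u x) - φ x • (Complex.I * (pot a x : ℂ) * u x))) ∧
    (∫ x in Ω, φ x • v₂ x = ∫ x in Ω, -(d2 φ x • u x))

/-- `f = -((∂₁ - i (pot a)) v₁ + ∂₂ v₂)` in the sense of distributions on the plane. -/
def IsWeakMagNegDiv (a : ℝ) (v₁ v₂ f : ℝ × ℝ → ℂ) : Prop :=
  ∀ φ : ℝ × ℝ → ℝ, IsTest φ →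
    ∫ x, φ x • f x =
      ∫ x, (d1 φ x • v₁ x + φ x • (Complex.I * (pot a x : ℂ) * v₁ x) + d2 φ x • v₂ x)

/-- The Hilbert space `L²(ℝ²; ℂ)`. -/
abbrev L2 : Type := Lp ℂ 2 (volume : Measure (ℝ × ℝ))

/-- The graph of the self-adjoint magnetic Hamiltonian `𝓛_a = -(∇ - i σ A₀)²` in `L²(ℝ²)`:
its domain consists of the `u ∈ L²` with `(∇ - i σ A₀) u ∈ L²` and `(∇ - i σ A₀)² u ∈ L²`
(distributional sense), and `HamiltonianGraph a u f` says that `u` is in the domain and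
`𝓛_a u = f`. -/
def HamiltonianGraph (a : ℝ) (u f : L2) : Prop :=
  ∃ v₁ v₂ : ℝ × ℝ → ℂ, MemLp v₁ 2 volume ∧ MemLp v₂ 2 volume ∧
    IsWeakMagGrad a univ u v₁ v₂ ∧ IsWeakMagNegDiv a v₁ v₂ f

/-- The spectrum of `𝓛_a`: the complex `z` for which `𝓛_a - z` has no bounded two-sided inverse
`T : L² → dom 𝓛_a` (note that `HamiltonianGraph a u (f + z • u)` means `(𝓛_a - z) u = f`). -/
def hamiltonianSpectrum (a : ℝ) : Set ℂ :=
  {z | ¬ ∃ T : L2 →L[ℂ] L2, ∀ f u : L2, HamiltonianGraph a u (f + z • u) ↔ u = T f}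

/-- `β_a = inf sp(𝓛_a)`; the spectrum of the self-adjoint operator `𝓛_a` is real. -/
def beta (a : ℝ) : ℝ := sInf {t : ℝ | (t : ℂ) ∈ hamiltonianSpectrum a}

/-- The strip `S_R = (-R/2, R/2) × ℝ`. -/
def strip (R : ℝ) : Set (ℝ × ℝ) := Ioo (-R / 2) (R / 2) ×ˢ univ

/-- `τm` and `τp` are the traces of `u` on the lines `x₁ = -R/2` and `x₁ = R/2`, where `w = ∂₁ u`
in the strip: the Green formula in the direction `x₁` holds with the boundary values `τm`, `τp`
against every test function on the plane. -/
def IsLateralTrace (R : ℝ) (u w : ℝ × ℝ → ℂ) (τm τp : ℝ → ℂ) : Prop :=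
  LocallyIntegrable τm ∧ LocallyIntegrable τp ∧
  ∀ φ : ℝ × ℝ → ℝ, IsTest φ →
    ∫ x in strip R, (d1 φ x • u x + φ x • w x) =
      (∫ y, φ (R / 2, y) • τp y) - ∫ y, φ (-R / 2, y) • τm y

/-- `u ∈ 𝓓_R` with `(∇ - i σ A₀) u = (v₁, v₂)`: `u` and its magnetic gradient are in `L²(S_R)`
and `u` vanishes on the lateral boundary `x₁ = ± R/2`. The pair `(v₁, v₂)` is determined by `u`
almost everywhere in the strip, and `∂₁ u = v₁ + i (pot a) u`. -/
structure InDomain (a R : ℝ) (u v₁ v₂ : ℝ × ℝ → ℂ) : Prop where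
  memLp : MemLp u 2 (volume.restrict (strip R))
  memLp_grad₁ : MemLp v₁ 2 (volume.restrict (strip R))
  memLp_grad₂ : MemLp v₂ 2 (volume.restrict (strip R))
  grad : IsWeakMagGrad a (strip R) u v₁ v₂
  trace_zero : IsLateralTrace R u (fun x => v₁ x + Complex.I * (pot a x : ℂ) * u x) 0 0

/-- The Ginzburg--Landau energy of `u` with magnetic gradient `(v₁, v₂)` in the strip. (Should
`|u|⁴` not be integrable, the integral reads `0`, the energy of `u = 0`, instead of `+∞`; this has
no effect on the infimum.) -/
def energy (b R : ℝ) (u v₁ v₂ : ℝ × ℝ → ℂ) : ℝ :=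
  ∫ x in strip R,
    (b * (‖v₁ x‖ ^ 2 + ‖v₂ x‖ ^ 2) - ‖u x‖ ^ 2 + (1 / 2) * ‖u x‖ ^ 4)

/-- The set of values of the energy on `𝓓_R`. -/
def energyValues (a b R : ℝ) : Set ℝ :=
  {E | ∃ u v₁ v₂ : ℝ × ℝ → ℂ, InDomain a R u v₁ v₂ ∧ E = energy b R u v₁ v₂}

/-- The ground state energy `𝔤_a(b, R)`, the infimum of the energy over `𝓓_R`. -/
def groundEnergy (a b R : ℝ) : ℝ := sInf (energyValues a b R)

end StepGL

end

/-!
For `a > 0` the commutator of the two magnetic derivatives is the field `σ ≥ a`, so that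
`∫ |(∇ - i σ A₀) u|² ≥ a ∫ |u|²` and the energies are non-negative as soon as `b ≥ 1 / a`. For any
sign of `a` the same argument with `|a|` applies to functions vanishing near the discontinuity line
`x₂ = 0`. Localizing in `x₂`, the energy is therefore bounded below by the contribution of a box
around that line, in which the quartic term controls the mass; this gives
`-C b² R ≤ 𝔤_a(b, R) ≤ 0`.

Gluing configurations on adjacent strips makes `𝔤_a(b, ·)` subadditive. Conversely, a configuration
on a wide strip of width `M`, cut off at height `√R` and looked at through a window of width `R`, is
admissible on the strip of width `R`; averaging over all positions of the window bounds
`𝔤_a(b, R) / R` by `𝔤_a(b, M) / M` up to an error of order `b² / √R`. Hence the quotient converges,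
with that rate, to its infimum `𝔢_a(b)`, which is concave in `b` as an infimum of affine functions.

The operator `ℒ_a` is the one associated with the closed magnetic quadratic form, so `β_a` is the
infimum of the form over normalized test functions. If `b β_a ≥ 1` all energies are non-negative;
otherwise some test function has negative quadratic energy, and so do its small multiples with the
quartic term included.
-/

noncomputable section

namespace StepGL

open ContinuousLinearMap (lsmul)
open scoped Convolution ContDiff ENNReal

/-! ### Weak directional derivatives -/

theorem locallyIntegrable_comp_add_right {G F : Type*} [AddGroup G] [TopologicalSpace G]
    [IsTopologicalAddGroup G] [MeasurableSpace G] [BorelSpace G] [NormedAddCommGroup F]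
    {μ : Measure G} [μ.IsAddRightInvariant] {f : G → F} (hf : LocallyIntegrable f μ) (c : G) :
    LocallyIntegrable (fun x => f (x + c)) μ :=
  (locallyIntegrable_map_homeomorph (Homeomorph.addRight c)).1 <| by
    rwa [Homeomorph.coe_addRight, map_add_right_eq_self]

section WeakDerivative

variable {E F G : Type*} [NormedAddCommGroup E] [NormedSpace ℝ E]
  [NormedAddCommGroup F] [NormedSpace ℝ F] [NormedAddCommGroup G] [NormedSpace ℝ G]

/-- Vector-valued test functions: smooth with compact support. For real-valued functions on the
plane this unfolds to `IsTest`. -/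
structure IsTestFunction (φ : E → F) : Prop where
  contDiff : ContDiff ℝ ∞ φ
  hasCompactSupport : HasCompactSupport φ

theorem isTest_iff {φ : ℝ × ℝ → ℝ} : IsTest φ ↔ IsTestFunction φ :=
  ⟨fun h => ⟨h.1, h.2⟩, fun h => ⟨h.1, h.2⟩⟩

namespace IsTestFunction

variable {φ : E → F}

theorem continuous (h : IsTestFunction φ) : Continuous φ := h.contDiff.continuous

theorem differentiable (h : IsTestFunction φ) : Differentiable ℝ φ :=
  h.contDiff.differentiable (by simp)

theorem fderiv_apply (h : IsTestFunction φ) (e : E) : IsTestFunction fun x => fderiv ℝ φ x e :=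
  ⟨(h.contDiff.fderiv_right (by simp)).clm_apply contDiff_const,
    h.hasCompactSupport.fderiv_apply ℝ e⟩

theorem smul_left (h : IsTestFunction φ) {χ : E → ℝ} (hχ : ContDiff ℝ ∞ χ) :
    IsTestFunction fun x => χ x • φ x :=
  ⟨hχ.smul h.contDiff, h.hasCompactSupport.smul_left⟩

theorem clm_comp (h : IsTestFunction φ) (ℓ : F →L[ℝ] G) : IsTestFunction fun x => ℓ (φ x) :=
  ⟨ℓ.contDiff.comp h.contDiff, h.hasCompactSupport.comp_left (map_zero ℓ)⟩

theorem comp_sub_right (h : IsTestFunction φ) (c : E) : IsTestFunction fun x => φ (x - c) :=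
  ⟨h.contDiff.comp (contDiff_id.sub contDiff_const),
    h.hasCompactSupport.comp_homeomorph (Homeomorph.subRight c)⟩

theorem comp_sub_left (h : IsTestFunction φ) (c : E) : IsTestFunction fun x => φ (c - x) :=
  ⟨h.contDiff.comp (contDiff_const.sub contDiff_id),
    h.hasCompactSupport.comp_homeomorph (Homeomorph.subLeft c)⟩

theorem memLp [MeasurableSpace E] [OpensMeasurableSpace E] {μ : Measure E}
    [IsFiniteMeasureOnCompacts μ] (h : IsTestFunction φ) (p : ℝ≥0∞) : MemLp φ p μ :=
  h.continuous.memLp_of_hasCompactSupport h.hasCompactSupport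

theorem integrable_smul [MeasurableSpace E] [OpensMeasurableSpace E] {μ : Measure E}
    {f : E → F} {φ : E → ℝ} (h : IsTestFunction φ) (hf : LocallyIntegrable f μ) :
    Integrable (fun x => φ x • f x) μ :=
  hf.integrable_smul_left_of_hasCompactSupport h.continuous h.hasCompactSupport

end IsTestFunction

variable [MeasurableSpace E] {μ : Measure E}

/-- `w` is the derivative of `u` in the direction `e` in the sense of distributions on the whole
space. -/
structure HasWeakLineDeriv (μ : Measure E) (u w : E → F) (e : E) : Prop where
  locallyIntegrable : LocallyIntegrable u μ
  locallyIntegrable_deriv : LocallyIntegrable w μ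
  integral_eq_zero : ∀ φ : E → ℝ, IsTestFunction φ →
    ∫ x, (fderiv ℝ φ x e • u x + φ x • w x) ∂μ = 0

namespace HasWeakLineDeriv

variable {u w u' w' : E → F} {e : E}

theorem integrable [OpensMeasurableSpace E] (h : HasWeakLineDeriv μ u w e)
    {φ : E → ℝ} (hφ : IsTestFunction φ) :
    Integrable (fun x => fderiv ℝ φ x e • u x + φ x • w x) μ :=
  ((hφ.fderiv_apply e).integrable_smul h.locallyIntegrable).add
    (hφ.integrable_smul h.locallyIntegrable_deriv)

theorem integral_fderiv_smul [OpensMeasurableSpace E] (h : HasWeakLineDeriv μ u w e)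
    {φ : E → ℝ} (hφ : IsTestFunction φ) :
    ∫ x, fderiv ℝ φ x e • u x ∂μ = -∫ x, φ x • w x ∂μ := by
  rw [eq_neg_iff_add_eq_zero, ← integral_add
    ((hφ.fderiv_apply e).integrable_smul h.locallyIntegrable)
    (hφ.integrable_smul h.locallyIntegrable_deriv), h.integral_eq_zero φ hφ]

theorem congr_ae (h : HasWeakLineDeriv μ u w e) (hu : u =ᵐ[μ] u') (hw : w =ᵐ[μ] w') :
    HasWeakLineDeriv μ u' w' e where
  locallyIntegrable := h.locallyIntegrable.congr hu
  locallyIntegrable_deriv := h.locallyIntegrable_deriv.congr hw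
  integral_eq_zero φ hφ := by
    rw [← h.integral_eq_zero φ hφ]
    refine integral_congr_ae ?_
    filter_upwards [hu, hw] with x hux hwx
    rw [hux, hwx]

theorem zero : HasWeakLineDeriv μ (0 : E → F) 0 e :=
  ⟨locallyIntegrable_zero, locallyIntegrable_zero, fun _ _ => by simp⟩

theorem add [OpensMeasurableSpace E] (h : HasWeakLineDeriv μ u w e)
    (h' : HasWeakLineDeriv μ u' w' e) : HasWeakLineDeriv μ (u + u') (w + w') e where
  locallyIntegrable := h.locallyIntegrable.add h'.locallyIntegrable
  locallyIntegrable_deriv := h.locallyIntegrable_deriv.add h'.locallyIntegrable_deriv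
  integral_eq_zero φ hφ := by
    have := integral_add (h.integrable hφ) (h'.integrable hφ)
    rw [h.integral_eq_zero φ hφ, h'.integral_eq_zero φ hφ, add_zero] at this
    rw [← this]
    congr 1; ext x
    simp only [Pi.add_apply, smul_add]; abel

theorem clm_comp [OpensMeasurableSpace E] [CompleteSpace F] [CompleteSpace G]
    (h : HasWeakLineDeriv μ u w e) (ℓ : F →L[ℝ] G) :
    HasWeakLineDeriv μ (fun x => ℓ (u x)) (fun x => ℓ (w x)) e where
  locallyIntegrable x := (h.locallyIntegrable x).imp fun _ hs => ⟨hs.1, ℓ.integrable_comp hs.2⟩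
  locallyIntegrable_deriv x :=
    (h.locallyIntegrable_deriv x).imp fun _ hs => ⟨hs.1, ℓ.integrable_comp hs.2⟩
  integral_eq_zero φ hφ := by
    simpa [h.integral_eq_zero φ hφ] using ℓ.integral_comp_comm (h.integrable hφ)

theorem smul [OpensMeasurableSpace E] [LocallyCompactSpace E] (h : HasWeakLineDeriv μ u w e)
    {χ : E → ℝ} (hχ : ContDiff ℝ ∞ χ) :
    HasWeakLineDeriv μ (fun x => χ x • u x) (fun x => χ x • w x + fderiv ℝ χ x e • u x) e where
  locallyIntegrable := h.locallyIntegrable.continuous_smul hχ.continuous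
  locallyIntegrable_deriv := (h.locallyIntegrable_deriv.continuous_smul hχ.continuous).add
    (h.locallyIntegrable.continuous_smul
      ((hχ.continuous_fderiv (by simp)).clm_apply continuous_const))
  integral_eq_zero φ hφ := by
    rw [← h.integral_eq_zero _ (hφ.smul_left hχ)]
    congr 1; ext x
    rw [fderiv_fun_smul (hχ.differentiable (by simp) x) (hφ.differentiable x)]
    simp only [smul_eq_mul, add_apply, smul_apply, ContinuousLinearMap.smulRight_apply]
    module

theorem comp_add_right [BorelSpace E] [μ.IsAddRightInvariant] (h : HasWeakLineDeriv μ u w e)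
    (c : E) : HasWeakLineDeriv μ (fun x => u (x + c)) (fun x => w (x + c)) e where
  locallyIntegrable := locallyIntegrable_comp_add_right h.locallyIntegrable c
  locallyIntegrable_deriv := locallyIntegrable_comp_add_right h.locallyIntegrable_deriv c
  integral_eq_zero φ hφ := by
    refine Eq.trans ?_ ((integral_add_right_eq_self _ c).trans
      (h.integral_eq_zero _ (hφ.comp_sub_right c)))
    simp [fderiv_comp_sub]

variable [BorelSpace E] [FiniteDimensional ℝ E] [μ.IsAddHaarMeasure]

theorem of_isTestFunction {ϕ : E → F} (h : IsTestFunction ϕ) (e : E) :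
    HasWeakLineDeriv μ ϕ (fun x => fderiv ℝ ϕ x e) e where
  locallyIntegrable := h.continuous.locallyIntegrable
  locallyIntegrable_deriv := (h.fderiv_apply e).continuous.locallyIntegrable
  integral_eq_zero φ hφ := by
    have hφ'ϕ := (hφ.fderiv_apply e).integrable_smul (h.continuous.locallyIntegrable (μ := μ))
    have hφϕ' :=
      hφ.integrable_smul ((h.fderiv_apply e).continuous.locallyIntegrable (μ := μ))
    rw [integral_add hφ'ϕ hφϕ', integral_smul_fderiv_eq_neg_fderiv_smul_of_integrable hφ'ϕ hφϕ'
      (hφ.integrable_smul h.continuous.locallyIntegrable) (fun x _ => hφ.differentiable x)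
      (fun x _ => h.differentiable x), add_neg_cancel]

theorem fderiv_convolution (h : HasWeakLineDeriv μ u w e) {ρ : E → ℝ}
    (hρ : IsTestFunction ρ) (x : E) :
    fderiv ℝ (ρ ⋆[lsmul ℝ ℝ, μ] u) x e = (ρ ⋆[lsmul ℝ ℝ, μ] w) x := by
  have hρx := hρ.comp_sub_left x
  have hfderiv (y : E) : fderiv ℝ (fun y => ρ (x - y)) y e = -fderiv ℝ ρ (x - y) e := by
    have := (hρ.differentiable (x - y)).hasFDerivAt.comp y ((hasFDerivAt_id y).const_sub x)
    rw [show (fun y => ρ (x - y)) = ρ ∘ (x - ·) from rfl, this.fderiv]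
    simp
  have hconv : ConvolutionExistsAt (fderiv ℝ ρ) u x ((lsmul ℝ ℝ).precompL E) μ :=
    (hρ.hasCompactSupport.fderiv ℝ).convolutionExists_left _
      (hρ.contDiff.continuous_fderiv (by simp)) h.locallyIntegrable x
  calc fderiv ℝ (ρ ⋆[lsmul ℝ ℝ, μ] u) x e = ∫ y, fderiv ℝ ρ y e • u (x - y) ∂μ := by
        rw [(hρ.hasCompactSupport.hasFDerivAt_convolution_left (lsmul ℝ ℝ)
          (hρ.contDiff.of_le (by simp)) h.locallyIntegrable x).fderiv, convolution_def,
          ContinuousLinearMap.integral_apply hconv]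
        rfl
    _ = -∫ y, fderiv ℝ (fun y => ρ (x - y)) y e • u y ∂μ := by
        rw [← integral_sub_left_eq_self _ μ x]
        simp [hfderiv, integral_neg]
    _ = ∫ y, ρ (x - y) • w y ∂μ := by rw [h.integral_fderiv_smul hρx, neg_neg]
    _ = (ρ ⋆[lsmul ℝ ℝ, μ] w) x := by
        rw [convolution_def, ← integral_sub_left_eq_self _ μ x]
        simp

end HasWeakLineDeriv

end WeakDerivative

/-! ### Square-integrable functions and cutoffs -/

section Integration

variable {α F : Type*} [MeasurableSpace α] {μ : Measure α} [NormedAddCommGroup F]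

theorem integrable_norm_sq {f : α → F} (hf : MemLp f 2 μ) : Integrable (fun x => ‖f x‖ ^ 2) μ :=
  (memLp_two_iff_integrable_sq_norm hf.1).1 hf

variable [NormedSpace ℝ F] {f : α → F}

theorem memLp_smul_of_abs_le {p : ℝ≥0∞} {k : α → ℝ} {C : ℝ} (hf : MemLp f p μ)
    (hk : AEStronglyMeasurable k μ) (hkC : ∀ x, |k x| ≤ C) : MemLp (fun x => k x • f x) p μ :=
  hf.smul (memLp_top_of_bound hk C (.of_forall hkC))

theorem tendsto_integral_smul {k : ℕ → α → ℝ} {C : ℝ} (hf : Integrable f μ)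
    (hk : ∀ n, AEStronglyMeasurable (k n) μ) (hkC : ∀ n x, |k n x| ≤ C) {l : α → ℝ}
    (hlim : ∀ᵐ x ∂μ, Tendsto (fun n => k n x) atTop (𝓝 (l x))) :
    Tendsto (fun n => ∫ x, k n x • f x ∂μ) atTop (𝓝 (∫ x, l x • f x ∂μ)) :=
  tendsto_integral_of_dominated_convergence (fun x => C * ‖f x‖) (fun n => (hk n).smul hf.1)
    (hf.norm.const_mul C)
    (fun n => .of_forall fun x => by
      rw [norm_smul]; exact mul_le_mul_of_nonneg_right (hkC n x) (norm_nonneg _))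
    (hlim.mono fun x hx => hx.smul_const _)

end Integration

theorem exists_seq_contDiff_tsupport_subset {E : Type*} [NormedAddCommGroup E] [NormedSpace ℝ E]
    [FiniteDimensional ℝ E] {s : Set E} (hs : IsOpen s) :
    ∃ k : ℕ → E → ℝ, (∀ n, ContDiff ℝ ∞ (k n)) ∧ (∀ n, tsupport (k n) ⊆ s) ∧
      (∀ n x, |k n x| ≤ 1) ∧ ∀ x ∈ s, Tendsto (fun n => k n x) atTop (𝓝 1) := by
  obtain ⟨f, hf, hfd, hf01⟩ := hs.exists_contDiff_support_eq (n := (⊤ : ℕ∞))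
  refine ⟨fun n x => Real.smoothTransition (n * f x - 1), fun n =>
    Real.smoothTransition.contDiff.comp ((contDiff_const.mul hfd).sub contDiff_const), fun n => ?_,
    fun n x => ?_, fun x hx => ?_⟩
  · have hclosed : IsClosed {x | 1 ≤ n * f x} :=
      isClosed_le continuous_const (continuous_const.mul hfd.continuous)
    refine (closure_minimal (fun x hx => ?_) hclosed).trans fun x hx => ?_
    · by_contra hlt
      exact hx (Real.smoothTransition.zero_of_nonpos (by grind))
    · rw [← hf, Function.mem_support]
      rintro h
      norm_num [mem_ofPred_eq, h] at hx
  · rw [abs_of_nonneg (Real.smoothTransition.nonneg _)]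
    exact Real.smoothTransition.le_one _
  · have hpos : 0 < f x := lt_of_le_of_ne (hf01 (mem_range_self x)).1 (by
      rw [← hf] at hx; exact Ne.symm hx)
    refine tendsto_const_nhds.congr' ?_
    filter_upwards [(tendsto_natCast_atTop_atTop.atTop_mul_const hpos).eventually_ge_atTop 2]
      with n hn
    exact (Real.smoothTransition.one_of_one_le (by linarith)).symm

/-! ### Magnetic Sobolev functions on the plane -/

theorem lipschitzWith_pot (a : ℝ) : LipschitzWith (1 + ‖a‖₊) (pot a) := by
  have hpot (x : ℝ × ℝ) : pot a x = -max x.2 0 + a • max (-x.2) 0 := by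
    unfold pot step
    rw [smul_eq_mul]
    split_ifs with h
    · rw [max_eq_left h.le, max_eq_right (by linarith)]; ring
    · rw [max_eq_right (by linarith), max_eq_left (by linarith)]; ring
  rw [funext hpot, ← mul_one ‖a‖₊]
  exact (LipschitzWith.prod_snd.max_const 0).neg.add
    ((lipschitzWith_smul a).comp (LipschitzWith.prod_snd.neg.max_const 0))

theorem continuous_pot (a : ℝ) : Continuous (pot a) := (lipschitzWith_pot a).continuous

theorem pot_add_fst (a s : ℝ) (x : ℝ × ℝ) : pot a (x + (s, 0)) = pot a x := by
  simp [pot, step]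

theorem locallyIntegrable_pot_mul {μ : Measure (ℝ × ℝ)} (a : ℝ) {f : ℝ × ℝ → ℂ}
    (hf : LocallyIntegrable f μ) :
    LocallyIntegrable (fun x => Complex.I * (pot a x : ℂ) * f x) μ :=
  hf.continuous_mul (by have := continuous_pot a; fun_prop)

theorem hasFDerivAt_comp_fst {k : ℝ → ℝ} (hk : Differentiable ℝ k) (x : ℝ × ℝ) :
    HasFDerivAt (fun y : ℝ × ℝ => k y.1) (deriv k x.1 • ContinuousLinearMap.fst ℝ ℝ ℝ) x :=
  (hk x.1).hasDerivAt.comp_hasFDerivAt x hasFDerivAt_fst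

theorem hasFDerivAt_comp_snd {k : ℝ → ℝ} (hk : Differentiable ℝ k) (x : ℝ × ℝ) :
    HasFDerivAt (fun y : ℝ × ℝ => k y.2) (deriv k x.2 • ContinuousLinearMap.snd ℝ ℝ ℝ) x :=
  (hk x.2).hasDerivAt.comp_hasFDerivAt x hasFDerivAt_snd

theorem d1_comp_fst {k : ℝ → ℝ} (hk : Differentiable ℝ k) (x : ℝ × ℝ) :
    d1 (fun y => k y.1) x = deriv k x.1 := by
  simp [d1, (hasFDerivAt_comp_fst hk x).fderiv]

theorem d2_comp_fst {k : ℝ → ℝ} (hk : Differentiable ℝ k) (x : ℝ × ℝ) :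
    d2 (fun y => k y.1) x = 0 := by
  simp [d2, (hasFDerivAt_comp_fst hk x).fderiv]

theorem d1_comp_snd {k : ℝ → ℝ} (hk : Differentiable ℝ k) (x : ℝ × ℝ) :
    d1 (fun y => k y.2) x = 0 := by
  simp [d1, (hasFDerivAt_comp_snd hk x).fderiv]

theorem d2_comp_snd {k : ℝ → ℝ} (hk : Differentiable ℝ k) (x : ℝ × ℝ) :
    d2 (fun y => k y.2) x = deriv k x.2 := by
  simp [d2, (hasFDerivAt_comp_snd hk x).fderiv]

section Plane

variable {a b R : ℝ} {u v₁ v₂ u' v₁' v₂' : ℝ × ℝ → ℂ}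

/-- The magnetic Sobolev space of the plane: `u` and its magnetic gradient
`(v₁, v₂) = (∇ - i σ A₀) u` are square integrable. -/
structure MagH1 (a : ℝ) (u v₁ v₂ : ℝ × ℝ → ℂ) : Prop where
  memLp : MemLp u 2 volume
  memLp₁ : MemLp v₁ 2 volume
  memLp₂ : MemLp v₂ 2 volume
  weak₁ : HasWeakLineDeriv volume u (fun x => v₁ x + Complex.I * (pot a x : ℂ) * u x) (1, 0)
  weak₂ : HasWeakLineDeriv volume u v₂ (0, 1)

namespace MagH1

theorem locallyIntegrable (h : MagH1 a u v₁ v₂) : LocallyIntegrable u volume :=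
  h.weak₁.locallyIntegrable

theorem zero (a : ℝ) : MagH1 a 0 0 0 where
  memLp := MemLp.zero
  memLp₁ := MemLp.zero
  memLp₂ := MemLp.zero
  weak₁ := by
    convert HasWeakLineDeriv.zero using 1
    ext; simp
  weak₂ := HasWeakLineDeriv.zero

theorem add (h : MagH1 a u v₁ v₂) (h' : MagH1 a u' v₁' v₂') :
    MagH1 a (u + u') (v₁ + v₁') (v₂ + v₂') where
  memLp := h.memLp.add h'.memLp
  memLp₁ := h.memLp₁.add h'.memLp₁
  memLp₂ := h.memLp₂.add h'.memLp₂
  weak₁ := by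
    convert h.weak₁.add h'.weak₁ using 1
    ext x; simp only [Pi.add_apply]; ring
  weak₂ := h.weak₂.add h'.weak₂

theorem const_mul (h : MagH1 a u v₁ v₂) (c : ℂ) :
    MagH1 a (fun x => c * u x) (fun x => c * v₁ x) (fun x => c * v₂ x) where
  memLp := h.memLp.const_mul c
  memLp₁ := h.memLp₁.const_mul c
  memLp₂ := h.memLp₂.const_mul c
  weak₁ := by
    have hfun : (fun x => c * v₁ x + Complex.I * (pot a x : ℂ) * (c * u x)) =
        fun x => ContinuousLinearMap.mul ℝ ℂ c (v₁ x + Complex.I * (pot a x : ℂ) * u x) := by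
      ext x; simp only [ContinuousLinearMap.mul_apply']; ring
    rw [hfun]
    exact h.weak₁.clm_comp (ContinuousLinearMap.mul ℝ ℂ c)
  weak₂ := h.weak₂.clm_comp (ContinuousLinearMap.mul ℝ ℂ c)

theorem smul (h : MagH1 a u v₁ v₂) {χ : ℝ × ℝ → ℝ} (hχ : ContDiff ℝ ∞ χ) {C : ℝ}
    (h0 : ∀ x, |χ x| ≤ C) (h1 : ∀ x, |d1 χ x| ≤ C) (h2 : ∀ x, |d2 χ x| ≤ C) :
    MagH1 a (fun x => χ x • u x) (fun x => χ x • v₁ x + d1 χ x • u x)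
      (fun x => χ x • v₂ x + d2 χ x • u x) := by
  have hmeas := hχ.continuous.aestronglyMeasurable (μ := volume)
  have hmeas' (e : ℝ × ℝ) : AEStronglyMeasurable (fun x => fderiv ℝ χ x e) volume :=
    ((hχ.continuous_fderiv (by simp)).clm_apply continuous_const).aestronglyMeasurable
  exact {
    memLp := memLp_smul_of_abs_le h.memLp hmeas h0
    memLp₁ := (memLp_smul_of_abs_le h.memLp₁ hmeas h0).add
      (memLp_smul_of_abs_le h.memLp (hmeas' _) h1)
    memLp₂ := (memLp_smul_of_abs_le h.memLp₂ hmeas h0).add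
      (memLp_smul_of_abs_le h.memLp (hmeas' _) h2)
    weak₁ := by
      convert h.weak₁.smul hχ using 1
      ext x; simp only [Complex.real_smul, d1]; ring
    weak₂ := h.weak₂.smul hχ }

theorem smul_fst (h : MagH1 a u v₁ v₂) {k : ℝ → ℝ} (hk : ContDiff ℝ ∞ k) {C : ℝ}
    (h0 : ∀ x, |k x| ≤ C) (h1 : ∀ x, |deriv k x| ≤ C) :
    MagH1 a (fun x => k x.1 • u x) (fun x => k x.1 • v₁ x + deriv k x.1 • u x)
      (fun x => k x.1 • v₂ x) := by
  have hd : Differentiable ℝ k := hk.differentiable (by simp)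
  have := h.smul (χ := fun x => k x.1) (hk.comp contDiff_fst) (C := C) (fun x => h0 _)
    (fun x => by rw [d1_comp_fst hd]; exact h1 _)
    (fun x => by rw [d2_comp_fst hd, abs_zero]; exact (abs_nonneg _).trans (h0 0))
  simpa only [d1_comp_fst hd, d2_comp_fst hd, zero_smul, add_zero] using this

theorem smul_snd (h : MagH1 a u v₁ v₂) {k : ℝ → ℝ} (hk : ContDiff ℝ ∞ k) {C : ℝ}
    (h0 : ∀ x, |k x| ≤ C) (h1 : ∀ x, |deriv k x| ≤ C) :
    MagH1 a (fun x => k x.2 • u x) (fun x => k x.2 • v₁ x)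
      (fun x => k x.2 • v₂ x + deriv k x.2 • u x) := by
  have hd : Differentiable ℝ k := hk.differentiable (by simp)
  have := h.smul (χ := fun x => k x.2) (hk.comp contDiff_snd) (C := C) (fun x => h0 _)
    (fun x => by rw [d1_comp_snd hd, abs_zero]; exact (abs_nonneg _).trans (h0 0))
    (fun x => by rw [d2_comp_snd hd]; exact h1 _)
  simpa only [d1_comp_snd hd, d2_comp_snd hd, zero_smul, add_zero] using this

theorem comp_add_fst (h : MagH1 a u v₁ v₂) (s : ℝ) :
    MagH1 a (fun x => u (x + (s, 0))) (fun x => v₁ (x + (s, 0))) (fun x => v₂ (x + (s, 0))) := by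
  have hp := measurePreserving_add_right (volume : Measure (ℝ × ℝ)) (s, 0)
  exact {
    memLp := h.memLp.comp_measurePreserving hp
    memLp₁ := h.memLp₁.comp_measurePreserving hp
    memLp₂ := h.memLp₂.comp_measurePreserving hp
    weak₁ := by simpa only [pot_add_fst] using h.weak₁.comp_add_right (s, 0)
    weak₂ := h.weak₂.comp_add_right (s, 0) }

end MagH1

/-! ### The strip problem in terms of functions on the plane -/

theorem measurableSet_strip (R : ℝ) : MeasurableSet (strip R) :=
  measurableSet_Ioo.prod MeasurableSet.univ

theorem setIntegral_strip_eq {E : Type*} [NormedAddCommGroup E] [NormedSpace ℝ E]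
    {f : ℝ × ℝ → E} (hf : ∀ x, x ∉ strip R → f x = 0) : ∫ x in strip R, f x = ∫ x, f x :=
  setIntegral_eq_integral_of_forall_compl_eq_zero hf

/-- The lateral boundary does not enter in the direction `x₂`: multiplying the test function by
cutoffs in `x₁` reduces the claim to the weak equation inside the strip. -/
theorem InDomain.setIntegral_weak₂_eq_zero (h : InDomain a R u v₁ v₂) {φ : ℝ × ℝ → ℝ}
    (hφ : IsTestFunction φ) : ∫ x in strip R, (fderiv ℝ φ x (0, 1) • u x + φ x • v₂ x) = 0 := by
  have hu := h.memLp.locallyIntegrable (by norm_num)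
  have hv := h.memLp_grad₂.locallyIntegrable (by norm_num)
  obtain ⟨k, hk, hks, hk1, hklim⟩ :=
    exists_seq_contDiff_tsupport_subset (isOpen_Ioo : IsOpen (Ioo (-R / 2) (R / 2)))
  have hcut (n : ℕ) :
      ∫ x in strip R, k n x.1 • (fderiv ℝ φ x (0, 1) • u x + φ x • v₂ x) = 0 := by
    have hkd : Differentiable ℝ (k n) := (hk n).differentiable (by simp)
    have hkφ : IsTestFunction fun x : ℝ × ℝ => k n x.1 • φ x :=
      hφ.smul_left (χ := fun x => k n x.1) ((hk n).comp contDiff_fst)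
    have hsupp : tsupport (fun x : ℝ × ℝ => k n x.1 • φ x) ⊆ strip R := fun x hx =>
      ⟨hks n (tsupport_comp_subset_preimage (k n) continuous_fst
        (tsupport_smul_subset_left (fun x : ℝ × ℝ => k n x.1) φ hx)), mem_univ _⟩
    have hweak := (h.grad _ (isTest_iff.2 hkφ) hsupp).2
    simp only [d2] at hweak
    rw [integral_neg, eq_neg_iff_add_eq_zero, ← integral_add (hkφ.integrable_smul hv)
      ((hkφ.fderiv_apply (0, 1)).integrable_smul hu)] at hweak
    rw [← hweak]
    congr 1; ext x
    have hderiv : fderiv ℝ (fun y : ℝ × ℝ => k n y.1 • φ y) x (0, 1) =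
        k n x.1 * fderiv ℝ φ x (0, 1) := by
      have hkx := hasFDerivAt_comp_fst hkd x
      rw [fderiv_fun_smul hkx.differentiableAt (hφ.differentiable x), hkx.fderiv]
      simp
    rw [hderiv]
    module
  have hlim := tendsto_integral_smul (k := fun n x => k n x.1) (l := 1)
    (((hφ.fderiv_apply (0, 1)).integrable_smul hu).add (hφ.integrable_smul hv))
    (fun n => ((hk n).continuous.comp continuous_fst).aestronglyMeasurable) (fun n x => hk1 n x.1)
    ((ae_restrict_mem (measurableSet_strip R)).mono fun x hx => hklim x.1 hx.1)
  simp only [Pi.add_apply, hcut, Pi.one_apply, one_smul] at hlim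
  exact tendsto_nhds_unique hlim tendsto_const_nhds

theorem InDomain.magH1_indicator (h : InDomain a R u v₁ v₂) :
    MagH1 a ((strip R).indicator u) ((strip R).indicator v₁) ((strip R).indicator v₂) := by
  have hS := measurableSet_strip R
  have hu := (memLp_indicator_iff_restrict hS).2 h.memLp
  have hv₁ := (memLp_indicator_iff_restrict hS).2 h.memLp_grad₁
  have hv₂ := (memLp_indicator_iff_restrict hS).2 h.memLp_grad₂
  refine ⟨hu, hv₁, hv₂, ⟨hu.locallyIntegrable (by norm_num), (hv₁.locallyIntegrable
    (by norm_num)).add (locallyIntegrable_pot_mul a (hu.locallyIntegrable (by norm_num))), ?_⟩,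
    hu.locallyIntegrable (by norm_num), hv₂.locallyIntegrable (by norm_num), ?_⟩
  · intro φ hφ
    have htrace := h.trace_zero.2.2 φ (isTest_iff.2 hφ)
    simp only [Pi.zero_apply, smul_zero, integral_zero, sub_zero] at htrace
    rw [← htrace, ← integral_indicator hS]
    congr 1; ext x
    by_cases hx : x ∈ strip R <;> simp [hx, d1]
  · intro φ hφ
    rw [← h.setIntegral_weak₂_eq_zero hφ, ← integral_indicator hS]
    congr 1; ext x
    by_cases hx : x ∈ strip R <;> simp [hx]

theorem isWeakMagGrad_univ_iff (hu : MemLp u 2 volume) (h₁ : MemLp v₁ 2 volume)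
    (h₂ : MemLp v₂ 2 volume) : IsWeakMagGrad a univ u v₁ v₂ ↔ MagH1 a u v₁ v₂ := by
  have hu' := hu.locallyIntegrable (by norm_num)
  have h₁' := h₁.locallyIntegrable (by norm_num)
  have h₂' := h₂.locallyIntegrable (by norm_num)
  have diff₁ {φ : ℝ × ℝ → ℝ} (hφ : IsTestFunction φ) :
      (∫ x, φ x • v₁ x) -
          ∫ x, (-(fderiv ℝ φ x (1, 0) • u x) - φ x • (Complex.I * (pot a x : ℂ) * u x)) =
        ∫ x, (fderiv ℝ φ x (1, 0) • u x + φ x • (v₁ x + Complex.I * (pot a x : ℂ) * u x)) := by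
    have hright : Integrable fun x =>
        -(fderiv ℝ φ x (1, 0) • u x) - φ x • (Complex.I * (pot a x : ℂ) * u x) :=
      ((hφ.fderiv_apply _).integrable_smul hu').neg.sub
        (hφ.integrable_smul (locallyIntegrable_pot_mul a hu'))
    rw [← integral_sub (hφ.integrable_smul h₁') hright]
    congr 1; ext x
    simp only [smul_add]; abel
  have diff₂ {φ : ℝ × ℝ → ℝ} (hφ : IsTestFunction φ) :
      (∫ x, φ x • v₂ x) - ∫ x, -(fderiv ℝ φ x (0, 1) • u x) =
        ∫ x, (fderiv ℝ φ x (0, 1) • u x + φ x • v₂ x) := by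
    rw [← integral_sub (hφ.integrable_smul h₂')
      ((hφ.fderiv_apply _).integrable_smul hu').fun_neg]
    congr 1; ext x
    abel
  simp only [IsWeakMagGrad, Measure.restrict_univ, d1, d2, subset_univ, forall_const, isTest_iff]
  constructor
  · intro h
    exact ⟨hu, h₁, h₂, ⟨hu', h₁'.add (locallyIntegrable_pot_mul a hu'), fun φ hφ => by
      rw [← diff₁ hφ, (h φ hφ).1, sub_self]⟩, ⟨hu', h₂', fun φ hφ => by
      rw [← diff₂ hφ, (h φ hφ).2, sub_self]⟩⟩
  · intro h φ hφ
    exact ⟨sub_eq_zero.1 ((diff₁ hφ).trans (h.weak₁.integral_eq_zero φ hφ)),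
      sub_eq_zero.1 ((diff₂ hφ).trans (h.weak₂.integral_eq_zero φ hφ))⟩

theorem MagH1.inDomain (h : MagH1 a u v₁ v₂)
    (hs : ∀ x, x ∉ strip R → u x = 0 ∧ v₁ x = 0 ∧ v₂ x = 0) : InDomain a R u v₁ v₂ where
  memLp := h.memLp.restrict _
  memLp_grad₁ := h.memLp₁.restrict _
  memLp_grad₂ := h.memLp₂.restrict _
  grad φ hφ _ := by
    have := (isWeakMagGrad_univ_iff h.memLp h.memLp₁ h.memLp₂).2 h φ hφ (subset_univ _)
    simp only [Measure.restrict_univ] at this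
    constructor
    · rw [setIntegral_strip_eq fun x hx => by simp [hs x hx],
        setIntegral_strip_eq fun x hx => by simp [hs x hx], this.1]
    · rw [setIntegral_strip_eq fun x hx => by simp [hs x hx],
        setIntegral_strip_eq fun x hx => by simp [hs x hx], this.2]
  trace_zero := ⟨locallyIntegrable_zero, locallyIntegrable_zero, fun φ hφ => by
    rw [setIntegral_strip_eq fun x hx => by simp [hs x hx]]
    simpa [d1] using h.weak₁.integral_eq_zero φ (isTest_iff.1 hφ)⟩

/-- The Ginzburg--Landau energy on the plane, with the quadratic and quartic parts integrated
separately; it is the energy of a strip for configurations extended by zero. -/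
def planeEnergy (b : ℝ) (u v₁ v₂ : ℝ × ℝ → ℂ) : ℝ :=
  b * ((∫ x, ‖v₁ x‖ ^ 2) + ∫ x, ‖v₂ x‖ ^ 2) - (∫ x, ‖u x‖ ^ 2) + (1 / 2) * ∫ x, ‖u x‖ ^ 4

/-- Admissible configurations of the strip problem, extended by zero to the plane. Finiteness of
the quartic energy is part of the definition. -/
structure IsAdmissible (a R : ℝ) (u v₁ v₂ : ℝ × ℝ → ℂ) : Prop where
  magH1 : MagH1 a u v₁ v₂
  eq_zero : ∀ x, x ∉ strip R → u x = 0 ∧ v₁ x = 0 ∧ v₂ x = 0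
  quartic : Integrable fun x => ‖u x‖ ^ 4

theorem IsAdmissible.zero (a R : ℝ) : IsAdmissible a R 0 0 0 :=
  ⟨MagH1.zero a, fun _ _ => by simp, by simp⟩

theorem MagH1.integrable_quadratic (h : MagH1 a u v₁ v₂) (b : ℝ) :
    Integrable fun x => b * (‖v₁ x‖ ^ 2 + ‖v₂ x‖ ^ 2) - ‖u x‖ ^ 2 :=
  (((integrable_norm_sq h.memLp₁).add (integrable_norm_sq h.memLp₂)).const_mul b).sub
    (integrable_norm_sq h.memLp)

theorem MagH1.integral_energy (h : MagH1 a u v₁ v₂) (hq : Integrable fun x => ‖u x‖ ^ 4) :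
    ∫ x, (b * (‖v₁ x‖ ^ 2 + ‖v₂ x‖ ^ 2) - ‖u x‖ ^ 2 + (1 / 2) * ‖u x‖ ^ 4) =
      planeEnergy b u v₁ v₂ := by
  have hv := (integrable_norm_sq h.memLp₁).fun_add (integrable_norm_sq h.memLp₂)
  rw [integral_add (h.integrable_quadratic b) (hq.const_mul _), integral_sub (hv.const_mul b)
    (integrable_norm_sq h.memLp), integral_const_mul, integral_const_mul,
    integral_add (integrable_norm_sq h.memLp₁) (integrable_norm_sq h.memLp₂), planeEnergy]

theorem InDomain.exists_isAdmissible (h : InDomain a R u v₁ v₂) :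
    ∃ u' v₁' v₂', IsAdmissible a R u' v₁' v₂' ∧ energy b R u v₁ v₂ = planeEnergy b u' v₁' v₂' := by
  have hm := h.magH1_indicator
  have henergy : energy b R u v₁ v₂ = ∫ x, (b * (‖(strip R).indicator v₁ x‖ ^ 2 +
      ‖(strip R).indicator v₂ x‖ ^ 2) - ‖(strip R).indicator u x‖ ^ 2 +
      (1 / 2) * ‖(strip R).indicator u x‖ ^ 4) := by
    rw [energy, ← integral_indicator (measurableSet_strip R)]
    congr 1; ext x
    by_cases hx : x ∈ strip R <;> simp [hx]
  by_cases hq : Integrable fun x => ‖(strip R).indicator u x‖ ^ 4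
  · exact ⟨_, _, _, ⟨hm, fun x hx => by simp [hx], hq⟩, henergy.trans (hm.integral_energy hq)⟩
  · refine ⟨0, 0, 0, IsAdmissible.zero a R, ?_⟩
    rw [henergy, integral_undef]
    · simp [planeEnergy]
    · intro hint
      refine hq (((hint.sub (hm.integrable_quadratic b)).const_mul 2).congr
        (.of_forall fun x => ?_))
      simp only [Pi.sub_apply]; ring

theorem IsAdmissible.planeEnergy_mem (h : IsAdmissible a R u v₁ v₂) :
    planeEnergy b u v₁ v₂ ∈ energyValues a b R :=
  ⟨u, v₁, v₂, h.magH1.inDomain h.eq_zero, by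
    rw [energy, setIntegral_strip_eq fun x hx => by simp [h.eq_zero x hx],
      h.magH1.integral_energy h.quartic]⟩

theorem mem_energyValues_iff {E : ℝ} :
    E ∈ energyValues a b R ↔
      ∃ u v₁ v₂ : ℝ × ℝ → ℂ, IsAdmissible a R u v₁ v₂ ∧ E = planeEnergy b u v₁ v₂ :=
  ⟨fun ⟨_, _, _, h, hE⟩ => hE ▸ h.exists_isAdmissible,
    fun ⟨_, _, _, h, hE⟩ => hE ▸ h.planeEnergy_mem⟩

theorem zero_mem_energyValues (a b R : ℝ) : (0 : ℝ) ∈ energyValues a b R :=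
  mem_energyValues_iff.2 ⟨0, 0, 0, IsAdmissible.zero a R, by simp [planeEnergy]⟩

end Plane

/-! ### Approximation in `L^p` by mollification and truncation -/

theorem eLpNorm_rpow_toReal {α F : Type*} [MeasurableSpace α] [NormedAddCommGroup F]
    {μ : Measure α} {p : ℝ≥0∞} (hp0 : p ≠ 0) (hp : p ≠ ⊤) (f : α → F) :
    eLpNorm f p μ ^ p.toReal = ∫⁻ x, ‖f x‖ₑ ^ p.toReal ∂μ := by
  rw [eLpNorm_eq_lintegral_rpow_enorm_toReal hp0 hp, one_div,
    ENNReal.rpow_inv_rpow (ENNReal.toReal_pos hp0 hp).ne']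

theorem eLpNorm_integral_rpow_le {α β F : Type*} [MeasurableSpace α] [MeasurableSpace β]
    [NormedAddCommGroup F] [NormedSpace ℝ F] {μ : Measure α} {ν : Measure β} [SFinite μ]
    [IsProbabilityMeasure ν] {p : ℝ≥0∞} (hp1 : 1 ≤ p) (hp : p ≠ ⊤) {g : α → β → F}
    (hg : AEStronglyMeasurable (Function.uncurry g) (μ.prod ν)) :
    eLpNorm (fun x => ∫ y, g x y ∂ν) p μ ^ p.toReal ≤
      ∫⁻ y, eLpNorm (fun x => g x y) p μ ^ p.toReal ∂ν := by
  have hp0 : p ≠ 0 := (zero_lt_one.trans_le hp1).ne'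
  have jensen : ∀ᵐ x ∂μ, ‖∫ y, g x y ∂ν‖ₑ ^ p.toReal ≤ ∫⁻ y, ‖g x y‖ₑ ^ p.toReal ∂ν := by
    filter_upwards [hg.prodMk_left] with x hx
    rw [← eLpNorm_rpow_toReal hp0 hp]
    gcongr
    calc ‖∫ y, g x y ∂ν‖ₑ ≤ eLpNorm (g x) 1 ν := by
          rw [eLpNorm_one_eq_lintegral_enorm]; exact enorm_integral_le_lintegral_enorm _
      _ ≤ eLpNorm (g x) p ν := eLpNorm_le_eLpNorm_of_exponent_le hp1 hx
  calc eLpNorm (fun x => ∫ y, g x y ∂ν) p μ ^ p.toReal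
      ≤ ∫⁻ x, ∫⁻ y, ‖g x y‖ₑ ^ p.toReal ∂ν ∂μ := by
        rw [eLpNorm_rpow_toReal hp0 hp]; exact lintegral_mono_ae jensen
    _ = ∫⁻ y, ∫⁻ x, ‖g x y‖ₑ ^ p.toReal ∂μ ∂ν :=
        lintegral_lintegral_swap (hg.enorm.pow_const _)
    _ = ∫⁻ y, eLpNorm (fun x => g x y) p μ ^ p.toReal ∂ν := by
        simp only [eLpNorm_rpow_toReal hp0 hp]

theorem tendsto_eLpNorm_smul_zero {α F : Type*} [MeasurableSpace α] [NormedAddCommGroup F]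
    [NormedSpace ℝ F] {μ : Measure α} {p : ℝ≥0∞} (hp0 : p ≠ 0) (hp : p ≠ ⊤) {f : α → F}
    (hf : MemLp f p μ) {k : ℕ → α → ℝ} {C : ℝ} (hk : ∀ n, AEStronglyMeasurable (k n) μ)
    (hkC : ∀ n x, |k n x| ≤ C) (hlim : ∀ᵐ x ∂μ, Tendsto (fun n => k n x) atTop (𝓝 0)) :
    Tendsto (fun n => eLpNorm (fun x => k n x • f x) p μ) atTop (𝓝 0) := by
  have hp' : 0 < p.toReal := ENNReal.toReal_pos hp0 hp
  simp only [eLpNorm_eq_lintegral_rpow_enorm_toReal hp0 hp]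
  rw [← ENNReal.zero_rpow_of_pos (one_div_pos.2 hp')]
  refine Tendsto.ennrpow_const _ ?_
  rw [← lintegral_zero (μ := μ)]
  have hCf : MemLp (fun x => C • f x) p μ := hf.const_smul C
  refine tendsto_lintegral_of_dominated_convergence' (fun x => ‖C • f x‖ₑ ^ p.toReal)
    (fun n => ((hk n).smul hf.1).enorm.pow_const _) (fun n => .of_forall fun x => ?_) ?_ ?_
  · refine ENNReal.rpow_le_rpow ?_ hp'.le
    rw [enorm_le_iff_norm_le, norm_smul, norm_smul]
    gcongr
    exact (hkC n x).trans (le_abs_self C)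
  · exact (lintegral_rpow_enorm_lt_top_of_eLpNorm_lt_top hp0 hp hCf.2).ne
  · filter_upwards [hlim] with x hx
    have := ((hx.smul_const (f x)).enorm).ennrpow_const p.toReal
    simpa [hp'] using this

section Mollification

variable {E F : Type*} [NormedAddCommGroup E] [NormedSpace ℝ E] [FiniteDimensional ℝ E]
  [MeasurableSpace E] [BorelSpace E] [NormedAddCommGroup F] {μ : Measure E} [μ.IsAddHaarMeasure]
  {p : ℝ≥0∞} {f : E → F}

theorem tendsto_eLpNorm_comp_sub_right [Fact (1 ≤ p)] (hp : p ≠ ⊤) (hf : MemLp f p μ) :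
    Tendsto (fun y => eLpNorm (fun x => f (x - y) - f x) p μ) (𝓝 0) (𝓝 0) := by
  let τ : C(E, C(E, E)) := ContinuousMap.curry ⟨fun q : E × E => q.2 - q.1, by fun_prop⟩
  have hτ (y : E) : MeasurePreserving (τ y) μ μ := measurePreserving_sub_right μ y
  have hlim := Tendsto.compMeasurePreservingLp (f := fun _ => hf.toLp f) tendsto_const_nhds
    (τ.continuous.tendsto 0) hτ (hτ 0) hp
  simp only [Lp.toLp_compMeasurePreserving] at hlim
  have := (Lp.tendsto_Lp_iff_tendsto_eLpNorm'' (fun y => f ∘ τ y)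
    (fun y => hf.comp_measurePreserving (hτ y)) _ (hf.comp_measurePreserving (hτ 0))).1 hlim
  refine this.congr fun y => ?_
  congr 1; ext x
  simp [τ]

variable [NormedSpace ℝ F] [CompleteSpace F]

/-- The convolution is an average of translates for the probability measure with density `ρ`, so
Jensen's inequality applies. -/
theorem eLpNorm_convolution_sub_le (hp1 : 1 ≤ p) (hp : p ≠ ⊤) (hf : MemLp f p μ)
    (φ : ContDiffBump (0 : E)) {ε : ℝ≥0∞}
    (hε : ∀ y ∈ Metric.ball 0 φ.rOut, eLpNorm (fun x => f (x - y) - f x) p μ ≤ ε) :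
    eLpNorm (φ.normed μ ⋆[lsmul ℝ ℝ, μ] f - f) p μ ≤ ε := by
  have hp0 : 0 < p.toReal := ENNReal.toReal_pos (zero_lt_one.trans_le hp1).ne' hp
  set ρ := φ.normed μ with hρ
  have hρm : Measurable fun y => ENNReal.ofReal (ρ y) :=
    (φ.continuous_normed.measurable).ennreal_ofReal
  let ν : Measure E := μ.withDensity fun y => ENNReal.ofReal (ρ y)
  have hν : IsProbabilityMeasure ν := ⟨by
    rw [withDensity_apply _ .univ, Measure.restrict_univ, ← ofReal_integral_eq_lintegral_ofReal
      φ.integrable_normed (.of_forall φ.nonneg_normed), φ.integral_normed, ENNReal.ofReal_one]⟩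
  have hconv : ρ ⋆[lsmul ℝ ℝ, μ] f - f = fun x => ∫ y, (f (x - y) - f x) ∂ν := by
    ext x
    have hint : Integrable (fun y => ρ y • f (x - y)) μ :=
      φ.hasCompactSupport_normed.convolutionExists_left (lsmul ℝ ℝ) φ.continuous_normed
        (hf.locallyIntegrable hp1) x
    rw [integral_withDensity_eq_integral_toReal_smul hρm
      (.of_forall fun _ => ENNReal.ofReal_lt_top)]
    simp only [ENNReal.toReal_ofReal (φ.nonneg_normed _), hρ, smul_sub]
    rw [integral_sub hint (φ.integrable_normed.smul_const _), integral_smul_const,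
      φ.integral_normed, one_smul]
    rfl
  have hmeas : AEStronglyMeasurable (fun q : E × E => f (q.1 - q.2) - f q.1) (μ.prod ν) := by
    refine AEStronglyMeasurable.mono_ac (.prod .rfl (withDensity_absolutelyContinuous _ _)) ?_
    exact (hf.1.comp_quasiMeasurePreserving (quasiMeasurePreserving_sub μ μ)).sub
      (hf.1.comp_quasiMeasurePreserving Measure.quasiMeasurePreserving_fst)
  have hsmall : ∀ᵐ y ∂ν, eLpNorm (fun x => f (x - y) - f x) p μ ^ p.toReal ≤ ε ^ p.toReal := by
    refine (ae_withDensity_iff hρm).2 (.of_forall fun y hy => ?_)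
    have hyρ : y ∈ Function.support ρ := fun h => hy (by simp [h])
    rw [hρ, φ.support_normed_eq] at hyρ
    gcongr
    exact hε y hyρ
  rw [← ENNReal.rpow_le_rpow_iff hp0, hconv]
  refine (eLpNorm_integral_rpow_le hp1 hp hmeas).trans ?_
  simpa using lintegral_mono_ae hsmall

theorem tendsto_eLpNorm_convolution_sub [Fact (1 ≤ p)] (hp : p ≠ ⊤) (hf : MemLp f p μ)
    {ι : Type*} {l : Filter ι} {φ : ι → ContDiffBump (0 : E)}
    (hφ : Tendsto (fun i => (φ i).rOut) l (𝓝 0)) :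
    Tendsto (fun i => eLpNorm ((φ i).normed μ ⋆[lsmul ℝ ℝ, μ] f - f) p μ) l (𝓝 0) := by
  rw [ENNReal.tendsto_nhds_zero]
  intro ε hε
  obtain ⟨δ, hδ, hball⟩ := Metric.eventually_nhds_iff_ball.1
    ((tendsto_eLpNorm_comp_sub_right hp hf).eventually_le_const hε)
  filter_upwards [hφ.eventually_lt_const hδ] with i hi
  exact eLpNorm_convolution_sub_le Fact.out hp hf (φ i)
    fun y hy => hball y (Metric.ball_subset_ball hi.le hy)

end Mollification

theorem exists_seq_isTestFunction_tendsto_one (E : Type*) [NormedAddCommGroup E]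
    [NormedSpace ℝ E] [FiniteDimensional ℝ E] :
    ∃ χ : ℕ → E → ℝ, (∀ n, IsTestFunction (χ n)) ∧ (∀ n x, |χ n x| ≤ 1) ∧
      (∀ x, Tendsto (fun n => χ n x) atTop (𝓝 1)) ∧
      ∀ e, (∃ C, ∀ n x, |fderiv ℝ (χ n) x e| ≤ C) ∧
        ∀ x, Tendsto (fun n => fderiv ℝ (χ n) x e) atTop (𝓝 0) := by
  let B : ContDiffBump (0 : E) := ⟨1, 2, one_pos, one_lt_two⟩
  have hB : IsTestFunction B := ⟨B.contDiff, B.hasCompactSupport⟩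
  let c : ℕ → ℝ := fun n => 1 / ((n : ℝ) + 1)
  have hc0 (n : ℕ) : 0 < c n := Nat.one_div_pos_of_nat
  have hc1 (n : ℕ) : c n ≤ 1 := div_le_self zero_le_one (by simp)
  have hc : Tendsto c atTop (𝓝 0) := tendsto_one_div_add_atTop_nhds_zero_nat
  have hcx (x : E) : Tendsto (fun n => c n • x) atTop (𝓝 0) := by
    simpa using hc.smul_const x
  have hderiv (n : ℕ) (x e : E) :
      fderiv ℝ (fun x => B (c n • x)) x e = c n * fderiv ℝ B (c n • x) e := by
    rw [fderiv_comp_smul]; simp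
  have hbdd (e : E) : ∃ C, ∀ x, |fderiv ℝ B x e| ≤ C :=
    (hB.fderiv_apply e).continuous.bounded_above_of_compact_support
      (hB.fderiv_apply e).hasCompactSupport
  refine ⟨fun n x => B (c n • x), fun n => ⟨hB.contDiff.comp (contDiff_const_smul (c n)),
    hB.hasCompactSupport.comp_smul (hc0 n).ne'⟩, fun n x => ?_, fun x => ?_, fun e => ⟨?_, ?_⟩⟩
  · rw [abs_of_nonneg B.nonneg]; exact B.le_one
  · have := (B.continuous.tendsto 0).comp (hcx x)
    rwa [B.one_of_mem_closedBall (by simp [B])] at this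
  · obtain ⟨C, hC⟩ := hbdd e
    refine ⟨C, fun n x => ?_⟩
    rw [hderiv, abs_mul, abs_of_pos (hc0 n)]
    exact (mul_le_of_le_one_left (abs_nonneg _) (hc1 n)).trans (hC _)
  · intro x
    simp only [hderiv]
    simpa using hc.mul (((hB.fderiv_apply e).continuous.tendsto 0).comp (hcx x))

/-! ### Density of test functions in the magnetic Sobolev space -/

section Density

variable {a : ℝ} {u v₁ v₂ : ℝ × ℝ → ℂ}

/-- The magnetic derivative `(∂₁ - i σ A₀) ϕ` of a smooth function. -/
def mag1 (a : ℝ) (ϕ : ℝ × ℝ → ℂ) (x : ℝ × ℝ) : ℂ :=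
  fderiv ℝ ϕ x (1, 0) - Complex.I * (pot a x : ℂ) * ϕ x

/-- The magnetic derivative `∂₂ ϕ` of a smooth function. -/
def mag2 (ϕ : ℝ × ℝ → ℂ) (x : ℝ × ℝ) : ℂ := fderiv ℝ ϕ x (0, 1)

/-- The distance between `u` and `u'` in the norm of the magnetic Sobolev space; the magnetic
gradients are carried along explicitly. -/
def graphDist (u v₁ v₂ u' v₁' v₂' : ℝ × ℝ → ℂ) : ℝ≥0∞ :=
  eLpNorm (u - u') 2 volume + eLpNorm (v₁ - v₁') 2 volume + eLpNorm (v₂ - v₂') 2 volume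

theorem graphDist_triangle {u v₁ v₂ u' v₁' v₂' u'' v₁'' v₂'' : ℝ × ℝ → ℂ} (h : MagH1 a u v₁ v₂)
    (h' : MagH1 a u' v₁' v₂') (h'' : MagH1 a u'' v₁'' v₂'') :
    graphDist u v₁ v₂ u'' v₁'' v₂'' ≤
      graphDist u v₁ v₂ u' v₁' v₂' + graphDist u' v₁' v₂' u'' v₁'' v₂'' := by
  have key {f g k : ℝ × ℝ → ℂ} (hf : MemLp f 2 volume) (hg : MemLp g 2 volume)
      (hk : MemLp k 2 volume) : eLpNorm (f - k) 2 volume ≤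
      eLpNorm (f - g) 2 volume + eLpNorm (g - k) 2 volume := by
    simpa using eLpNorm_add_le (hf.sub hg).1 (hg.sub hk).1 one_le_two
  calc graphDist u v₁ v₂ u'' v₁'' v₂'' ≤ _ := add_le_add_three
        (key h.memLp h'.memLp h''.memLp) (key h.memLp₁ h'.memLp₁ h''.memLp₁)
        (key h.memLp₂ h'.memLp₂ h''.memLp₂)
    _ = _ := by simp only [graphDist]; ring

theorem abs_pot_le (a : ℝ) (x : ℝ × ℝ) : |pot a x| ≤ (1 + |a|) * ‖x‖ := by
  unfold pot step
  rw [abs_mul, abs_neg]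
  gcongr
  · split_ifs <;> simp
  · exact norm_snd_le x

theorem norm_pot_mul_le {f : ℝ × ℝ → ℂ} {r : ℝ} (hf : ∀ x, r < ‖x‖ → f x = 0) (x : ℝ × ℝ) :
    ‖Complex.I * (pot a x : ℂ) * f x‖ ≤ (1 + |a|) * r * ‖f x‖ := by
  by_cases hx : r < ‖x‖
  · simp [hf x hx]
  · rw [norm_mul, norm_mul, Complex.norm_I, one_mul, Complex.norm_real, Real.norm_eq_abs]
    gcongr
    exact (abs_pot_le a x).trans (by gcongr; exact not_lt.1 hx)

theorem aestronglyMeasurable_pot_mul {f : ℝ × ℝ → ℂ} (hf : AEStronglyMeasurable f volume) :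
    AEStronglyMeasurable (fun x => Complex.I * (pot a x : ℂ) * f x) volume :=
  ((Complex.continuous_ofReal.comp (continuous_pot a)).const_smul
    Complex.I).aestronglyMeasurable.mul hf

theorem memLp_pot_mul {f : ℝ × ℝ → ℂ} {r : ℝ} (hf : MemLp f 2 volume)
    (hs : ∀ x, r < ‖x‖ → f x = 0) : MemLp (fun x => Complex.I * (pot a x : ℂ) * f x) 2 volume :=
  hf.of_le_mul (aestronglyMeasurable_pot_mul hf.1) (.of_forall (norm_pot_mul_le hs))

theorem IsTestFunction.magH1 {ϕ : ℝ × ℝ → ℂ} (h : IsTestFunction ϕ) (a : ℝ) :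
    MagH1 a ϕ (mag1 a ϕ) (mag2 ϕ) where
  memLp := h.memLp 2
  memLp₁ := by
    obtain ⟨r, hr⟩ := h.hasCompactSupport.isCompact.isBounded.subset_closedBall 0
    refine ((h.fderiv_apply (1, 0)).memLp 2).sub (memLp_pot_mul (r := r) (h.memLp 2) fun x hx => ?_)
    by_contra hne
    exact hx.not_ge (by simpa using hr (subset_tsupport ϕ hne))
  memLp₂ := (h.fderiv_apply (0, 1)).memLp 2
  weak₁ := by simpa [mag1] using HasWeakLineDeriv.of_isTestFunction h (1, 0)
  weak₂ := HasWeakLineDeriv.of_isTestFunction h (0, 1)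

theorem convolution_normed_eq_zero {φ : ContDiffBump (0 : ℝ × ℝ)} {r : ℝ}
    (hs : ∀ x, r < ‖x‖ → u x = 0) {x : ℝ × ℝ} (hx : r + φ.rOut < ‖x‖) :
    (φ.normed volume ⋆[lsmul ℝ ℝ, volume] u) x = 0 := by
  refine integral_eq_zero_of_ae (.of_forall fun y => ?_)
  by_cases hy : y ∈ Metric.ball 0 φ.rOut
  · have hyx := norm_sub_norm_le x y
    rw [mem_ball_zero_iff] at hy
    simp [hs (x - y) (by linarith)]
  · rw [← φ.support_normed_eq (μ := volume), Function.notMem_support] at hy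
    simp [hy]

theorem MagH1.eLpNorm_mag1_convolution_sub_le (h : MagH1 a u v₁ v₂) {r : ℝ}
    (hs : ∀ x, r < ‖x‖ → u x = 0) {φ : ContDiffBump (0 : ℝ × ℝ)} (hφ : φ.rOut ≤ 1) :
    eLpNorm (mag1 a (φ.normed volume ⋆[lsmul ℝ ℝ, volume] u) - v₁) 2 volume ≤
      eLpNorm ((φ.normed volume ⋆[lsmul ℝ ℝ, volume]
          fun x => v₁ x + Complex.I * (pot a x : ℂ) * u x) -
        fun x => v₁ x + Complex.I * (pot a x : ℂ) * u x) 2 volume +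
      ENNReal.ofReal ((1 + |a|) * (r + 1)) *
        eLpNorm (φ.normed volume ⋆[lsmul ℝ ℝ, volume] u - u) 2 volume := by
  set ρ := φ.normed volume
  set w : ℝ × ℝ → ℂ := fun x => v₁ x + Complex.I * (pot a x : ℂ) * u x with hw
  have hρ : IsTestFunction ρ := ⟨φ.contDiff_normed, φ.hasCompactSupport_normed⟩
  have hm {f : ℝ × ℝ → ℂ} (hf : LocallyIntegrable f volume) :
      AEStronglyMeasurable (ρ ⋆[lsmul ℝ ℝ, volume] f - f) volume :=
    (hρ.hasCompactSupport.continuous_convolution_left _ hρ.continuous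
      hf).aestronglyMeasurable.sub hf.aestronglyMeasurable
  have hfar (x : ℝ × ℝ) (hx : r + 1 < ‖x‖) : (ρ ⋆[lsmul ℝ ℝ, volume] u - u) x = 0 := by
    rw [Pi.sub_apply, convolution_normed_eq_zero hs (by linarith), hs x (by linarith), sub_zero]
  have hsplit : mag1 a (ρ ⋆[lsmul ℝ ℝ, volume] u) - v₁ = (ρ ⋆[lsmul ℝ ℝ, volume] w - w) -
      fun x => Complex.I * (pot a x : ℂ) * (ρ ⋆[lsmul ℝ ℝ, volume] u - u) x := by
    ext x
    simp only [Pi.sub_apply, mag1, h.weak₁.fderiv_convolution hρ, hw]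
    ring
  rw [hsplit]
  exact (eLpNorm_sub_le (hm h.weak₁.locallyIntegrable_deriv)
    (aestronglyMeasurable_pot_mul (hm h.locallyIntegrable)) one_le_two).trans (add_le_add le_rfl
      (eLpNorm_le_mul_eLpNorm_of_ae_le_mul (.of_forall (norm_pot_mul_le hfar)) 2))

theorem MagH1.tendsto_graphDist_convolution (h : MagH1 a u v₁ v₂) {r : ℝ}
    (hs : ∀ x, r < ‖x‖ → u x = 0) {φ : ℕ → ContDiffBump (0 : ℝ × ℝ)} (hφ1 : ∀ n, (φ n).rOut ≤ 1)
    (hφ : Tendsto (fun n => (φ n).rOut) atTop (𝓝 0)) :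
    Tendsto (fun n => graphDist ((φ n).normed volume ⋆[lsmul ℝ ℝ, volume] u)
      (mag1 a ((φ n).normed volume ⋆[lsmul ℝ ℝ, volume] u))
      (mag2 ((φ n).normed volume ⋆[lsmul ℝ ℝ, volume] u)) u v₁ v₂) atTop (𝓝 0) := by
  have hconv {f : ℝ × ℝ → ℂ} (hf : MemLp f 2 volume) : Tendsto (fun n => eLpNorm
      ((φ n).normed volume ⋆[lsmul ℝ ℝ, volume] f - f) 2 volume) atTop (𝓝 0) :=
    tendsto_eLpNorm_convolution_sub ENNReal.ofNat_ne_top hf hφ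
  have hw : MemLp (fun x => v₁ x + Complex.I * (pot a x : ℂ) * u x) 2 volume :=
    h.memLp₁.add (memLp_pot_mul h.memLp hs)
  have h₂ (n : ℕ) : mag2 ((φ n).normed volume ⋆[lsmul ℝ ℝ, volume] u) =
      (φ n).normed volume ⋆[lsmul ℝ ℝ, volume] v₂ :=
    funext (h.weak₂.fderiv_convolution
      ⟨(φ n).contDiff_normed, (φ n).hasCompactSupport_normed⟩)
  simp only [graphDist, h₂]
  refine tendsto_of_tendsto_of_tendsto_of_le_of_le tendsto_const_nhds ?_ (fun _ => zero_le)
    (fun n => add_le_add_three le_rfl (h.eLpNorm_mag1_convolution_sub_le hs (hφ1 n)) le_rfl)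
  simpa using ((hconv h.memLp).add ((hconv hw).add (ENNReal.Tendsto.const_mul (hconv h.memLp)
    (Or.inr ENNReal.ofReal_ne_top)))).add (hconv h.memLp₂)

theorem MagH1.exists_isTestFunction_of_eq_zero (h : MagH1 a u v₁ v₂) {r : ℝ}
    (hs : ∀ x, r < ‖x‖ → u x = 0) {ε : ℝ≥0∞} (hε : 0 < ε) :
    ∃ ϕ, IsTestFunction ϕ ∧ graphDist ϕ (mag1 a ϕ) (mag2 ϕ) u v₁ v₂ ≤ ε := by
  let c : ℕ → ℝ := fun n => 1 / ((n : ℝ) + 1)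
  have hc (n : ℕ) : 0 < c n := Nat.one_div_pos_of_nat
  let φ : ℕ → ContDiffBump (0 : ℝ × ℝ) := fun n =>
    ⟨c n / 2, c n, half_pos (hc n), half_lt_self (hc n)⟩
  have hu : HasCompactSupport u :=
    HasCompactSupport.intro (isCompact_closedBall (0 : ℝ × ℝ) r)
      fun x hx => hs x (by simpa using hx)
  obtain ⟨n, hn⟩ := ((h.tendsto_graphDist_convolution hs (φ := φ)
    (fun n => div_le_self zero_le_one (by simp)) tendsto_one_div_add_atTop_nhds_zero_nat
    ).eventually_le_const hε).exists
  exact ⟨_, ⟨(φ n).hasCompactSupport_normed.contDiff_convolution_left _ (φ n).contDiff_normed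
    h.locallyIntegrable, .convolution _ (φ n).hasCompactSupport_normed hu⟩, hn⟩

theorem MagH1.exists_truncation (h : MagH1 a u v₁ v₂) {ε : ℝ≥0∞} (hε : 0 < ε) :
    ∃ u' v₁' v₂', MagH1 a u' v₁' v₂' ∧ (∃ r : ℝ, ∀ x, r < ‖x‖ → u' x = 0) ∧
      graphDist u' v₁' v₂' u v₁ v₂ ≤ ε := by
  obtain ⟨χ, hχ, hχ1, hχlim, hχd⟩ := exists_seq_isTestFunction_tendsto_one (ℝ × ℝ)
  obtain ⟨⟨C₁, hC₁⟩, hlim₁⟩ := hχd (1, 0)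
  obtain ⟨⟨C₂, hC₂⟩, hlim₂⟩ := hχd (0, 1)
  have hm (n : ℕ) := h.smul (hχ n).contDiff (C := max 1 (max C₁ C₂)) (by simp [hχ1])
    (by simp [d1, hC₁]) (by simp [d2, hC₂])
  have h2 : (2 : ℝ≥0∞) ≠ ⊤ := ENNReal.ofNat_ne_top
  have hder (e : ℝ × ℝ) (n : ℕ) : AEStronglyMeasurable (fun x => fderiv ℝ (χ n) x e) volume :=
    ((hχ n).fderiv_apply e).continuous.aestronglyMeasurable
  have hsub {f : ℝ × ℝ → ℂ} (hf : MemLp f 2 volume) :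
      Tendsto (fun n => eLpNorm (fun x => (χ n x - 1) • f x) 2 volume) atTop (𝓝 0) :=
    tendsto_eLpNorm_smul_zero two_ne_zero h2 hf (C := 2)
      (fun n => ((hχ n).continuous.sub continuous_const).aestronglyMeasurable)
      (fun n x => (abs_sub _ _).trans (by rw [abs_one]; linarith [hχ1 n x]))
      (.of_forall fun x => by simpa using (hχlim x).sub_const 1)
  have hlim := ((hsub h.memLp).add ((hsub h.memLp₁).add (tendsto_eLpNorm_smul_zero two_ne_zero h2
    h.memLp (hder (1, 0)) hC₁ (.of_forall hlim₁)))).add ((hsub h.memLp₂).add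
    (tendsto_eLpNorm_smul_zero two_ne_zero h2 h.memLp (hder (0, 1)) hC₂ (.of_forall hlim₂)))
  simp only [add_zero] at hlim
  obtain ⟨n, hn⟩ := (hlim.eventually_le_const hε).exists
  obtain ⟨r, hr⟩ := (hχ n).hasCompactSupport.isCompact.isBounded.subset_closedBall 0
  refine ⟨_, _, _, hm n, ⟨r, fun x hx => ?_⟩, le_trans ?_ hn⟩
  · have : χ n x = 0 := by
      by_contra hne
      exact hx.not_ge (by simpa using hr (subset_tsupport _ hne))
    simp [this]
  · have hadd {f : ℝ × ℝ → ℂ} (hf : MemLp f 2 volume) (e : ℝ × ℝ) :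
        eLpNorm ((fun x => χ n x • f x + fderiv ℝ (χ n) x e • u x) - f) 2 volume ≤
          eLpNorm (fun x => (χ n x - 1) • f x) 2 volume +
            eLpNorm (fun x => fderiv ℝ (χ n) x e • u x) 2 volume := by
      refine le_trans (le_of_eq ?_) (eLpNorm_add_le
        ((((hχ n).continuous.sub continuous_const).aestronglyMeasurable).smul hf.1)
        ((hder e n).smul h.memLp.1) one_le_two)
      congr 1; ext x
      simp only [Pi.sub_apply, Pi.add_apply, sub_smul, one_smul]; ring
    refine add_le_add_three (le_of_eq ?_) (hadd h.memLp₁ (1, 0)) (hadd h.memLp₂ (0, 1))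
    congr 1; ext x
    simp only [Pi.sub_apply, sub_smul, one_smul]

theorem MagH1.exists_seq_isTestFunction (h : MagH1 a u v₁ v₂) :
    ∃ ϕ : ℕ → ℝ × ℝ → ℂ, (∀ n, IsTestFunction (ϕ n)) ∧
      Tendsto (fun n => eLpNorm (ϕ n - u) 2 volume) atTop (𝓝 0) ∧
      Tendsto (fun n => eLpNorm (mag1 a (ϕ n) - v₁) 2 volume) atTop (𝓝 0) ∧
      Tendsto (fun n => eLpNorm (mag2 (ϕ n) - v₂) 2 volume) atTop (𝓝 0) := by
  have happrox (n : ℕ) : ∃ ϕ, IsTestFunction ϕ ∧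
      graphDist ϕ (mag1 a ϕ) (mag2 ϕ) u v₁ v₂ ≤ ((n : ℝ≥0∞))⁻¹ := by
    have hε : 0 < (n : ℝ≥0∞)⁻¹ / 2 := by simp
    obtain ⟨u', v₁', v₂', h', ⟨r, hr⟩, hd'⟩ := h.exists_truncation hε
    obtain ⟨ϕ, hϕ, hd⟩ := h'.exists_isTestFunction_of_eq_zero hr hε
    exact ⟨ϕ, hϕ, (graphDist_triangle (hϕ.magH1 a) h' h).trans
      ((add_le_add hd hd').trans_eq (ENNReal.add_halves _))⟩
  choose ϕ hϕ hd using happrox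
  have hlim := tendsto_of_tendsto_of_tendsto_of_le_of_le tendsto_const_nhds
    ENNReal.tendsto_inv_nat_nhds_zero (fun _ => zero_le) hd
  have hle {f : ℕ → ℝ≥0∞} (hf : ∀ n, f n ≤ graphDist (ϕ n) (mag1 a (ϕ n)) (mag2 (ϕ n)) u v₁ v₂) :
      Tendsto f atTop (𝓝 0) :=
    tendsto_of_tendsto_of_tendsto_of_le_of_le tendsto_const_nhds hlim (fun _ => zero_le) hf
  exact ⟨ϕ, hϕ, hle fun n => le_self_add.trans le_self_add,
    hle fun n => le_add_self.trans le_self_add, hle fun n => le_add_self⟩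

end Density

/-! ### Magnetic lower bounds -/

section QuadraticFunctionals

variable {α F : Type*} [MeasurableSpace α] {μ : Measure α} [NormedAddCommGroup F] {f g : α → F}

theorem integral_norm_mul_norm_le (hf : MemLp f 2 μ) (hg : MemLp g 2 μ) :
    ∫ x, ‖f x‖ * ‖g x‖ ∂μ ≤ √(∫ x, ‖f x‖ ^ 2 ∂μ) * √(∫ x, ‖g x‖ ^ 2 ∂μ) := by
  simpa [Real.sqrt_eq_rpow] using integral_mul_norm_le_Lp_mul_Lq Real.HolderConjugate.two_two
    (by simpa using hf) (by simpa using hg)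

theorem integrable_mul_norm_sq {k : α → ℝ} {C : ℝ} (hf : MemLp f 2 μ)
    (hk : AEStronglyMeasurable k μ) (hkC : ∀ x, |k x| ≤ C) :
    Integrable (fun x => k x * ‖f x‖ ^ 2) μ :=
  (integrable_norm_sq hf).bdd_mul hk (.of_forall hkC)

theorem eLpNorm_mul_norm_sq_sub_le {k : α → ℝ} {C : ℝ} (hf : MemLp f 2 μ) (hg : MemLp g 2 μ)
    (hkC : ∀ x, |k x| ≤ C) :
    eLpNorm ((fun x => k x * ‖f x‖ ^ 2) - fun x => k x * ‖g x‖ ^ 2) 1 μ ≤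
      ENNReal.ofReal C * (eLpNorm (f - g) 2 μ * (eLpNorm f 2 μ + eLpNorm g 2 μ)) := by
  have hd := (hf.sub hg).norm
  have hs : MemLp (fun x => ‖f x‖ + ‖g x‖) 2 μ := hf.norm.add hg.norm
  have hpoint (x : α) : |k x * ‖f x‖ ^ 2 - k x * ‖g x‖ ^ 2| ≤
      C * |‖(f - g) x‖ * (‖f x‖ + ‖g x‖)| := by
    rw [abs_of_nonneg (mul_nonneg (norm_nonneg _) (by positivity)), ← mul_sub, abs_mul, sq_sub_sq,
      mul_comm (_ + _), abs_mul, abs_of_nonneg (by positivity : 0 ≤ ‖f x‖ + ‖g x‖)]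
    have hC := hkC x
    have hsub : |‖f x‖ - ‖g x‖| ≤ ‖(f - g) x‖ := abs_norm_sub_norm_le _ _
    have hC0 : 0 ≤ C := (abs_nonneg _).trans hC
    gcongr
  calc _ ≤ ENNReal.ofReal C * eLpNorm ((fun x => ‖(f - g) x‖) • fun x => ‖f x‖ + ‖g x‖) 1 μ :=
        eLpNorm_le_mul_eLpNorm_of_ae_le_mul (.of_forall hpoint) 1
    _ ≤ ENNReal.ofReal C * (eLpNorm (fun x => ‖(f - g) x‖) 2 μ *
        eLpNorm (fun x => ‖f x‖ + ‖g x‖) 2 μ) := by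
        gcongr
        exact eLpNorm_smul_le_mul_eLpNorm hs.1 hd.1
    _ ≤ _ := by
        have hadd := eLpNorm_add_le hf.norm.1 hg.norm.1 one_le_two
        simp only [eLpNorm_norm] at hadd ⊢
        gcongr
        exact hadd

theorem tendsto_integral_mul_norm_sq {g : ℕ → α → F} {k : α → ℝ} {C : ℝ}
    (hg : ∀ n, MemLp (g n) 2 μ) (hf : MemLp f 2 μ)
    (hlim : Tendsto (fun n => eLpNorm (g n - f) 2 μ) atTop (𝓝 0))
    (hk : AEStronglyMeasurable k μ) (hkC : ∀ x, |k x| ≤ C) :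
    Tendsto (fun n => ∫ x, k x * ‖g n x‖ ^ 2 ∂μ) atTop (𝓝 (∫ x, k x * ‖f x‖ ^ 2 ∂μ)) := by
  have hbound (n : ℕ) : eLpNorm (g n) 2 μ + eLpNorm f 2 μ ≤
      eLpNorm (g n - f) 2 μ + (eLpNorm f 2 μ + eLpNorm f 2 μ) := by
    rw [← add_assoc]
    gcongr
    simpa using eLpNorm_add_le ((hg n).sub hf).1 hf.1 one_le_two
  have hfin : eLpNorm f 2 μ + eLpNorm f 2 μ ≠ ⊤ := ENNReal.add_ne_top.2 ⟨hf.2.ne, hf.2.ne⟩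
  have hzero := ENNReal.Tendsto.const_mul (ENNReal.Tendsto.mul hlim (.inr (by simpa using hfin))
    (hlim.add_const (eLpNorm f 2 μ + eLpNorm f 2 μ)) (.inr ENNReal.zero_ne_top))
    (.inr (ENNReal.ofReal_ne_top (r := C)))
  rw [zero_mul, mul_zero] at hzero
  exact tendsto_integral_of_L1' _ (integrable_mul_norm_sq hf hk hkC).1
    (.of_forall fun n => integrable_mul_norm_sq (hg n) hk hkC)
    (tendsto_of_tendsto_of_tendsto_of_le_of_le tendsto_const_nhds hzero (fun _ => zero_le)
      fun n => (eLpNorm_mul_norm_sq_sub_le (hg n) hf hkC).trans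
        (mul_le_mul_right (mul_le_mul_right (hbound n) _) _))

theorem tendsto_integral_norm_sq {g : ℕ → α → F} (hg : ∀ n, MemLp (g n) 2 μ)
    (hf : MemLp f 2 μ) (hlim : Tendsto (fun n => eLpNorm (g n - f) 2 μ) atTop (𝓝 0)) :
    Tendsto (fun n => ∫ x, ‖g n x‖ ^ 2 ∂μ) atTop (𝓝 (∫ x, ‖f x‖ ^ 2 ∂μ)) := by
  simpa using tendsto_integral_mul_norm_sq (k := fun _ => 1) (C := 1) hg hf hlim
    aestronglyMeasurable_const (by simp)

end QuadraticFunctionals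

namespace IsTestFunction

variable {E F : Type*} [NormedAddCommGroup E] [NormedSpace ℝ E]

section InnerProduct

variable [NormedAddCommGroup F] [InnerProductSpace ℝ F] {ϕ : E → F}

theorem norm_sq (h : IsTestFunction ϕ) : IsTestFunction fun x => ‖ϕ x‖ ^ 2 :=
  ⟨h.contDiff.norm_sq ℝ, h.hasCompactSupport.comp_left (g := fun z => ‖z‖ ^ 2) (by simp)⟩

theorem fderiv_norm_sq (h : IsTestFunction ϕ) (x e : E) :
    fderiv ℝ (fun x => ‖ϕ x‖ ^ 2) x e = 2 * inner ℝ (ϕ x) (fderiv ℝ ϕ x e) := by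
  rw [((h.differentiable x).hasFDerivAt.norm_sq).fderiv]
  simp

theorem abs_fderiv_norm_sq_le (h : IsTestFunction ϕ) (x e : E) :
    |fderiv ℝ (fun x => ‖ϕ x‖ ^ 2) x e| ≤ 2 * (‖ϕ x‖ * ‖fderiv ℝ ϕ x e‖) := by
  rw [h.fderiv_norm_sq, abs_mul, abs_two]
  gcongr
  exact abs_real_inner_le_norm _ _

end InnerProduct

variable [NormedAddCommGroup F] [NormedSpace ℝ F] {ϕ : E → F}

theorem fderiv_fderiv_comm (h : IsTestFunction ϕ) (x v w : E) :
    fderiv ℝ (fun y => fderiv ℝ ϕ y v) x w = fderiv ℝ (fun y => fderiv ℝ ϕ y w) x v := by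
  have hd : DifferentiableAt ℝ (fderiv ℝ ϕ) x :=
    (h.contDiff.fderiv_right (m := ∞) (by simp)).differentiable (by simp) x
  have hsymm : IsSymmSndFDerivAt ℝ ϕ x :=
    (contDiff_infty.1 h.contDiff 2).contDiffAt.isSymmSndFDerivAt (by simp)
  have happly (v w : E) : fderiv ℝ (fun y => fderiv ℝ ϕ y v) x w = fderiv ℝ (fderiv ℝ ϕ) x w v := by
    rw [fderiv_clm_apply hd (differentiableAt_const v)]
    simp
  rw [happly, happly, hsymm.eq]

/-- Integrating by parts in both variables exchanges the two derivatives. -/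
theorem integral_apply_fderiv_fderiv_eq_zero [MeasurableSpace E] [BorelSpace E]
    [FiniteDimensional ℝ E] {μ : Measure E} [μ.IsAddHaarMeasure] (h : IsTestFunction ϕ)
    {B : F →L[ℝ] F →L[ℝ] ℝ} (hB : ∀ z w, B w z = -B z w) (v w : E) :
    ∫ x, B (fderiv ℝ ϕ x v) (fderiv ℝ ϕ x w) ∂μ = 0 := by
  have hint {f g : E → F} (hf : IsTestFunction f) (hg : IsTestFunction g) :
      Integrable (fun x => B (f x) (g x)) μ :=
    ((B.continuous.comp hf.continuous).clm_apply hg.continuous).integrable_of_hasCompactSupport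
      (hf.hasCompactSupport.mono fun x hx hfx => hx (by simp [show f x = 0 from hfx]))
  have hparts (v w : E) := integral_bilinear_fderiv_right_eq_neg_left_of_integrable (B := B)
    (hint ((h.fderiv_apply v).fderiv_apply w) h) (hint (h.fderiv_apply v) (h.fderiv_apply w))
    (hint (h.fderiv_apply v) h) (fun x _ => (h.fderiv_apply v).differentiable x)
    (fun x _ => h.differentiable x)
  have hswap : ∫ x, B (fderiv ℝ ϕ x w) (fderiv ℝ ϕ x v) ∂μ =
      -∫ x, B (fderiv ℝ ϕ x v) (fderiv ℝ ϕ x w) ∂μ := by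
    rw [← integral_neg]
    exact integral_congr_ae (.of_forall fun x => hB _ _)
  have hcomm : ∫ x, B (fderiv ℝ ϕ x v) (fderiv ℝ ϕ x w) ∂μ =
      ∫ x, B (fderiv ℝ ϕ x w) (fderiv ℝ ϕ x v) ∂μ := by
    rw [hparts v w, hparts w v]
    simp only [h.fderiv_fderiv_comm _ v w]
  linarith

end IsTestFunction

theorem lineDeriv_pot (a : ℝ) {x : ℝ × ℝ} (hx : x.2 ≠ 0) :
    lineDeriv ℝ (pot a) x (0, 1) = -step a x := by
  have hstep : ∀ᶠ y in 𝓝 x, step a y = step a x := by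
    rcases hx.lt_or_gt with h | h
    · filter_upwards [continuous_snd.continuousAt.eventually_lt_const h] with y hy
      simp [step, h.not_gt, hy.not_gt]
    · filter_upwards [continuous_snd.continuousAt.eventually_const_lt h] with y hy
      simp [step, h, hy]
  have hpot : pot a =ᶠ[𝓝 x] fun y => step a x * -y.2 := by
    filter_upwards [hstep] with y hy
    rw [pot, hy]
  have hderiv : HasFDerivAt (fun y : ℝ × ℝ => step a x * -y.2)
      (step a x • -ContinuousLinearMap.snd ℝ ℝ ℝ) x := hasFDerivAt_snd.neg.const_mul _
  rw [hpot.lineDeriv_eq, (hderiv.hasLineDerivAt _).lineDeriv]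
  simp

theorem ae_snd_ne_zero : ∀ᵐ x : ℝ × ℝ, x.2 ≠ 0 :=
  Measure.quasiMeasurePreserving_snd.ae (Measure.ae_ne volume 0)

theorem measurable_step (a : ℝ) : Measurable (step a) :=
  Measurable.ite (measurableSet_lt measurable_const measurable_snd) measurable_const
    measurable_const

theorem abs_step_le {a : ℝ} (ha : |a| ≤ 1) (x : ℝ × ℝ) : |step a x| ≤ 1 := by
  unfold step; split_ifs <;> simp [ha]

theorem integral_pot_mul_fderiv (a : ℝ) {ψ : ℝ × ℝ → ℝ} (hψ : IsTestFunction ψ) :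
    ∫ x, pot a x * fderiv ℝ ψ x (0, 1) = ∫ x, step a x * ψ x := by
  obtain ⟨D, hD⟩ := hψ.contDiff.lipschitzWith_of_hasCompactSupport hψ.hasCompactSupport (by simp)
  have hparts := (lipschitzWith_pot a).integral_lineDeriv_mul_eq (μ := volume) hD
    hψ.hasCompactSupport (0, 1)
  have hleft : ∫ x, lineDeriv ℝ (pot a) x (0, 1) * ψ x = -∫ x, step a x * ψ x := by
    rw [← integral_neg]
    refine integral_congr_ae ?_
    filter_upwards [ae_snd_ne_zero] with x hx
    rw [lineDeriv_pot a hx, neg_mul]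
  have hright : ∫ x, lineDeriv ℝ ψ x (-(0, 1)) * pot a x =
      -∫ x, pot a x * fderiv ℝ ψ x (0, 1) := by
    rw [← integral_neg]
    refine integral_congr_ae (.of_forall fun x => ?_)
    simp only
    rw [(hψ.differentiable x).lineDeriv_eq_fderiv, map_neg, neg_mul, mul_comm]
  rw [hleft, hright, neg_inj] at hparts
  exact hparts.symm

/-- The alternating form `(z, w) ↦ im (conj z * w)` on `ℂ`. -/
def crossForm : ℂ →L[ℝ] ℂ →L[ℝ] ℝ :=
  (ContinuousLinearMap.compL ℝ ℂ ℂ ℝ Complex.imCLM).comp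
    ((ContinuousLinearMap.mul ℝ ℂ).comp Complex.conjCLE.toContinuousLinearMap)

theorem crossForm_apply (z w : ℂ) : crossForm z w = (starRingEnd ℂ z * w).im := rfl

theorem two_mul_abs_crossForm_le (z w : ℂ) : 2 * |crossForm z w| ≤ ‖z‖ ^ 2 + ‖w‖ ^ 2 := by
  have h : |crossForm z w| ≤ ‖z‖ * ‖w‖ := by
    simpa [crossForm_apply] using Complex.abs_im_le_norm (starRingEnd ℂ z * w)
  linarith [two_mul_le_add_sq ‖z‖ ‖w‖]

section MagneticBounds

variable {a : ℝ} {u v₁ v₂ : ℝ × ℝ → ℂ}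

namespace IsTestFunction

variable {ϕ : ℝ × ℝ → ℂ}

/-- The commutator of the two magnetic derivatives is multiplication by `-i` times the magnetic
field `step a`. -/
theorem integral_step_mul_norm_sq (h : IsTestFunction ϕ) (a : ℝ) :
    ∫ x, step a x * ‖ϕ x‖ ^ 2 = ∫ x, 2 * crossForm (mag1 a ϕ x) (mag2 ϕ x) := by
  have hexpand (x : ℝ × ℝ) : 2 * crossForm (mag1 a ϕ x) (mag2 ϕ x) =
      pot a x * fderiv ℝ (fun x => ‖ϕ x‖ ^ 2) x (0, 1) +
        2 * crossForm (fderiv ℝ ϕ x (1, 0)) (fderiv ℝ ϕ x (0, 1)) := by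
    rw [h.fderiv_norm_sq, Complex.inner]
    simp [crossForm_apply, mag1, mag2]
    ring
  have hpot : Integrable fun x => pot a x * fderiv ℝ (fun x => ‖ϕ x‖ ^ 2) x (0, 1) :=
    ((continuous_pot a).mul (h.norm_sq.fderiv_apply _).continuous).integrable_of_hasCompactSupport
      (h.norm_sq.fderiv_apply _).hasCompactSupport.mul_left
  have hcross : Integrable fun x =>
      2 * crossForm (fderiv ℝ ϕ x (1, 0)) (fderiv ℝ ϕ x (0, 1)) := by
    have h₁ : IsTestFunction fun x => fderiv ℝ ϕ x (1, 0) := h.fderiv_apply (1, 0)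
    have h₂ : IsTestFunction fun x => fderiv ℝ ϕ x (0, 1) := h.fderiv_apply (0, 1)
    refine Integrable.mono' ((integrable_norm_sq (h₁.memLp 2)).add
      (integrable_norm_sq (h₂.memLp 2))) ?_ (.of_forall fun x => ?_)
    · exact (continuous_const.mul ((crossForm.continuous.comp
        h₁.continuous).clm_apply h₂.continuous)).aestronglyMeasurable
    · simpa using two_mul_abs_crossForm_le (fderiv ℝ ϕ x (1, 0)) (fderiv ℝ ϕ x (0, 1))
  rw [← integral_pot_mul_fderiv a h.norm_sq]
  simp only [hexpand]
  rw [integral_add hpot hcross, integral_const_mul, h.integral_apply_fderiv_fderiv_eq_zero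
    (fun z w => by simp [crossForm_apply]; ring), mul_zero, add_zero]

theorem abs_integral_step_le (h : IsTestFunction ϕ) (a : ℝ) :
    |∫ x, step a x * ‖ϕ x‖ ^ 2| ≤ (∫ x, ‖mag1 a ϕ x‖ ^ 2) + ∫ x, ‖mag2 ϕ x‖ ^ 2 := by
  have hm₁ := integrable_norm_sq (h.magH1 a).memLp₁
  have hm₂ := integrable_norm_sq (h.magH1 a).memLp₂
  rw [h.integral_step_mul_norm_sq, ← integral_add hm₁ hm₂, ← Real.norm_eq_abs]
  refine norm_integral_le_of_norm_le (hm₁.add hm₂) (.of_forall fun x => ?_)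
  simpa using two_mul_abs_crossForm_le (mag1 a ϕ x) (mag2 ϕ x)

/-- The weight is the derivative of the bounded function `arctan`. -/
theorem integral_weight_le (h : IsTestFunction ϕ) :
    ∫ x : ℝ × ℝ, (1 + x.2 ^ 2)⁻¹ * ‖ϕ x‖ ^ 2 ≤
      Real.pi * (√(∫ x, ‖ϕ x‖ ^ 2) * √(∫ x, ‖mag2 ϕ x‖ ^ 2)) := by
  have hsq := h.norm_sq
  have harctan : Differentiable ℝ fun x : ℝ × ℝ => Real.arctan x.2 :=
    Real.differentiable_arctan.comp differentiable_snd
  have hderiv (x : ℝ × ℝ) :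
      fderiv ℝ (fun x : ℝ × ℝ => Real.arctan x.2) x (0, 1) = (1 + x.2 ^ 2)⁻¹ := by
    simpa only [d2, Real.deriv_arctan, one_div] using d2_comp_snd Real.differentiable_arctan x
  have hint {k ψ : ℝ × ℝ → ℝ} (hk : Continuous k) (hψ : IsTestFunction ψ) :
      Integrable fun x => k x * ψ x :=
    (hk.mul hψ.continuous).integrable_of_hasCompactSupport hψ.hasCompactSupport.mul_left
  have hweight : Continuous fun x : ℝ × ℝ => (1 + x.2 ^ 2)⁻¹ :=
    Continuous.inv₀ (by fun_prop) fun x => by positivity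
  have hparts := integral_mul_fderiv_eq_neg_fderiv_mul_of_integrable (μ := volume) (v := (0, 1))
    (by simpa only [hderiv] using hint hweight hsq)
    (hint harctan.continuous (hsq.fderiv_apply (0, 1))) (hint harctan.continuous hsq)
    (fun x _ => harctan x) (fun x _ => hsq.differentiable x)
  simp only [hderiv] at hparts
  rw [← neg_eq_iff_eq_neg] at hparts
  rw [← hparts, ← integral_neg]
  calc _ ≤ ∫ x, Real.pi * (‖ϕ x‖ * ‖mag2 ϕ x‖) := by
        refine integral_mono (hint harctan.continuous (hsq.fderiv_apply (0, 1))).neg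
          (((h.memLp 2).norm.integrable_mul ((h.fderiv_apply (0, 1)).memLp 2).norm).const_mul _)
          fun x => (neg_le_abs _).trans ?_
        have hbound : |Real.arctan x.2| ≤ Real.pi / 2 :=
          abs_le.2 ⟨(Real.neg_pi_div_two_lt_arctan _).le, (Real.arctan_lt_pi_div_two _).le⟩
        rw [abs_mul]
        refine (mul_le_mul hbound (h.abs_fderiv_norm_sq_le x (0, 1)) (abs_nonneg _)
          (by positivity)).trans_eq ?_
        rw [mag2]; ring
    _ ≤ _ := by
        rw [integral_const_mul]
        gcongr
        exact integral_norm_mul_norm_le (h.memLp 2) ((h.fderiv_apply (0, 1)).memLp 2)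

end IsTestFunction

namespace MagH1

theorem abs_integral_step_le (h : MagH1 a u v₁ v₂) (ha : |a| ≤ 1) :
    |∫ x, step a x * ‖u x‖ ^ 2| ≤ (∫ x, ‖v₁ x‖ ^ 2) + ∫ x, ‖v₂ x‖ ^ 2 := by
  obtain ⟨ϕ, hϕ, hlim, hlim₁, hlim₂⟩ := h.exists_seq_isTestFunction
  exact le_of_tendsto_of_tendsto'
    (tendsto_integral_mul_norm_sq (fun n => ((hϕ n).magH1 a).memLp) h.memLp hlim
      (measurable_step a).aestronglyMeasurable (abs_step_le ha)).abs
    ((tendsto_integral_norm_sq (fun n => ((hϕ n).magH1 a).memLp₁) h.memLp₁ hlim₁).add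
      (tendsto_integral_norm_sq (fun n => ((hϕ n).magH1 a).memLp₂) h.memLp₂ hlim₂))
    fun n => (hϕ n).abs_integral_step_le a

theorem integral_weight_le (h : MagH1 a u v₁ v₂) :
    ∫ x : ℝ × ℝ, (1 + x.2 ^ 2)⁻¹ * ‖u x‖ ^ 2 ≤
      Real.pi * (√(∫ x, ‖u x‖ ^ 2) * √(∫ x, ‖v₂ x‖ ^ 2)) := by
  obtain ⟨ϕ, hϕ, hlim, -, hlim₂⟩ := h.exists_seq_isTestFunction
  have hweight (x : ℝ × ℝ) : |(1 + x.2 ^ 2)⁻¹| ≤ 1 := by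
    rw [abs_of_nonneg (by positivity)]
    exact inv_le_one_of_one_le₀ (by nlinarith [sq_nonneg x.2])
  exact le_of_tendsto_of_tendsto'
    (tendsto_integral_mul_norm_sq (fun n => ((hϕ n).magH1 a).memLp) h.memLp hlim
      (Measurable.aestronglyMeasurable (by fun_prop)) hweight)
    (.const_mul _
      ((tendsto_integral_norm_sq (fun n => ((hϕ n).magH1 a).memLp) h.memLp hlim).sqrt.mul
        (tendsto_integral_norm_sq (fun n => ((hϕ n).magH1 a).memLp₂) h.memLp₂ hlim₂).sqrt))
    fun n => (hϕ n).integral_weight_le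

theorem mul_integral_le_of_pos (h : MagH1 a u v₁ v₂) (ha : 0 < a) (ha1 : a ≤ 1) :
    a * ∫ x, ‖u x‖ ^ 2 ≤ (∫ x, ‖v₁ x‖ ^ 2) + ∫ x, ‖v₂ x‖ ^ 2 := by
  have habs : |a| ≤ 1 := by rwa [abs_of_pos ha]
  refine le_trans ?_ ((le_abs_self _).trans (h.abs_integral_step_le habs))
  rw [← integral_const_mul]
  refine integral_mono ((integrable_norm_sq h.memLp).const_mul a)
    (integrable_mul_norm_sq h.memLp (measurable_step a).aestronglyMeasurable (abs_step_le habs))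
    fun x => ?_
  have hstep : a ≤ step a x := by unfold step; split_ifs <;> linarith
  exact mul_le_mul_of_nonneg_right hstep (by positivity)

end MagH1

end MagneticBounds

/-! ### Localization in the direction `x₂` -/

section Cutoff

theorem deriv_smoothTransition_eq_zero {t : ℝ} (h : t ≤ 0 ∨ 1 ≤ t) :
    deriv Real.smoothTransition t = 0 := by
  rcases h with h | h
  · refine IsLocalMin.deriv_eq_zero (.of_forall fun s => ?_)
    rw [Real.smoothTransition.zero_of_nonpos h]
    exact Real.smoothTransition.nonneg s
  · refine IsLocalMax.deriv_eq_zero (.of_forall fun s => ?_)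
    rw [Real.smoothTransition.one_of_one_le h]
    exact Real.smoothTransition.le_one s

theorem abs_smoothTransition_le_one (t : ℝ) : |Real.smoothTransition t| ≤ 1 := by
  rw [abs_of_nonneg (Real.smoothTransition.nonneg t)]
  exact Real.smoothTransition.le_one t

theorem differentiable_smoothTransition : Differentiable ℝ Real.smoothTransition :=
  Real.smoothTransition.contDiff.differentiable (n := 1) one_ne_zero

theorem continuous_deriv_smoothTransition : Continuous (deriv Real.smoothTransition) :=
  (Real.smoothTransition.contDiff (n := 1)).continuous_deriv le_rfl

theorem hasCompactSupport_deriv_smoothTransition :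
    HasCompactSupport (deriv Real.smoothTransition) :=
  HasCompactSupport.intro (isCompact_Icc (a := (0 : ℝ)) (b := 1)) fun t ht =>
    deriv_smoothTransition_eq_zero (by by_contra! h; exact ht ⟨h.1.le, h.2.le⟩)

theorem exists_one_le_abs_deriv_smoothTransition_le :
    ∃ C : ℝ, 1 ≤ C ∧ ∀ t, |deriv Real.smoothTransition t| ≤ C := by
  obtain ⟨C, hC⟩ := continuous_deriv_smoothTransition.bounded_above_of_compact_support
    hasCompactSupport_deriv_smoothTransition
  exact ⟨max C 1, le_max_right _ _, fun t => (hC t).trans (le_max_left _ _)⟩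

/-- A Lipschitz constant, at least `1`, of the smooth transition function from which all cutoffs
are built. -/
def transitionSlope : ℝ := exists_one_le_abs_deriv_smoothTransition_le.choose

theorem one_le_transitionSlope : 1 ≤ transitionSlope :=
  exists_one_le_abs_deriv_smoothTransition_le.choose_spec.1

theorem abs_deriv_smoothTransition_le (t : ℝ) : |deriv Real.smoothTransition t| ≤ transitionSlope :=
  exists_one_le_abs_deriv_smoothTransition_le.choose_spec.2 t

theorem hasDerivAt_smoothTransition_affine (m c t : ℝ) :
    HasDerivAt (fun s => Real.smoothTransition (m * s + c))
      (deriv Real.smoothTransition (m * t + c) * m) t := by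
  have haff : HasDerivAt (fun s => m * s + c) m t := by
    simpa using ((hasDerivAt_id t).const_mul m).add_const c
  exact (differentiable_smoothTransition (m * t + c)).hasDerivAt.comp t haff

theorem contDiff_smoothTransition_affine (m c : ℝ) :
    ContDiff ℝ ∞ fun s => Real.smoothTransition (m * s + c) :=
  Real.smoothTransition.contDiff.comp (by fun_prop)

theorem smoothTransition_sq_add_neg_sq_le (t : ℝ) :
    Real.smoothTransition t ^ 2 + Real.smoothTransition (-t) ^ 2 ≤ 1 := by
  have hsq (s : ℝ) : Real.smoothTransition s ^ 2 ≤ 1 :=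
    pow_le_one₀ (Real.smoothTransition.nonneg s) (Real.smoothTransition.le_one s)
  rcases le_total t 0 with h | h
  · simpa [Real.smoothTransition.zero_of_nonpos h] using hsq (-t)
  · simpa [Real.smoothTransition.zero_of_nonpos (neg_nonpos.2 h)] using hsq t

theorem smoothTransition_sq_add_neg_sq {t : ℝ} (h : 1 ≤ |t|) :
    Real.smoothTransition t ^ 2 + Real.smoothTransition (-t) ^ 2 = 1 := by
  rcases le_abs.1 h with h | h
  · simp [Real.smoothTransition.one_of_one_le h,
      Real.smoothTransition.zero_of_nonpos (show -t ≤ 0 by linarith)]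
  · simp [Real.smoothTransition.one_of_one_le h,
      Real.smoothTransition.zero_of_nonpos (show t ≤ 0 by linarith)]

/-- The angle whose cosine and sine are the cutoffs of the localization: it is `0` on `[-L, L]`
and `π / 2` off `[-2L, 2L]`. -/
def cutAngle (L t : ℝ) : ℝ :=
  Real.pi / 2 * (Real.smoothTransition (L⁻¹ * t + -1) + Real.smoothTransition (-L⁻¹ * t + -1))

theorem contDiff_cutAngle (L : ℝ) : ContDiff ℝ ∞ (cutAngle L) :=
  contDiff_const.mul
    ((contDiff_smoothTransition_affine _ _).add (contDiff_smoothTransition_affine _ _))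

theorem deriv_cutAngle (L t : ℝ) : deriv (cutAngle L) t = Real.pi / 2 *
    (deriv Real.smoothTransition (L⁻¹ * t + -1) * L⁻¹ +
      deriv Real.smoothTransition (-L⁻¹ * t + -1) * -L⁻¹) :=
  (((hasDerivAt_smoothTransition_affine L⁻¹ (-1) t).add
    (hasDerivAt_smoothTransition_affine (-L⁻¹) (-1) t)).const_mul _).deriv

/-- A bound for the slope of `cutAngle 1`. -/
def angleSlope : ℝ := Real.pi * transitionSlope

theorem one_le_angleSlope : 1 ≤ angleSlope := by
  unfold angleSlope
  nlinarith [Real.pi_gt_three, one_le_transitionSlope]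

variable {L : ℝ}

theorem abs_deriv_cutAngle_le (hL : 0 < L) (t : ℝ) : |deriv (cutAngle L) t| ≤ angleSlope / L := by
  have hslope (s : ℝ) : |deriv Real.smoothTransition s| * L⁻¹ ≤ transitionSlope * L⁻¹ := by
    gcongr
    exact abs_deriv_smoothTransition_le s
  rw [deriv_cutAngle, abs_mul, abs_of_pos (by positivity)]
  calc _ ≤ Real.pi / 2 * (transitionSlope * L⁻¹ + transitionSlope * L⁻¹) := by
        gcongr
        refine (abs_add_le _ _).trans (add_le_add ?_ ?_)
        · rw [abs_mul, abs_of_pos (inv_pos.2 hL)]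
          exact hslope _
        · rw [abs_mul, abs_neg, abs_of_pos (inv_pos.2 hL)]
          exact hslope _
    _ = angleSlope / L := by rw [angleSlope]; ring

theorem cutAngle_eq_zero (hL : 0 < L) {t : ℝ} (h : |t| ≤ L) : cutAngle L t = 0 := by
  have hup : L⁻¹ * t ≤ 1 := (inv_mul_le_one₀ hL).2 ((le_abs_self t).trans h)
  have hdown : L⁻¹ * -t ≤ 1 := (inv_mul_le_one₀ hL).2 ((neg_le_abs t).trans h)
  rw [cutAngle, Real.smoothTransition.zero_of_nonpos (by linarith),
    Real.smoothTransition.zero_of_nonpos (by linarith), add_zero, mul_zero]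

theorem two_le_or_le_of_two_mul_le_abs (hL : 0 < L) {t : ℝ} (h : 2 * L ≤ |t|) :
    2 ≤ L⁻¹ * t ∨ L⁻¹ * t ≤ -2 := by
  have hle {s : ℝ} (hs : 2 * L ≤ s) : 2 ≤ L⁻¹ * s := by
    rwa [inv_mul_eq_div, le_div_iff₀ hL]
  rcases le_abs.1 h with h | h
  · exact .inl (hle h)
  · exact .inr (by linarith [hle h])

theorem cutAngle_eq_pi_div_two (hL : 0 < L) {t : ℝ} (h : 2 * L ≤ |t|) :
    cutAngle L t = Real.pi / 2 := by
  rcases two_le_or_le_of_two_mul_le_abs hL h with h | h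
  · rw [cutAngle, Real.smoothTransition.one_of_one_le (by linarith),
      Real.smoothTransition.zero_of_nonpos (by linarith), add_zero, mul_one]
  · rw [cutAngle, Real.smoothTransition.zero_of_nonpos (by linarith),
      Real.smoothTransition.one_of_one_le (by linarith), zero_add, mul_one]

theorem deriv_cutAngle_eq_zero (hL : 0 < L) {t : ℝ} (h : 2 * L ≤ |t|) :
    deriv (cutAngle L) t = 0 := by
  have := two_le_or_le_of_two_mul_le_abs hL h
  rw [deriv_cutAngle, deriv_smoothTransition_eq_zero (by grind),
    deriv_smoothTransition_eq_zero (by grind), zero_mul, zero_mul, add_zero, mul_zero]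

end Cutoff

theorem norm_smul_sq {E : Type*} [SeminormedAddCommGroup E] [NormedSpace ℝ E] (c : ℝ) (z : E) :
    ‖c • z‖ ^ 2 = c ^ 2 * ‖z‖ ^ 2 := by
  rw [norm_smul, mul_pow, Real.norm_eq_abs, sq_abs]

theorem norm_rotation_sq {E : Type*} [SeminormedAddCommGroup E] [InnerProductSpace ℝ E]
    (θ m : ℝ) (z w : E) :
    ‖Real.cos θ • z - (Real.sin θ * m) • w‖ ^ 2 + ‖Real.sin θ • z + (Real.cos θ * m) • w‖ ^ 2 =
      ‖z‖ ^ 2 + m ^ 2 * ‖w‖ ^ 2 := by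
  rw [norm_sub_sq_real, norm_add_sq_real]
  simp only [norm_smul_sq, real_inner_smul_left, real_inner_smul_right]
  linear_combination (‖z‖ ^ 2 + m ^ 2 * ‖w‖ ^ 2) * Real.cos_sq_add_sin_sq θ

namespace MagH1

variable {a b C L : ℝ} {u v₁ v₂ : ℝ × ℝ → ℂ} {θ : ℝ → ℝ}

theorem cos_smul (h : MagH1 a u v₁ v₂) (hθ : ContDiff ℝ ∞ θ) (hC : ∀ t, |deriv θ t| ≤ C) :
    MagH1 a (fun x => Real.cos (θ x.2) • u x) (fun x => Real.cos (θ x.2) • v₁ x)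
      (fun x => Real.cos (θ x.2) • v₂ x - (Real.sin (θ x.2) * deriv θ x.2) • u x) := by
  have hderiv (t : ℝ) : deriv (fun s => Real.cos (θ s)) t = -(Real.sin (θ t) * deriv θ t) := by
    rw [(hθ.differentiable (by simp) t).hasDerivAt.cos.deriv, neg_mul]
  have hmag := h.smul_snd (Real.contDiff_cos.comp hθ) (C := max 1 C)
    (fun t => (Real.abs_cos_le_one _).trans (le_max_left _ _)) fun t => by
      simp only [Function.comp_def, hderiv, abs_neg, abs_mul]
      exact (mul_le_of_le_one_left (abs_nonneg _) (Real.abs_sin_le_one _)).trans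
        ((hC t).trans (le_max_right _ _))
  simpa only [Function.comp_def, hderiv, neg_smul, ← sub_eq_add_neg] using hmag

theorem sin_smul (h : MagH1 a u v₁ v₂) (hθ : ContDiff ℝ ∞ θ) (hC : ∀ t, |deriv θ t| ≤ C) :
    MagH1 a (fun x => Real.sin (θ x.2) • u x) (fun x => Real.sin (θ x.2) • v₁ x)
      (fun x => Real.sin (θ x.2) • v₂ x + (Real.cos (θ x.2) * deriv θ x.2) • u x) := by
  have hderiv (t : ℝ) : deriv (fun s => Real.sin (θ s)) t = Real.cos (θ t) * deriv θ t :=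
    (hθ.differentiable (by simp) t).hasDerivAt.sin.deriv
  have hmag := h.smul_snd (Real.contDiff_sin.comp hθ) (C := max 1 C)
    (fun t => (Real.abs_sin_le_one _).trans (le_max_left _ _)) fun t => by
      simp only [Function.comp_def, hderiv, abs_mul]
      exact (mul_le_of_le_one_left (abs_nonneg _) (Real.abs_cos_le_one _)).trans
        ((hC t).trans (le_max_right _ _))
  simpa only [Function.comp_def, hderiv] using hmag

theorem integrable_deriv_sq_mul (h : MagH1 a u v₁ v₂) (hθ : ContDiff ℝ ∞ θ)
    (hC : ∀ t, |deriv θ t| ≤ C) : Integrable fun x => deriv θ x.2 ^ 2 * ‖u x‖ ^ 2 := by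
  have hcont : Continuous (deriv θ) := hθ.continuous_deriv (by simp)
  refine integrable_mul_norm_sq (C := C ^ 2) h.memLp
    ((hcont.comp continuous_snd).pow 2).aestronglyMeasurable fun x => ?_
  rw [abs_pow]
  exact pow_le_pow_left₀ (abs_nonneg _) (hC x.2) 2

theorem integral_localize_mass (h : MagH1 a u v₁ v₂) (hθ : ContDiff ℝ ∞ θ)
    (hC : ∀ t, |deriv θ t| ≤ C) :
    (∫ x, ‖Real.cos (θ x.2) • u x‖ ^ 2) + ∫ x, ‖Real.sin (θ x.2) • u x‖ ^ 2 = ∫ x, ‖u x‖ ^ 2 := by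
  rw [← integral_add (integrable_norm_sq (h.cos_smul hθ hC).memLp)
    (integrable_norm_sq (h.sin_smul hθ hC).memLp)]
  congr 1; ext x
  simpa using norm_rotation_sq (θ x.2) 0 (u x) 0

theorem integral_localize (h : MagH1 a u v₁ v₂) (hθ : ContDiff ℝ ∞ θ)
    (hC : ∀ t, |deriv θ t| ≤ C) :
    ((∫ x, ‖Real.cos (θ x.2) • v₁ x‖ ^ 2) +
      ∫ x, ‖Real.cos (θ x.2) • v₂ x - (Real.sin (θ x.2) * deriv θ x.2) • u x‖ ^ 2) +
    ((∫ x, ‖Real.sin (θ x.2) • v₁ x‖ ^ 2) +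
      ∫ x, ‖Real.sin (θ x.2) • v₂ x + (Real.cos (θ x.2) * deriv θ x.2) • u x‖ ^ 2) =
    (∫ x, ‖v₁ x‖ ^ 2) + (∫ x, ‖v₂ x‖ ^ 2) + ∫ x, deriv θ x.2 ^ 2 * ‖u x‖ ^ 2 := by
  have hcos := h.cos_smul hθ hC
  have hsin := h.sin_smul hθ hC
  rw [add_add_add_comm, ← integral_add (integrable_norm_sq hcos.memLp₁)
    (integrable_norm_sq hsin.memLp₁), ← integral_add (integrable_norm_sq hcos.memLp₂)
    (integrable_norm_sq hsin.memLp₂), add_assoc, ← integral_add (integrable_norm_sq h.memLp₂)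
    (h.integrable_deriv_sq_mul hθ hC)]
  congr 2
  · ext x
    simpa using norm_rotation_sq (θ x.2) 0 (v₁ x) 0
  · ext x
    exact norm_rotation_sq _ _ _ _

theorem smoothTransition_smul (h : MagH1 a u v₁ v₂) {m : ℝ}
    (hz : ∀ x : ℝ × ℝ, |m * x.2| ≤ 1 → u x = 0) :
    MagH1 a (fun x => Real.smoothTransition (m * x.2) • u x)
      (fun x => Real.smoothTransition (m * x.2) • v₁ x)
      (fun x => Real.smoothTransition (m * x.2) • v₂ x) := by
  have hderiv (t : ℝ) : deriv (fun s => Real.smoothTransition (m * s)) t =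
      deriv Real.smoothTransition (m * t) * m := by
    simpa using (hasDerivAt_smoothTransition_affine m 0 t).deriv
  have hmag := h.smul_snd (k := fun t => Real.smoothTransition (m * t))
    (by simpa using contDiff_smoothTransition_affine m 0) (C := max 1 (transitionSlope * |m|))
    (fun t => (abs_smoothTransition_le_one _).trans (le_max_left _ _)) fun t => by
      rw [hderiv, abs_mul]
      exact le_max_of_le_right
        (mul_le_mul_of_nonneg_right (abs_deriv_smoothTransition_le _) (abs_nonneg m))
  have hzero (x : ℝ × ℝ) : (deriv Real.smoothTransition (m * x.2) * m) • u x = 0 := by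
    by_cases hx : |m * x.2| ≤ 1
    · rw [hz x hx, smul_zero]
    · rw [deriv_smoothTransition_eq_zero (by grind), zero_mul, zero_smul]
  simpa only [hderiv, hzero, add_zero] using hmag

theorem abs_mul_integral_smoothTransition_le (h : MagH1 a u v₁ v₂) (ha : |a| ≤ 1) {m s : ℝ}
    (hz : ∀ x : ℝ × ℝ, |m * x.2| ≤ 1 → u x = 0) (hs : ∀ x, 0 < m * x.2 → step a x = s) :
    |s| * ∫ x, ‖Real.smoothTransition (m * x.2) • u x‖ ^ 2 ≤
      (∫ x, ‖Real.smoothTransition (m * x.2) • v₁ x‖ ^ 2) +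
        ∫ x, ‖Real.smoothTransition (m * x.2) • v₂ x‖ ^ 2 := by
  have hstep : ∫ x, step a x * ‖Real.smoothTransition (m * x.2) • u x‖ ^ 2 =
      s * ∫ x, ‖Real.smoothTransition (m * x.2) • u x‖ ^ 2 := by
    rw [← integral_const_mul]
    congr 1; ext x
    rcases le_or_gt (m * x.2) 0 with hx | hx
    · simp [Real.smoothTransition.zero_of_nonpos hx]
    · rw [hs x hx]
  refine le_of_eq_of_le ?_ ((h.smoothTransition_smul hz).abs_integral_step_le ha)
  rw [hstep, abs_mul, abs_of_nonneg (integral_nonneg fun x => by positivity)]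

theorem integral_smoothTransition_add_neg_le {v : ℝ × ℝ → ℂ} {m : ℝ} (hv : MemLp v 2 volume)
    (hup : MemLp (fun x => Real.smoothTransition (m * x.2) • v x) 2 volume)
    (hdown : MemLp (fun x => Real.smoothTransition (-m * x.2) • v x) 2 volume) :
    (∫ x, ‖Real.smoothTransition (m * x.2) • v x‖ ^ 2) +
      ∫ x, ‖Real.smoothTransition (-m * x.2) • v x‖ ^ 2 ≤ ∫ x, ‖v x‖ ^ 2 := by
  rw [← integral_add (integrable_norm_sq hup) (integrable_norm_sq hdown)]
  refine integral_mono ((integrable_norm_sq hup).add (integrable_norm_sq hdown))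
    (integrable_norm_sq hv) fun x => ?_
  simp only [norm_smul_sq, ← add_mul, neg_mul]
  exact mul_le_of_le_one_left (sq_nonneg _) (smoothTransition_sq_add_neg_sq_le _)

/-- A function vanishing near the line `x₂ = 0` splits into its parts in the two half-planes, where
the magnetic field is constant, of intensity `1` and `|a|`. -/
theorem abs_mul_integral_le_of_eq_zero (h : MagH1 a u v₁ v₂) (ha : |a| ≤ 1) (hL : 0 < L)
    (hz : ∀ x : ℝ × ℝ, |x.2| ≤ L → u x = 0) :
    |a| * ∫ x, ‖u x‖ ^ 2 ≤ (∫ x, ‖v₁ x‖ ^ 2) + ∫ x, ‖v₂ x‖ ^ 2 := by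
  set m : ℝ := L⁻¹
  have hm : 0 < m := inv_pos.2 hL
  have hz_up (x : ℝ × ℝ) (hx : |m * x.2| ≤ 1) : u x = 0 := hz x (by
    rwa [abs_mul, abs_of_pos hm, inv_mul_le_one₀ hL] at hx)
  have hz_down (x : ℝ × ℝ) (hx : |-m * x.2| ≤ 1) : u x = 0 := hz_up x (by
    rwa [neg_mul, abs_neg] at hx)
  have hmag_up := h.smoothTransition_smul hz_up
  have hmag_down := h.smoothTransition_smul hz_down
  have hupper := h.abs_mul_integral_smoothTransition_le ha hz_up (s := 1) fun x hx =>
    if_pos ((pos_iff_pos_of_mul_pos hx).1 hm)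
  have hlower := h.abs_mul_integral_smoothTransition_le ha hz_down (s := a) fun x hx => by
    rw [neg_mul, neg_pos] at hx
    exact if_neg (neg_of_mul_neg_right hx hm.le).not_gt
  have hmass : ∫ x, ‖u x‖ ^ 2 = (∫ x, ‖Real.smoothTransition (m * x.2) • u x‖ ^ 2) +
      ∫ x, ‖Real.smoothTransition (-m * x.2) • u x‖ ^ 2 := by
    rw [← integral_add (integrable_norm_sq hmag_up.memLp) (integrable_norm_sq hmag_down.memLp)]
    congr 1; ext x
    by_cases hx : |m * x.2| ≤ 1
    · simp [hz_up x hx]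
    · rw [norm_smul_sq, norm_smul_sq, ← add_mul, neg_mul,
        smoothTransition_sq_add_neg_sq (not_le.1 hx).le, one_mul]
  have hsplit₁ := integral_smoothTransition_add_neg_le h.memLp₁ hmag_up.memLp₁ hmag_down.memLp₁
  have hsplit₂ := integral_smoothTransition_add_neg_le h.memLp₂ hmag_up.memLp₂ hmag_down.memLp₂
  have hmass_up : |a| * ∫ x, ‖Real.smoothTransition (m * x.2) • u x‖ ^ 2 ≤
      |1| * ∫ x, ‖Real.smoothTransition (m * x.2) • u x‖ ^ 2 := by
    rw [abs_one]
    gcongr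
  rw [hmass, mul_add]
  linarith

/-- The part of `u` away from the line `x₂ = 0` has non-negative quadratic energy. -/
theorem quadratic_cos_smul_le (h : MagH1 a u v₁ v₂) (ha : |a| ≤ 1) (hb : 0 ≤ b)
    (hab : 1 ≤ b * |a|) (hθ : ContDiff ℝ ∞ θ) (hC : ∀ t, |deriv θ t| ≤ C) (hL : 0 < L)
    (hθL : ∀ t, |t| ≤ L → θ t = 0) :
    b * ((∫ x, ‖Real.cos (θ x.2) • v₁ x‖ ^ 2) +
      ∫ x, ‖Real.cos (θ x.2) • v₂ x - (Real.sin (θ x.2) * deriv θ x.2) • u x‖ ^ 2) -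
      ∫ x, ‖Real.cos (θ x.2) • u x‖ ^ 2 ≤
    b * ((∫ x, ‖v₁ x‖ ^ 2) + ∫ x, ‖v₂ x‖ ^ 2) - (∫ x, ‖u x‖ ^ 2) +
      b * ∫ x, deriv θ x.2 ^ 2 * ‖u x‖ ^ 2 := by
  have houter := mul_le_mul_of_nonneg_left ((h.sin_smul hθ hC).abs_mul_integral_le_of_eq_zero ha hL
    fun x hx => by simp [hθL _ hx]) hb
  have henergy := congrArg (b * ·) (h.integral_localize hθ hC)
  have hmass := h.integral_localize_mass hθ hC
  have hpos := mul_le_mul_of_nonneg_right hab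
    (integral_nonneg fun x => sq_nonneg ‖Real.sin (θ x.2) • u x‖ :
      0 ≤ ∫ x, ‖Real.sin (θ x.2) • u x‖ ^ 2)
  simp only [mul_add] at houter henergy ⊢
  linarith

end MagH1

/-! ### Coercivity and lower bounds for the energy -/

section Coercivity

variable {a C L : ℝ} {u v₁ v₂ : ℝ × ℝ → ℂ}

theorem MagH1.integral_le_weight (h : MagH1 a u v₁ v₂) {k : ℝ → ℝ} (hk : ∀ t, k t ≤ C)
    (hC : 0 ≤ C) (hki : Integrable fun x : ℝ × ℝ => k x.2 * ‖u x‖ ^ 2)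
    (hz : ∀ t, 2 ≤ |t| → k t = 0) :
    ∫ x, k x.2 * ‖u x‖ ^ 2 ≤ 5 * C * ∫ x : ℝ × ℝ, (1 + x.2 ^ 2)⁻¹ * ‖u x‖ ^ 2 := by
  have hweight : Integrable fun x : ℝ × ℝ => (1 + x.2 ^ 2)⁻¹ * ‖u x‖ ^ 2 :=
    integrable_mul_norm_sq (C := 1) h.memLp (Measurable.aestronglyMeasurable (by fun_prop))
      fun x => by
        rw [abs_of_nonneg (by positivity)]
        exact inv_le_one_of_one_le₀ (by nlinarith [sq_nonneg x.2])
  rw [← integral_const_mul]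
  refine integral_mono hki (hweight.const_mul _) fun x => ?_
  simp only [← mul_assoc]
  gcongr
  rcases le_or_gt 2 |x.2| with hx | hx
  · rw [hz _ hx]; positivity
  · have hone : 1 ≤ 5 * (1 + x.2 ^ 2)⁻¹ := by
      rw [← div_eq_mul_inv, le_div_iff₀ (by positivity)]
      nlinarith [sq_abs x.2, abs_nonneg x.2]
    calc k x.2 ≤ C * 1 := by rw [mul_one]; exact hk _
      _ ≤ C * (5 * (1 + x.2 ^ 2)⁻¹) := by gcongr
      _ = 5 * C * (1 + x.2 ^ 2)⁻¹ := by ring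

theorem cos_cutAngle_sq_le_one (L t : ℝ) : Real.cos (cutAngle L t) ^ 2 ≤ 1 :=
  Real.cos_sq_le_one _

theorem cos_cutAngle_eq_zero (hL : 0 < L) {t : ℝ} (ht : 2 * L ≤ |t|) :
    Real.cos (cutAngle L t) = 0 := by
  rw [cutAngle_eq_pi_div_two hL ht, Real.cos_pi_div_two]

theorem deriv_cutAngle_sq_le (hL : 0 < L) (t : ℝ) :
    deriv (cutAngle L) t ^ 2 ≤ (angleSlope / L) ^ 2 :=
  sq_le_sq' (abs_le.1 (abs_deriv_cutAngle_le hL t)).1 (abs_le.1 (abs_deriv_cutAngle_le hL t)).2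

/-- Near the line `x₂ = 0` the mass is controlled by the Hardy weight, away from it by the
magnetic field. -/
theorem MagH1.mass_le (h : MagH1 a u v₁ v₂) (ha0 : a ≠ 0) (ha : |a| ≤ 1) :
    ∫ x, ‖u x‖ ^ 2 ≤ 5 * (1 + angleSlope ^ 2 / |a|) *
      (∫ x : ℝ × ℝ, (1 + x.2 ^ 2)⁻¹ * ‖u x‖ ^ 2) +
        ((∫ x, ‖v₁ x‖ ^ 2) + ∫ x, ‖v₂ x‖ ^ 2) / |a| := by
  have hθ := contDiff_cutAngle 1
  have hC := abs_deriv_cutAngle_le one_pos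
  have habs : 0 < |a| := abs_pos.2 ha0
  set P := ∫ x : ℝ × ℝ, (1 + x.2 ^ 2)⁻¹ * ‖u x‖ ^ 2
  set q := (∫ x, ‖v₁ x‖ ^ 2) + ∫ x, ‖v₂ x‖ ^ 2
  have hinner : ∫ x, ‖Real.cos (cutAngle 1 x.2) • u x‖ ^ 2 ≤ 5 * P := by
    have hint := integrable_norm_sq (h.cos_smul hθ hC).memLp
    simp only [norm_smul_sq] at hint ⊢
    simpa using h.integral_le_weight (k := fun t => Real.cos (cutAngle 1 t) ^ 2)
      (cos_cutAngle_sq_le_one 1) zero_le_one hint fun t ht => by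
        simp [cos_cutAngle_eq_zero one_pos (by simpa using ht)]
  have hslope : ∫ x, deriv (cutAngle 1) x.2 ^ 2 * ‖u x‖ ^ 2 ≤ 5 * angleSlope ^ 2 * P :=
    h.integral_le_weight (k := fun t => deriv (cutAngle 1) t ^ 2)
      (fun t => by simpa using deriv_cutAngle_sq_le one_pos t) (by positivity)
      (h.integrable_deriv_sq_mul hθ hC) fun t ht => by
        simp [deriv_cutAngle_eq_zero one_pos (by simpa using ht)]
  have houter : ∫ x, ‖Real.sin (cutAngle 1 x.2) • u x‖ ^ 2 ≤
      (q + 5 * angleSlope ^ 2 * P) / |a| := by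
    have hform := (h.sin_smul hθ hC).abs_mul_integral_le_of_eq_zero ha one_pos fun x hx => by
      simp [cutAngle_eq_zero one_pos hx]
    have hcos : 0 ≤ (∫ x, ‖Real.cos (cutAngle 1 x.2) • v₁ x‖ ^ 2) +
      ∫ x, ‖Real.cos (cutAngle 1 x.2) • v₂ x -
        (Real.sin (cutAngle 1 x.2) * deriv (cutAngle 1) x.2) • u x‖ ^ 2 := by positivity
    rw [le_div_iff₀' habs]
    linarith [h.integral_localize hθ hC]
  calc ∫ x, ‖u x‖ ^ 2 ≤ 5 * P + (q + 5 * angleSlope ^ 2 * P) / |a| := by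
        rw [← h.integral_localize_mass hθ hC]; exact add_le_add hinner houter
    _ = 5 * (1 + angleSlope ^ 2 / |a|) * P + q / |a| := by ring

theorem exists_coercive (ha0 : a ≠ 0) (ha : |a| ≤ 1) :
    ∃ c > 0, ∀ u v₁ v₂ : ℝ × ℝ → ℂ, MagH1 a u v₁ v₂ →
      c * ∫ x, ‖u x‖ ^ 2 ≤ (∫ x, ‖v₁ x‖ ^ 2) + ∫ x, ‖v₂ x‖ ^ 2 := by
  have : 0 < |a| := abs_pos.2 ha0
  have := Real.pi_pos
  set K : ℝ := 5 * (1 + angleSlope ^ 2 / |a|) * Real.pi with hK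
  refine ⟨1 / (K ^ 2 + 2 / |a|), by positivity, fun u v₁ v₂ h => ?_⟩
  set m := ∫ x, ‖u x‖ ^ 2
  set q := (∫ x, ‖v₁ x‖ ^ 2) + ∫ x, ‖v₂ x‖ ^ 2
  have hm0 : 0 ≤ m := by positivity
  have hq0 : 0 ≤ q := by positivity
  have hHardy : ∫ x : ℝ × ℝ, (1 + x.2 ^ 2)⁻¹ * ‖u x‖ ^ 2 ≤ Real.pi * (√m * √q) := by
    refine h.integral_weight_le.trans ?_
    gcongr
    exact le_add_of_nonneg_left (by positivity)
  have hmass : m ≤ K * (√m * √q) + q / |a| := by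
    refine (h.mass_le ha0 ha).trans ?_
    rw [hK, mul_assoc _ Real.pi]
    gcongr
  have hyoung : K * (√m * √q) ≤ m / 2 + K ^ 2 * q / 2 := by
    nlinarith [sq_nonneg (√m - K * √q), Real.sq_sqrt hm0, Real.sq_sqrt hq0]
  rw [one_div, inv_mul_le_iff₀ (by positivity)]
  linarith [show (K ^ 2 + 2 / |a|) * q = K ^ 2 * q + 2 * (q / |a|) by ring]

end Coercivity

section Box

variable {a b C L R : ℝ} {u v₁ v₂ : ℝ × ℝ → ℂ}

/-- The part `(-R/2, R/2) × (-2L, 2L)` of the strip in which the cutoff of angle `cutAngle L`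
lives. -/
def box (R L : ℝ) : Set (ℝ × ℝ) := Ioo (-R / 2) (R / 2) ×ˢ Ioo (-(2 * L)) (2 * L)

theorem volume_box (hR : 0 < R) (L : ℝ) : volume (box R L) = ENNReal.ofReal (4 * R * L) := by
  rw [box, Measure.volume_eq_prod, Measure.prod_prod, Real.volume_Ioo, Real.volume_Ioo,
    ← ENNReal.ofReal_mul (by linarith)]
  congr 1; ring

theorem notMem_strip_or_of_notMem_box {x : ℝ × ℝ} (hx : x ∉ box R L) :
    x ∉ strip R ∨ 2 * L ≤ |x.2| := by
  by_contra! h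
  exact hx ⟨h.1.1, abs_lt.1 h.2⟩

theorem setIntegral_box_norm_sq_le (hu : MemLp u 2 volume) (hq : Integrable fun x => ‖u x‖ ^ 4)
    (hR : 0 < R) (hL : 0 < L) {s : ℝ} (hs : 0 < s) :
    ∫ x in box R L, ‖u x‖ ^ 2 ≤ s * (∫ x, ‖u x‖ ^ 4) + 1 / s * (R * L) := by
  have hfin : IsFiniteMeasure (volume.restrict (box R L)) := ⟨by
    rw [Measure.restrict_apply_univ, volume_box hR L]; exact ENNReal.ofReal_lt_top⟩
  have hqs : Integrable (fun x => s * ‖u x‖ ^ 4) (volume.restrict (box R L)) :=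
    (hq.const_mul s).integrableOn
  calc ∫ x in box R L, ‖u x‖ ^ 2 ≤ ∫ x in box R L, (s * ‖u x‖ ^ 4 + 1 / (4 * s)) := by
        refine integral_mono (integrable_norm_sq hu).integrableOn
          (hqs.add (integrable_const _)) fun x => ?_
        have hsquare : s * ‖u x‖ ^ 4 + 1 / (4 * s) - ‖u x‖ ^ 2 =
            s * (‖u x‖ ^ 2 - 1 / (2 * s)) ^ 2 := by
          field_simp; ring
        exact sub_nonneg.1 (hsquare.ge.trans' (by positivity))
    _ = s * (∫ x in box R L, ‖u x‖ ^ 4) + 1 / s * (R * L) := by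
        rw [integral_add hqs (integrable_const _), integral_const_mul, integral_const,
          smul_eq_mul, Measure.real, Measure.restrict_apply_univ, volume_box hR L,
          ENNReal.toReal_ofReal (by positivity)]
        field_simp
    _ ≤ s * (∫ x, ‖u x‖ ^ 4) + 1 / s * (R * L) := by
        gcongr ?_ + _
        exact mul_le_mul_of_nonneg_left
          (setIntegral_le_integral hq (.of_forall fun x => by positivity)) hs.le

namespace IsAdmissible

theorem integral_le_box (h : IsAdmissible a R u v₁ v₂) {k : ℝ → ℝ} (hk : ∀ t, k t ≤ C)
    (hki : Integrable fun x : ℝ × ℝ => k x.2 * ‖u x‖ ^ 2) (hz : ∀ t, 2 * L ≤ |t| → k t = 0) :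
    ∫ x, k x.2 * ‖u x‖ ^ 2 ≤ C * ∫ x in box R L, ‖u x‖ ^ 2 := by
  have hout (x : ℝ × ℝ) (hx : x ∉ box R L) : k x.2 * ‖u x‖ ^ 2 = 0 := by
    rcases notMem_strip_or_of_notMem_box hx with hx | hx
    · simp [h.eq_zero x hx]
    · simp [hz _ hx]
  rw [← setIntegral_eq_integral_of_forall_compl_eq_zero hout, ← integral_const_mul]
  refine integral_mono hki.integrableOn
    ((integrable_norm_sq h.magH1.memLp).integrableOn.const_mul C) fun x => ?_
  exact mul_le_mul_of_nonneg_right (hk _) (by positivity)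

theorem integral_deriv_cutAngle_le_box (h : IsAdmissible a R u v₁ v₂) (hL : 0 < L) :
    ∫ x, deriv (cutAngle L) x.2 ^ 2 * ‖u x‖ ^ 2 ≤
      (angleSlope / L) ^ 2 * ∫ x in box R L, ‖u x‖ ^ 2 :=
  h.integral_le_box (k := fun t => deriv (cutAngle L) t ^ 2) (deriv_cutAngle_sq_le hL)
    (h.magH1.integrable_deriv_sq_mul (contDiff_cutAngle L) (abs_deriv_cutAngle_le hL))
    fun t ht => by simp [deriv_cutAngle_eq_zero hL ht]

theorem integral_cos_cutAngle_le_box (h : IsAdmissible a R u v₁ v₂) (hL : 0 < L) :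
    ∫ x, ‖Real.cos (cutAngle L x.2) • u x‖ ^ 2 ≤ ∫ x in box R L, ‖u x‖ ^ 2 := by
  have hint := integrable_norm_sq
    (h.magH1.cos_smul (contDiff_cutAngle L) (abs_deriv_cutAngle_le hL)).memLp
  simp only [norm_smul_sq] at hint ⊢
  simpa using h.integral_le_box (k := fun t => Real.cos (cutAngle L t) ^ 2)
    (cos_cutAngle_sq_le_one L) hint fun t ht => by simp [cos_cutAngle_eq_zero hL ht]

end IsAdmissible

theorem one_le_of_one_le_mul_abs (ha : |a| ≤ 1) (hb : 0 ≤ b) (hab : 1 ≤ b * |a|) : 1 ≤ b :=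
  hab.trans (mul_le_of_le_one_right hb ha)

/-- The constant in the bound `planeEnergy ≥ -lowerConst * b² * R`. -/
def lowerConst : ℝ := 16 * angleSlope ^ 4

theorem sixteen_le_lowerConst : 16 ≤ lowerConst := by
  have := one_le_pow₀ one_le_angleSlope (n := 4)
  unfold lowerConst; linarith

theorem four_mul_sq_le_lowerConst (hb : 1 ≤ b) :
    4 * (1 + b * angleSlope ^ 2) ^ 2 ≤ lowerConst * b ^ 2 := by
  have hone : 1 ≤ b * angleSlope ^ 2 := by nlinarith [one_le_pow₀ one_le_angleSlope (n := 2)]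
  rw [lowerConst]
  nlinarith

theorem IsAdmissible.lower_bound (h : IsAdmissible a R u v₁ v₂) (ha : |a| ≤ 1) (hb : 0 ≤ b)
    (hab : 1 ≤ b * |a|) (hR : 0 < R) :
    (1 / 4) * (∫ x, ‖u x‖ ^ 4) - lowerConst * b ^ 2 * R ≤ planeEnergy b u v₁ v₂ := by
  have houter := h.magH1.quadratic_cos_smul_le ha hb hab (contDiff_cutAngle 1)
    (abs_deriv_cutAngle_le one_pos) one_pos fun t => cutAngle_eq_zero one_pos
  have hslope := mul_le_mul_of_nonneg_left (h.integral_deriv_cutAngle_le_box one_pos) hb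
  have hinner := h.integral_cos_cutAngle_le_box one_pos
  have hcos := mul_nonneg hb (by positivity :
    0 ≤ (∫ x, ‖Real.cos (cutAngle 1 x.2) • v₁ x‖ ^ 2) + ∫ x, ‖Real.cos (cutAngle 1 x.2) • v₂ x -
      (Real.sin (cutAngle 1 x.2) * deriv (cutAngle 1) x.2) • u x‖ ^ 2)
  set c : ℝ := 1 + b * angleSlope ^ 2 with hc
  have hc0 : 0 < c := by positivity
  have hyoung := setIntegral_box_norm_sq_le h.magH1.memLp h.quartic hR one_pos
    (s := 1 / (4 * c)) (by positivity)
  rw [div_one] at hslope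
  set B := ∫ x in box R 1, ‖u x‖ ^ 2
  have hbox : c * B ≤ (1 / 4) * (∫ x, ‖u x‖ ^ 4) + lowerConst * b ^ 2 * R :=
    calc c * B ≤ c * (1 / (4 * c) * (∫ x, ‖u x‖ ^ 4) + 1 / (1 / (4 * c)) * (R * 1)) := by gcongr
      _ = (1 / 4) * (∫ x, ‖u x‖ ^ 4) + 4 * c ^ 2 * R := by field_simp
      _ ≤ (1 / 4) * (∫ x, ‖u x‖ ^ 4) + lowerConst * b ^ 2 * R := by
        gcongr _ + ?_ * R
        exact four_mul_sq_le_lowerConst (one_le_of_one_le_mul_abs ha hb hab)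
  unfold planeEnergy
  linarith [show c * B = B + b * (angleSlope ^ 2 * B) by ring]

theorem neg_mem_lowerBounds_energyValues (ha : |a| ≤ 1) (hb : 0 ≤ b) (hab : 1 ≤ b * |a|)
    (hR : 0 < R) : -(lowerConst * b ^ 2 * R) ∈ lowerBounds (energyValues a b R) := by
  intro E hE
  obtain ⟨u, v₁, v₂, h, rfl⟩ := mem_energyValues_iff.1 hE
  linarith [h.lower_bound ha hb hab hR, (by positivity : 0 ≤ ∫ x, ‖u x‖ ^ 4)]

theorem planeEnergy_nonneg {c : ℝ} (hb : 0 ≤ b) (hbc : 1 ≤ b * c)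
    (h : c * ∫ x, ‖u x‖ ^ 2 ≤ (∫ x, ‖v₁ x‖ ^ 2) + ∫ x, ‖v₂ x‖ ^ 2) :
    0 ≤ planeEnergy b u v₁ v₂ := by
  have hform := mul_le_mul_of_nonneg_left h hb
  have hmass := mul_le_mul_of_nonneg_right hbc (by positivity : 0 ≤ ∫ x, ‖u x‖ ^ 2)
  have hquartic : 0 ≤ ∫ x, ‖u x‖ ^ 4 := by positivity
  unfold planeEnergy
  linarith

theorem zero_mem_lowerBounds_energyValues (ha0 : 0 < a) (ha : a ≤ 1) (hb : 0 ≤ b)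
    (hab : 1 ≤ b * a) (R : ℝ) : 0 ∈ lowerBounds (energyValues a b R) := by
  intro E hE
  obtain ⟨u, v₁, v₂, h, rfl⟩ := mem_energyValues_iff.1 hE
  exact planeEnergy_nonneg hb hab (h.magH1.mul_integral_le_of_pos ha0 ha)

end Box

/-! ### The magnetic quadratic form and the bottom of the spectrum -/

section Operators

theorem exists_forall_eq_iff_isUnit {𝕜 H : Type*} [NontriviallyNormedField 𝕜]
    [NormedAddCommGroup H] [NormedSpace 𝕜 H] (T : H →L[𝕜] H) (c : 𝕜) :
    (∃ S : H →L[𝕜] H, ∀ f u, u = T (f + c • u) ↔ u = S f) ↔ IsUnit (1 - c • T) := by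
  constructor
  · rintro ⟨S, hS⟩
    have hSf (f : H) : S f = T (f + c • S f) := (hS f (S f)).2 rfl
    refine ⟨⟨1 - c • T, 1 + c • S, ?_, ?_⟩, rfl⟩
    · ext f
      change (f + c • S f) - c • T (f + c • S f) = f
      rw [← hSf, add_sub_cancel_right]
    · ext x
      have hx : T x = S (x - c • T x) := (hS _ _).1 (by rw [sub_add_cancel])
      change (x - c • T x) + c • S (x - c • T x) = x
      rw [← hx, sub_add_cancel]
  · rintro ⟨A, hA⟩
    have hleft (x : H) : (↑A⁻¹ : H →L[𝕜] H) (x - c • T x) = x := by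
      simpa [hA] using DFunLike.congr_fun A.inv_mul x
    have hright (x : H) : (↑A⁻¹ : H →L[𝕜] H) x - c • T ((↑A⁻¹ : H →L[𝕜] H) x) = x := by
      simpa [hA] using DFunLike.congr_fun A.mul_inv x
    refine ⟨T ∘L ↑A⁻¹, fun f u => ?_⟩
    rw [ContinuousLinearMap.comp_apply]
    constructor
    · intro h
      have hfu := hleft (f + c • u)
      rw [← h, add_sub_cancel_right] at hfu
      rwa [hfu]
    · intro h
      have hfu := hright f
      rw [← h, sub_eq_iff_eq_add] at hfu
      rwa [← hfu]

theorem isUnit_one_sub_smul_iff {𝕜 A : Type*} [Field 𝕜] [Ring A] [Algebra 𝕜 A] {T : A} {c : 𝕜}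
    (hc : c ≠ 0) : IsUnit (1 - c • T) ↔ c⁻¹ ∉ spectrum 𝕜 T := by
  have hfactor : 1 - c • T = Units.mk0 c hc • (algebraMap 𝕜 A c⁻¹ - T) := by
    rw [Units.smul_mk0, smul_sub, Algebra.algebraMap_eq_smul_one, smul_inv_smul₀ hc]
  rw [hfactor, spectrum.notMem_iff, isUnit_smul_iff]

variable {A : Type*} [CStarAlgebra A] [PartialOrder A] [StarOrderedRing A] {T : A}

theorem isUnit_one_sub_smul_of_nonneg (hT : 0 ≤ T) {c : ℝ} (hc : c * ‖T‖ < 1) :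
    IsUnit (1 - c • T) := by
  nontriviality A
  rcases eq_or_ne c 0 with rfl | hc0
  · simp
  · rw [isUnit_one_sub_smul_iff hc0]
    intro hmem
    have hpos : 0 < c := (inv_nonneg.1 (spectrum_nonneg_of_nonneg hT hmem)).lt_of_ne' hc0
    have hle : c⁻¹ ≤ ‖T‖ := (Real.le_norm_self _).trans (spectrum.norm_le_norm_of_mem hmem)
    exact hc.not_ge ((inv_le_iff_one_le_mul₀' hpos).1 hle)

theorem not_isUnit_one_sub_inv_norm_smul (hT : 0 ≤ T) (hT0 : T ≠ 0) :
    ¬ IsUnit (1 - ‖T‖⁻¹ • T) := by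
  have : Nontrivial A := nontrivial_of_ne T 0 hT0
  rw [isUnit_one_sub_smul_iff (inv_ne_zero (norm_ne_zero_iff.2 hT0)), inv_inv, not_not]
  exact CStarAlgebra.norm_mem_spectrum_of_nonneg hT

end Operators

section SquareIntegrable

variable {α : Type*} [MeasurableSpace α] {μ : Measure α} {f : α → ℂ}

theorem inner_toLp (hf : MemLp f 2 μ) (g : Lp ℂ 2 μ) :
    inner ℂ (hf.toLp f) g = ∫ x, starRingEnd ℂ (f x) * g x ∂μ := by
  rw [L2.inner_def]
  refine integral_congr_ae ?_
  filter_upwards [hf.coeFn_toLp] with x hx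
  rw [hx, RCLike.inner_apply, mul_comm]

theorem integrable_conj_mul (hf : MemLp f 2 μ) (g : Lp ℂ 2 μ) :
    Integrable (fun x => starRingEnd ℂ (f x) * g x) μ :=
  MemLp.integrable_mul (p := 2) (q := 2) hf.star (Lp.memLp g)

theorem norm_sq_eq_integral (g : Lp ℂ 2 μ) : ‖g‖ ^ 2 = ∫ x, ‖g x‖ ^ 2 ∂μ := by
  have hinner : ((‖g‖ ^ 2 : ℝ) : ℂ) = ((∫ x, ‖g x‖ ^ 2 ∂μ : ℝ) : ℂ) := by
    rw [← integral_complex_ofReal, Complex.ofReal_pow]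
    refine (inner_self_eq_norm_sq_to_K (𝕜 := ℂ) g).symm.trans ?_
    rw [L2.inner_def]
    refine integral_congr_ae (.of_forall fun x => ?_)
    simp only [inner_self_eq_norm_sq_to_K, Complex.coe_algebraMap, Complex.ofReal_pow]
  exact Complex.ofReal_injective hinner

theorem norm_toLp_sq (hf : MemLp f 2 μ) : ‖hf.toLp f‖ ^ 2 = ∫ x, ‖f x‖ ^ 2 ∂μ := by
  rw [norm_sq_eq_integral]
  refine integral_congr_ae ?_
  filter_upwards [hf.coeFn_toLp] with x hx
  rw [hx]

theorem tendsto_toLp {ι : Type*} {l : Filter ι} {F : ι → α → ℂ} (hF : ∀ n, MemLp (F n) 2 μ)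
    {g : Lp ℂ 2 μ} (h : Tendsto (fun n => eLpNorm (F n - ⇑g) 2 μ) l (𝓝 0)) :
    Tendsto (fun n => (hF n).toLp (F n)) l (𝓝 g) := by
  simpa only [Lp.toLp_coeFn] using
    (Lp.tendsto_Lp_iff_tendsto_eLpNorm'' F hF g (Lp.memLp g)).2 h

end SquareIntegrable

section FormDomain

variable {a : ℝ} {u v₁ v₂ u' v₁' v₂' : ℝ × ℝ → ℂ} {φ : ℝ × ℝ → ℝ}

theorem MagH1.congr_ae (h : MagH1 a u v₁ v₂) (hu : u =ᵐ[volume] u') (h₁ : v₁ =ᵐ[volume] v₁')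
    (h₂ : v₂ =ᵐ[volume] v₂') : MagH1 a u' v₁' v₂' where
  memLp := h.memLp.ae_eq hu
  memLp₁ := h.memLp₁.ae_eq h₁
  memLp₂ := h.memLp₂.ae_eq h₂
  weak₁ := h.weak₁.congr_ae hu <| by filter_upwards [hu, h₁] with x e₀ e₁; rw [e₀, e₁]
  weak₂ := h.weak₂.congr_ae hu h₂

/-- The Hilbert space `L² × L² × L²`, in which a magnetic Sobolev function is represented by the
triple consisting of the function and its magnetic gradient. -/
abbrev GraphSpace : Type := PiLp 2 fun _ : Fin 3 => L2

/-- The element of `GraphSpace` with given components. -/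
def graphVec (f g h : L2) : GraphSpace := WithLp.toLp 2 ![f, g, h]

theorem inner_graphVec (f g h : L2) (U : GraphSpace) :
    inner ℂ (graphVec f g h) U = inner ℂ f (U 0) + inner ℂ g (U 1) + inner ℂ h (U 2) := by
  rw [PiLp.inner_apply, Fin.sum_univ_three]
  rfl

theorem GraphSpace.norm_sq (U : GraphSpace) :
    ‖U‖ ^ 2 = ‖U 0‖ ^ 2 + ‖U 1‖ ^ 2 + ‖U 2‖ ^ 2 := by
  rw [PiLp.norm_sq_eq_of_L2, Fin.sum_univ_three]

theorem IsTestFunction.ofReal (h : IsTestFunction φ) : IsTestFunction fun x => (φ x : ℂ) :=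
  h.clm_comp Complex.ofRealCLM

theorem fderiv_clm_comp_apply {E F G : Type*} [NormedAddCommGroup E] [NormedSpace ℝ E]
    [NormedAddCommGroup F] [NormedSpace ℝ F] [NormedAddCommGroup G] [NormedSpace ℝ G]
    (ℓ : F →L[ℝ] G) {f : E → F} (hf : Differentiable ℝ f) (x e : E) :
    fderiv ℝ (fun y => ℓ (f y)) x e = ℓ (fderiv ℝ f x e) := by
  have : HasFDerivAt (fun y => ℓ (f y)) (ℓ ∘L fderiv ℝ f x) x :=
    ℓ.hasFDerivAt.comp x (hf x).hasFDerivAt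
  rw [this.fderiv, ContinuousLinearMap.comp_apply]

theorem mag1_ofReal (hφ : IsTestFunction φ) (a : ℝ) (x : ℝ × ℝ) :
    mag1 a (fun y => (φ y : ℂ)) x = fderiv ℝ φ x (1, 0) - Complex.I * pot a x * φ x :=
  congrArg (· - _) (fderiv_clm_comp_apply Complex.ofRealCLM hφ.differentiable x (1, 0))

theorem mag2_ofReal (hφ : IsTestFunction φ) (x : ℝ × ℝ) :
    mag2 (fun y => (φ y : ℂ)) x = fderiv ℝ φ x (0, 1) :=
  fderiv_clm_comp_apply Complex.ofRealCLM hφ.differentiable x (0, 1)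

/-- The vectors of `GraphSpace` to which `(u, v₁, v₂)` is orthogonal precisely when `(v₁, v₂)` is
the weak magnetic gradient of `u`. -/
def gradTests (a : ℝ) : Set GraphSpace :=
  {w | ∃ (φ : ℝ × ℝ → ℝ) (hφ : IsTestFunction φ),
    w = graphVec ((hφ.ofReal.magH1 a).memLp₁.toLp _) ((hφ.ofReal.magH1 a).memLp.toLp _) 0 ∨
    w = graphVec ((hφ.ofReal.magH1 a).memLp₂.toLp _) 0 ((hφ.ofReal.magH1 a).memLp.toLp _)}

theorem inner_gradTest₁ (hφ : IsTestFunction φ) (a : ℝ) (U : GraphSpace) :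
    inner ℂ (graphVec ((hφ.ofReal.magH1 a).memLp₁.toLp _) ((hφ.ofReal.magH1 a).memLp.toLp _) 0) U =
      ∫ x, (fderiv ℝ φ x (1, 0) • U 0 x +
        φ x • (U 1 x + Complex.I * (pot a x : ℂ) * U 0 x)) := by
  have h := hφ.ofReal.magH1 a
  rw [inner_graphVec, inner_zero_left, add_zero, inner_toLp, inner_toLp,
    ← integral_add (integrable_conj_mul h.memLp₁ _) (integrable_conj_mul h.memLp _)]
  congr 1; ext x
  rw [mag1_ofReal hφ]
  simp only [map_sub, map_mul, Complex.conj_ofReal, Complex.conj_I, Complex.real_smul]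
  ring

theorem inner_gradTest₂ (hφ : IsTestFunction φ) (a : ℝ) (U : GraphSpace) :
    inner ℂ (graphVec ((hφ.ofReal.magH1 a).memLp₂.toLp _) 0 ((hφ.ofReal.magH1 a).memLp.toLp _)) U =
      ∫ x, (fderiv ℝ φ x (0, 1) • U 0 x + φ x • U 2 x) := by
  have h := hφ.ofReal.magH1 a
  rw [inner_graphVec, inner_zero_left, add_zero, inner_toLp, inner_toLp,
    ← integral_add (integrable_conj_mul h.memLp₂ _) (integrable_conj_mul h.memLp _)]
  congr 1; ext x
  rw [mag2_ofReal hφ]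
  simp only [Complex.conj_ofReal, Complex.real_smul]

/-- The magnetic Sobolev space as a closed subspace of `GraphSpace`. -/
def formDomain (a : ℝ) : Submodule ℂ GraphSpace := (Submodule.span ℂ (gradTests a))ᗮ

instance (a : ℝ) : CompleteSpace (formDomain a) := by
  unfold formDomain; infer_instance

theorem mem_formDomain_iff {U : GraphSpace} :
    U ∈ formDomain a ↔ MagH1 a (U 0) (U 1) (U 2) := by
  have hU (i : Fin 3) : LocallyIntegrable (U i) volume :=
    (Lp.memLp (U i)).locallyIntegrable (by norm_num)
  rw [formDomain, Submodule.mem_orthogonal]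
  constructor
  · intro h
    refine ⟨Lp.memLp _, Lp.memLp _, Lp.memLp _,
      ⟨hU 0, (hU 1).add (locallyIntegrable_pot_mul a (hU 0)), fun φ hφ => ?_⟩,
      ⟨hU 0, hU 2, fun φ hφ => ?_⟩⟩
    · rw [← inner_gradTest₁ hφ]
      exact h _ (Submodule.subset_span ⟨φ, hφ, Or.inl rfl⟩)
    · rw [← inner_gradTest₂ hφ a]
      exact h _ (Submodule.subset_span ⟨φ, hφ, Or.inr rfl⟩)
  · intro h w hw
    induction hw using Submodule.span_induction with
    | mem w hw =>
      obtain ⟨φ, hφ, rfl | rfl⟩ := hw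
      · rw [inner_gradTest₁ hφ, h.weak₁.integral_eq_zero φ hφ]
      · rw [inner_gradTest₂ hφ a, h.weak₂.integral_eq_zero φ hφ]
    | zero => exact inner_zero_left U
    | add x y _ _ hx hy => rw [inner_add_left, hx, hy, add_zero]
    | smul c x _ hx => rw [inner_smul_left, hx, mul_zero]

/-- The element of the form domain given by a magnetic Sobolev function. -/
def MagH1.vec (h : MagH1 a u v₁ v₂) : formDomain a :=
  ⟨graphVec (h.memLp.toLp u) (h.memLp₁.toLp v₁) (h.memLp₂.toLp v₂), mem_formDomain_iff.2
    (h.congr_ae h.memLp.coeFn_toLp.symm h.memLp₁.coeFn_toLp.symm h.memLp₂.coeFn_toLp.symm)⟩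

theorem MagH1.inner_vec (h : MagH1 a u v₁ v₂) (U : formDomain a) :
    inner ℂ h.vec U = inner ℂ (h.memLp.toLp u) (U.1 0) + inner ℂ (h.memLp₁.toLp v₁) (U.1 1) +
      inner ℂ (h.memLp₂.toLp v₂) (U.1 2) :=
  inner_graphVec _ _ _ _

theorem MagH1.norm_vec_sq (h : MagH1 a u v₁ v₂) :
    ‖h.vec‖ ^ 2 = (∫ x, ‖u x‖ ^ 2) + (∫ x, ‖v₁ x‖ ^ 2) + ∫ x, ‖v₂ x‖ ^ 2 := by
  rw [Submodule.coe_norm, GraphSpace.norm_sq, ← norm_toLp_sq h.memLp, ← norm_toLp_sq h.memLp₁,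
    ← norm_toLp_sq h.memLp₂]
  rfl

theorem denseRange_testVec (a : ℝ) :
    DenseRange fun ϕ : {ϕ : ℝ × ℝ → ℂ // IsTestFunction ϕ} => (ϕ.2.magH1 a).vec := by
  intro U
  obtain ⟨ϕ, hϕ, hu, h₁, h₂⟩ := (mem_formDomain_iff.1 U.2).exists_seq_isTestFunction
  refine mem_closure_of_tendsto (f := fun n => ((hϕ n).magH1 a).vec) (b := atTop) ?_
    (.of_forall fun n => ⟨⟨ϕ n, hϕ n⟩, rfl⟩)
  have hcomp : Tendsto (fun n => (WithLp.ofLp ((hϕ n).magH1 a).vec.1 : Fin 3 → L2)) atTop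
      (𝓝 (WithLp.ofLp U.1)) := by
    refine tendsto_pi_nhds.2 fun i => ?_
    fin_cases i
    · exact tendsto_toLp (fun n => ((hϕ n).magH1 a).memLp) hu
    · exact tendsto_toLp (fun n => ((hϕ n).magH1 a).memLp₁) h₁
    · exact tendsto_toLp (fun n => ((hϕ n).magH1 a).memLp₂) h₂
  exact tendsto_subtype_rng.2 (((PiLp.continuous_toLp 2 fun _ : Fin 3 => L2).tendsto _).comp hcomp)

end FormDomain

section Hamiltonian

variable {a : ℝ} {u v₁ v₂ : ℝ × ℝ → ℂ}

/-- The embedding of the form domain into `L²`. -/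
def embed (a : ℝ) : formDomain a →L[ℂ] L2 :=
  (PiLp.proj 2 (fun _ : Fin 3 => L2) 0 : GraphSpace →L[ℂ] L2) ∘L (formDomain a).subtypeL

theorem embed_apply (U : formDomain a) : embed a U = U.1 0 := rfl

theorem embed_vec (h : MagH1 a u v₁ v₂) : embed a h.vec = h.memLp.toLp u := rfl

theorem embed_ne_zero (a : ℝ) : embed a ≠ 0 := by
  intro hzero
  let B : ContDiffBump (0 : ℝ × ℝ) := ⟨1, 2, one_pos, one_lt_two⟩
  have hB : IsTestFunction (B.normed volume) := ⟨B.contDiff_normed, B.hasCompactSupport_normed⟩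
  have hmag := hB.ofReal.magH1 a
  have htoLp : hmag.memLp.toLp _ = 0 := by rw [← embed_vec hmag, hzero]; rfl
  have hae : B.normed volume =ᵐ[volume] 0 := by
    filter_upwards [(MemLp.toLp_eq_toLp_iff hmag.memLp MemLp.zero).1 htoLp] with x hx
    exact Complex.ofReal_eq_zero.1 hx
  exact one_ne_zero ((B.integral_normed (μ := volume)).symm.trans (integral_eq_zero_of_ae hae))

theorem norm_embed_pos (a : ℝ) : 0 < ‖embed a‖ :=
  (ContinuousLinearMap.opNorm_nonneg _).lt_of_ne fun h =>
    embed_ne_zero a ((ContinuousLinearMap.opNorm_zero_iff _).1 h.symm)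

/-- The resolvent at `-1` of the operator associated with the magnetic quadratic form. -/
def formResolvent (a : ℝ) : L2 →L[ℂ] L2 := embed a ∘L ContinuousLinearMap.adjoint (embed a)

theorem formResolvent_nonneg (a : ℝ) : 0 ≤ formResolvent a :=
  (ContinuousLinearMap.nonneg_iff_isPositive _).2
    (ContinuousLinearMap.isPositive_self_comp_adjoint _)

theorem norm_formResolvent (a : ℝ) : ‖formResolvent a‖ = ‖embed a‖ ^ 2 := by
  have h := ContinuousLinearMap.norm_adjoint_comp_self (ContinuousLinearMap.adjoint (embed a))
  rwa [ContinuousLinearMap.adjoint_adjoint, LinearIsometryEquiv.norm_map, ← sq] at h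

theorem MagH1.inner_vec_adjoint_embed (h : MagH1 a u v₁ v₂) (f : L2) :
    inner ℂ h.vec (ContinuousLinearMap.adjoint (embed a) f) = inner ℂ (h.memLp.toLp u) f := by
  rw [ContinuousLinearMap.adjoint_inner_right, embed_vec]

theorem conj_mag_mul_add {ϕ : ℝ × ℝ → ℂ} (hϕ : Differentiable ℝ ϕ) (a : ℝ) (w₁ w₂ : ℂ)
    (x : ℝ × ℝ) :
    starRingEnd ℂ (mag1 a ϕ x) * w₁ + starRingEnd ℂ (mag2 ϕ x) * w₂ =
      (d1 (fun y => (ϕ y).re) x • w₁ + (ϕ x).re • (Complex.I * (pot a x : ℂ) * w₁) +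
        d2 (fun y => (ϕ y).re) x • w₂) -
      Complex.I * (d1 (fun y => (ϕ y).im) x • w₁ + (ϕ x).im • (Complex.I * (pot a x : ℂ) * w₁) +
        d2 (fun y => (ϕ y).im) x • w₂) := by
  have hre (e : ℝ × ℝ) : fderiv ℝ (fun y => (ϕ y).re) x e = (fderiv ℝ ϕ x e).re :=
    fderiv_clm_comp_apply Complex.reCLM hϕ x e
  have him (e : ℝ × ℝ) : fderiv ℝ (fun y => (ϕ y).im) x e = (fderiv ℝ ϕ x e).im :=
    fderiv_clm_comp_apply Complex.imCLM hϕ x e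
  have hconj (z : ℂ) : starRingEnd ℂ z = z.re - Complex.I * z.im := by
    apply Complex.ext <;> simp
  simp only [d1, d2, hre, him, mag1, mag2, map_sub, map_mul, Complex.conj_I, Complex.conj_ofReal,
    hconj (fderiv ℝ ϕ x _), hconj (ϕ x), Complex.real_smul]
  ring

theorem IsTestFunction.inner_toLp_of_isWeakMagNegDiv {ϕ : ℝ × ℝ → ℂ} (hϕ : IsTestFunction ϕ)
    {g w₁ w₂ : L2} (h : IsWeakMagNegDiv a w₁ w₂ g) :
    inner ℂ ((hϕ.magH1 a).memLp.toLp ϕ) g =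
      inner ℂ ((hϕ.magH1 a).memLp₁.toLp _) w₁ + inner ℂ ((hϕ.magH1 a).memLp₂.toLp _) w₂ := by
  have hmag := hϕ.magH1 a
  have hre : IsTestFunction fun x => (ϕ x).re := hϕ.clm_comp Complex.reCLM
  have him : IsTestFunction fun x => (ϕ x).im := hϕ.clm_comp Complex.imCLM
  have hloc (f : L2) : LocallyIntegrable f volume := (Lp.memLp f).locallyIntegrable (by norm_num)
  have hint {φ : ℝ × ℝ → ℝ} (hφ : IsTestFunction φ) : Integrable fun x =>
      d1 φ x • w₁ x + φ x • (Complex.I * (pot a x : ℂ) * w₁ x) + d2 φ x • w₂ x :=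
    (((hφ.fderiv_apply (1, 0)).integrable_smul (hloc w₁)).add
      (hφ.integrable_smul (locallyIntegrable_pot_mul a (hloc w₁)))).add
      ((hφ.fderiv_apply (0, 1)).integrable_smul (hloc w₂))
  rw [inner_toLp, inner_toLp, inner_toLp, ← integral_add (integrable_conj_mul hmag.memLp₁ _)
    (integrable_conj_mul hmag.memLp₂ _)]
  simp only [conj_mag_mul_add hϕ.differentiable]
  calc ∫ x, starRingEnd ℂ (ϕ x) * g x
      = ∫ x, ((ϕ x).re • g x - Complex.I * ((ϕ x).im • g x)) := by
        congr 1; ext x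
        rw [show starRingEnd ℂ (ϕ x) = (ϕ x).re - Complex.I * (ϕ x).im by
          apply Complex.ext <;> simp]
        simp only [Complex.real_smul]
        ring
    _ = (∫ x, (ϕ x).re • g x) - Complex.I * ∫ x, (ϕ x).im • g x := by
        rw [integral_sub (hre.integrable_smul (hloc g))
          ((him.integrable_smul (hloc g)).const_mul _), integral_const_mul]
    _ = _ := by
        rw [h _ (isTest_iff.2 hre), h _ (isTest_iff.2 him), ← integral_const_mul,
          ← integral_sub (hint hre) ((hint him).const_mul _)]

theorem MagH1.eq_formResolvent {w g w₁ w₂ : L2} (h : MagH1 a w w₁ w₂)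
    (hg : IsWeakMagNegDiv a w₁ w₂ g) : w = formResolvent a (g + w) := by
  have hadjoint : ContinuousLinearMap.adjoint (embed a) (g + w) = h.vec := by
    refine (denseRange_testVec a).eq_of_inner_right ℂ fun ⟨ϕ, hϕ⟩ => ?_
    change inner ℂ (hϕ.magH1 a).vec _ = inner ℂ (hϕ.magH1 a).vec _
    rw [MagH1.inner_vec_adjoint_embed, inner_add_right, hϕ.inner_toLp_of_isWeakMagNegDiv hg,
      (hϕ.magH1 a).inner_vec]
    simp only [MagH1.vec, graphVec, Lp.toLp_coeFn, PiLp.toLp_apply, Matrix.cons_val]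
    ring
  rw [formResolvent, ContinuousLinearMap.comp_apply, hadjoint, embed_vec, Lp.toLp_coeFn]

theorem isWeakMagNegDiv_adjoint_embed {w g : L2} (h : w = formResolvent a (g + w)) :
    IsWeakMagNegDiv a ((ContinuousLinearMap.adjoint (embed a) (g + w)).1 1)
      ((ContinuousLinearMap.adjoint (embed a) (g + w)).1 2) g := by
  intro φ hφ
  have hφ := isTest_iff.1 hφ
  have hmag := hφ.ofReal.magH1 a
  set U := ContinuousLinearMap.adjoint (embed a) (g + w) with hU
  have hw : U.1 0 = w := h.symm
  have hinner : inner ℂ (hmag.memLp.toLp _) g = inner ℂ (hmag.memLp₁.toLp _) (U.1 1) +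
      inner ℂ (hmag.memLp₂.toLp _) (U.1 2) := by
    have := hmag.inner_vec_adjoint_embed (g + w)
    rw [← hU, hmag.inner_vec, inner_add_right, hw] at this
    linear_combination -this
  rw [inner_toLp, inner_toLp, inner_toLp, ← integral_add (integrable_conj_mul hmag.memLp₁ _)
    (integrable_conj_mul hmag.memLp₂ _)] at hinner
  simp only [mag1_ofReal hφ, mag2_ofReal hφ, map_sub, map_mul, Complex.conj_I,
    Complex.conj_ofReal] at hinner
  simp only [d1, d2, Complex.real_smul]
  rw [hinner]
  congr 1; ext x
  ring

theorem hamiltonianGraph_iff {w g : L2} :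
    HamiltonianGraph a w g ↔ w = formResolvent a (g + w) := by
  constructor
  · rintro ⟨v₁, v₂, h₁, h₂, hgrad, hdiv⟩
    have hmag := (isWeakMagGrad_univ_iff (Lp.memLp w) h₁ h₂).1 hgrad
    refine MagH1.eq_formResolvent
      (hmag.congr_ae .rfl h₁.coeFn_toLp.symm h₂.coeFn_toLp.symm) fun φ hφ => ?_
    rw [hdiv φ hφ]
    refine integral_congr_ae ?_
    filter_upwards [h₁.coeFn_toLp, h₂.coeFn_toLp] with x e₁ e₂
    rw [e₁, e₂]
  · intro h
    have hmag := mem_formDomain_iff.1 (ContinuousLinearMap.adjoint (embed a) (g + w)).2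
    rw [← embed_apply, ← ContinuousLinearMap.comp_apply, ← formResolvent, ← h] at hmag
    exact ⟨_, _, Lp.memLp _, Lp.memLp _,
      (isWeakMagGrad_univ_iff (Lp.memLp w) (Lp.memLp _) (Lp.memLp _)).2 hmag,
      isWeakMagNegDiv_adjoint_embed h⟩

theorem mem_hamiltonianSpectrum_iff {z : ℂ} :
    z ∈ hamiltonianSpectrum a ↔ ¬ IsUnit (1 - (z + 1) • formResolvent a) := by
  rw [← exists_forall_eq_iff_isUnit]
  simp only [hamiltonianSpectrum, mem_ofPred_eq, hamiltonianGraph_iff, add_smul, one_smul,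
    add_assoc]

theorem beta_eq (a : ℝ) : beta a = (‖embed a‖ ^ 2)⁻¹ - 1 := by
  have hnorm : 0 < ‖embed a‖ ^ 2 := pow_pos (norm_embed_pos a) 2
  have hreal (t : ℝ) : (t : ℂ) ∈ hamiltonianSpectrum a ↔
      ¬ IsUnit (1 - (t + 1) • formResolvent a) := by
    rw [mem_hamiltonianSpectrum_iff, ← Complex.ofReal_one, ← Complex.ofReal_add,
      Complex.coe_smul]
    rfl
  refine IsLeast.csInf_eq ⟨?_, fun t ht => ?_⟩
  · rw [mem_ofPred_eq, hreal, sub_add_cancel, ← norm_formResolvent]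
    refine not_isUnit_one_sub_inv_norm_smul (formResolvent_nonneg a) (norm_ne_zero_iff.1 ?_)
    rw [norm_formResolvent]
    exact hnorm.ne'
  · by_contra! hlt
    refine (hreal t).1 ht (isUnit_one_sub_smul_of_nonneg (formResolvent_nonneg a) ?_)
    rw [norm_formResolvent]
    rwa [← lt_div_iff₀ hnorm, one_div, ← lt_sub_iff_add_lt]

theorem MagH1.beta_mul_le (h : MagH1 a u v₁ v₂) :
    beta a * ∫ x, ‖u x‖ ^ 2 ≤ (∫ x, ‖v₁ x‖ ^ 2) + ∫ x, ‖v₂ x‖ ^ 2 := by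
  have hnorm := norm_embed_pos a
  have hembed : (∫ x, ‖u x‖ ^ 2) ≤ ‖embed a‖ ^ 2 * ‖h.vec‖ ^ 2 := by
    rw [← mul_pow, ← norm_toLp_sq h.memLp, ← embed_vec h]
    gcongr
    exact (embed a).le_opNorm h.vec
  rw [h.norm_vec_sq, ← inv_mul_le_iff₀ (by positivity)] at hembed
  rw [beta_eq, sub_mul, one_mul]
  linarith

theorem exists_magH1_lt {s : ℝ} (hs : beta a < s) :
    ∃ u v₁ v₂ : ℝ × ℝ → ℂ, MagH1 a u v₁ v₂ ∧
      (∫ x, ‖v₁ x‖ ^ 2) + ∫ x, ‖v₂ x‖ ^ 2 < s * ∫ x, ‖u x‖ ^ 2 := by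
  by_contra! hform
  have hnorm := norm_embed_pos a
  rw [beta_eq, sub_lt_iff_lt_add] at hs
  have hs' : 0 < s + 1 := (by positivity : 0 < (‖embed a‖ ^ 2)⁻¹).trans hs
  refine hs.not_ge ((le_inv_comm₀ (by positivity) hs').1 ?_)
  have hle : ‖embed a‖ ≤ √(s + 1)⁻¹ := by
    refine ContinuousLinearMap.opNorm_le_bound _ (Real.sqrt_nonneg _) fun U => ?_
    have hU := hform _ _ _ (mem_formDomain_iff.1 U.2)
    rw [← norm_sq_eq_integral, ← norm_sq_eq_integral, ← norm_sq_eq_integral] at hU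
    rw [← Real.sqrt_sq (norm_nonneg U), ← Real.sqrt_mul (by positivity)]
    refine Real.le_sqrt_of_sq_le ?_
    rw [embed_apply, ← div_eq_inv_mul, le_div_iff₀ hs', Submodule.coe_norm, GraphSpace.norm_sq]
    linarith
  exact (Real.le_sqrt' hnorm).1 hle

theorem exists_isTestFunction_lt {s : ℝ} (hs : beta a < s) :
    ∃ ϕ : ℝ × ℝ → ℂ, IsTestFunction ϕ ∧
      (∫ x, ‖mag1 a ϕ x‖ ^ 2) + ∫ x, ‖mag2 ϕ x‖ ^ 2 < s * ∫ x, ‖ϕ x‖ ^ 2 := by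
  obtain ⟨u, v₁, v₂, h, hlt⟩ := exists_magH1_lt hs
  obtain ⟨ϕ, hϕ, hu, h₁, h₂⟩ := h.exists_seq_isTestFunction
  have hform := (tendsto_integral_norm_sq (fun n => ((hϕ n).magH1 a).memLp₁) h.memLp₁ h₁).add
    (tendsto_integral_norm_sq (fun n => ((hϕ n).magH1 a).memLp₂) h.memLp₂ h₂)
  have hmass := (tendsto_integral_norm_sq (fun n => ((hϕ n).magH1 a).memLp) h.memLp hu).const_mul s
  obtain ⟨n, hn⟩ := (hform.eventually_lt hmass hlt).exists
  exact ⟨ϕ n, hϕ n, hn⟩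

theorem beta_pos (ha0 : a ≠ 0) (ha : |a| ≤ 1) : 0 < beta a := by
  obtain ⟨c, hc, hcoercive⟩ := exists_coercive ha0 ha
  by_contra! hbeta
  obtain ⟨u, v₁, v₂, h, hlt⟩ := exists_magH1_lt (hbeta.trans_lt hc)
  exact (hcoercive _ _ _ h).not_gt hlt

end Hamiltonian

/-! ### Gluing and sliding windows in the direction `x₁` -/

section Gluing

variable {a b M R : ℝ} {u v₁ v₂ u' v₁' v₂' : ℝ × ℝ → ℂ}

theorem planeEnergy_comp_add (b : ℝ) (u v₁ v₂ : ℝ × ℝ → ℂ) (s : ℝ × ℝ) :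
    planeEnergy b (fun x => u (x + s)) (fun x => v₁ (x + s)) (fun x => v₂ (x + s)) =
      planeEnergy b u v₁ v₂ := by
  unfold planeEnergy
  rw [integral_add_right_eq_self (fun x => ‖u x‖ ^ 2), integral_add_right_eq_self
    (fun x => ‖v₁ x‖ ^ 2), integral_add_right_eq_self (fun x => ‖v₂ x‖ ^ 2),
    integral_add_right_eq_self (fun x => ‖u x‖ ^ 4)]

theorem norm_add_pow_of_eq_zero_or {E : Type*} [SeminormedAddCommGroup E] {z w : E}
    (h : z = 0 ∨ w = 0) {n : ℕ} (hn : n ≠ 0) : ‖z + w‖ ^ n = ‖z‖ ^ n + ‖w‖ ^ n := by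
  rcases h with rfl | rfl <;> simp [hn]

theorem planeEnergy_add (h : MagH1 a u v₁ v₂) (h' : MagH1 a u' v₁' v₂')
    (hq : Integrable fun x => ‖u x‖ ^ 4) (hq' : Integrable fun x => ‖u' x‖ ^ 4)
    (hdisj : ∀ x, (u x = 0 ∧ v₁ x = 0 ∧ v₂ x = 0) ∨ (u' x = 0 ∧ v₁' x = 0 ∧ v₂' x = 0)) :
    planeEnergy b (u + u') (v₁ + v₁') (v₂ + v₂') =
      planeEnergy b u v₁ v₂ + planeEnergy b u' v₁' v₂' := by
  have hu (x) : u x = 0 ∨ u' x = 0 := (hdisj x).imp And.left And.left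
  have hv₁ (x) : v₁ x = 0 ∨ v₁' x = 0 := (hdisj x).imp (·.2.1) (·.2.1)
  have hv₂ (x) : v₂ x = 0 ∨ v₂' x = 0 := (hdisj x).imp (·.2.2) (·.2.2)
  simp only [planeEnergy, Pi.add_apply, norm_add_pow_of_eq_zero_or (hu _) two_ne_zero,
    norm_add_pow_of_eq_zero_or (hu _) four_ne_zero, norm_add_pow_of_eq_zero_or (hv₁ _) two_ne_zero,
    norm_add_pow_of_eq_zero_or (hv₂ _) two_ne_zero]
  rw [integral_add (integrable_norm_sq h.memLp) (integrable_norm_sq h'.memLp),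
    integral_add (integrable_norm_sq h.memLp₁) (integrable_norm_sq h'.memLp₁),
    integral_add (integrable_norm_sq h.memLp₂) (integrable_norm_sq h'.memLp₂), integral_add hq hq']
  ring

theorem mem_strip {x : ℝ × ℝ} : x ∈ strip R ↔ -R / 2 < x.1 ∧ x.1 < R / 2 := by
  simp [strip]

theorem IsAdmissible.exists_add (h : IsAdmissible a R u v₁ v₂) (h' : IsAdmissible a M u' v₁' v₂')
    (hR : 0 < R) (hM : 0 < M) :
    ∃ w w₁ w₂, IsAdmissible a (R + M) w w₁ w₂ ∧
      planeEnergy b w w₁ w₂ = planeEnergy b u v₁ v₂ + planeEnergy b u' v₁' v₂' := by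
  have hmag := h.magH1.comp_add_fst (M / 2)
  have hmag' := h'.magH1.comp_add_fst (-R / 2)
  have hq := h.quartic.comp_add_right (M / 2, 0)
  have hq' := h'.quartic.comp_add_right (-R / 2, 0)
  have hzero (x : ℝ × ℝ) (hx : x ∉ strip (R + M) ∨ R / 2 - M / 2 ≤ x.1) :
      u (x + (M / 2, 0)) = 0 ∧ v₁ (x + (M / 2, 0)) = 0 ∧ v₂ (x + (M / 2, 0)) = 0 := by
    refine h.eq_zero _ fun hx' => ?_
    obtain ⟨hlower, hupper⟩ := mem_strip.1 hx'
    simp only [Prod.fst_add] at hlower hupper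
    exact hx.elim (· (mem_strip.2 ⟨by linarith, by linarith⟩)) fun hx => by linarith
  have hzero' (x : ℝ × ℝ) (hx : x ∉ strip (R + M) ∨ x.1 < R / 2 - M / 2) :
      u' (x + (-R / 2, 0)) = 0 ∧ v₁' (x + (-R / 2, 0)) = 0 ∧ v₂' (x + (-R / 2, 0)) = 0 := by
    refine h'.eq_zero _ fun hx' => ?_
    obtain ⟨hlower, hupper⟩ := mem_strip.1 hx'
    simp only [Prod.fst_add] at hlower hupper
    exact hx.elim (· (mem_strip.2 ⟨by linarith, by linarith⟩)) fun hx => by linarith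
  have hdisj (x : ℝ × ℝ) := (le_or_gt (R / 2 - M / 2) x.1).imp (fun hx => hzero x (.inr hx))
    fun hx => hzero' x (.inr hx)
  have hu := fun x => norm_add_pow_of_eq_zero_or ((hdisj x).imp And.left And.left) four_ne_zero
  refine ⟨_, _, _, ⟨hmag.add hmag', fun x hx => ?_, (hq.add hq').congr (.of_forall fun x =>
    (hu x).symm)⟩, ?_⟩
  · simp [hzero x (.inl hx), hzero' x (.inl hx)]
  · rw [planeEnergy_add hmag hmag' hq hq' hdisj, planeEnergy_comp_add, planeEnergy_comp_add]

end Gluing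

section Window

variable {u v : ℝ × ℝ → ℂ} {k χ : ℝ → ℝ}

theorem integrable_window {α : Type*} [MeasurableSpace α] {μ : Measure α} [SFinite μ] {ξ : α → ℝ}
    (hξ : Measurable ξ) (hk : Continuous k) (hki : Integrable k) {f : α → ℝ}
    (hf : Integrable f μ) :
    Integrable (fun p : ℝ × α => k (ξ p.2 - p.1) * f p.2) (volume.prod μ) := by
  have hmeas : AEStronglyMeasurable (fun p : ℝ × α => k (ξ p.2 - p.1) * f p.2)
      (volume.prod μ) :=
    (hk.measurable.comp ((hξ.comp measurable_snd).sub measurable_fst)).aestronglyMeasurable.mul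
      (hf.1.comp_quasiMeasurePreserving Measure.quasiMeasurePreserving_snd)
  rw [integrable_prod_iff' hmeas]
  refine ⟨.of_forall fun x => (hki.comp_sub_left (ξ x)).mul_const (f x), ?_⟩
  have hfiber (x : α) : ∫ t, ‖k (ξ x - t) * f x‖ = (∫ s, ‖k s‖) * ‖f x‖ := by
    simp only [norm_mul]
    rw [integral_mul_const, integral_sub_left_eq_self (fun s => ‖k s‖)]
  simp only [hfiber]
  exact hf.norm.const_mul _

theorem integral_window {α : Type*} [MeasurableSpace α] {μ : Measure α} [SFinite μ] {ξ : α → ℝ}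
    (hξ : Measurable ξ) (hk : Continuous k) (hki : Integrable k) {f : α → ℝ}
    (hf : Integrable f μ) :
    ∫ p : ℝ × α, k (ξ p.2 - p.1) * f p.2 ∂volume.prod μ = (∫ s, k s) * ∫ x, f x ∂μ := by
  rw [integral_prod_symm _ (integrable_window hξ hk hki hf), ← integral_const_mul]
  congr 1; ext x
  simp only [integral_mul_const, integral_sub_left_eq_self k]

/-- The function `u` seen through the window `χ` centred at the line `x₁ = t`. -/
def window (χ : ℝ → ℝ) (t : ℝ) (u : ℝ × ℝ → ℂ) (x : ℝ × ℝ) : ℂ := χ (x.1 - t) • u x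

theorem norm_window_pow (χ : ℝ → ℝ) (t : ℝ) (u : ℝ × ℝ → ℂ) (x : ℝ × ℝ) {n : ℕ} (hn : Even n) :
    ‖window χ t u x‖ ^ n = χ (x.1 - t) ^ n * ‖u x‖ ^ n := by
  rw [window, norm_smul, mul_pow, Real.norm_eq_abs, hn.pow_abs]

theorem integrable_norm_window_pow (hk : Continuous k) (hks : HasCompactSupport k) {n : ℕ}
    (hn : Even n) (hn0 : n ≠ 0) (hu : Integrable fun x => ‖u x‖ ^ n) :
    Integrable fun p : ℝ × (ℝ × ℝ) => ‖window k p.1 u p.2‖ ^ n := by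
  simp only [norm_window_pow _ _ _ _ hn]
  exact integrable_window measurable_fst (hk.pow n)
    ((hk.pow n).integrable_of_hasCompactSupport (hks.comp_left (zero_pow hn0))) hu

theorem integral_norm_window_pow (hk : Continuous k) (hks : HasCompactSupport k) {n : ℕ}
    (hn : Even n) (hn0 : n ≠ 0) (hu : Integrable fun x => ‖u x‖ ^ n) :
    ∫ p : ℝ × (ℝ × ℝ), ‖window k p.1 u p.2‖ ^ n = (∫ s, k s ^ n) * ∫ x, ‖u x‖ ^ n := by
  simp only [norm_window_pow _ _ _ _ hn]
  exact integral_window measurable_fst (hk.pow n)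
    ((hk.pow n).integrable_of_hasCompactSupport (hks.comp_left (zero_pow hn0))) hu

theorem integral_mul_deriv_eq_zero (hχ : IsTestFunction χ) : ∫ s, χ s * deriv χ s = 0 := by
  have hderiv (s : ℝ) : HasDerivAt χ (deriv χ s) s := (hχ.differentiable s).hasDerivAt
  have hint : Integrable fun s => χ s * deriv χ s :=
    (hχ.continuous.mul (hχ.contDiff.continuous_deriv (by simp))).integrable_of_hasCompactSupport
      hχ.hasCompactSupport.mul_right
  have hparts := integral_mul_deriv_eq_deriv_mul_of_integrable (fun s _ => hderiv s)
    (fun s _ => hderiv s) hint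
    (by simpa only [Pi.mul_def, mul_comm] using hint)
    ((hχ.continuous.mul hχ.continuous).integrable_of_hasCompactSupport
      hχ.hasCompactSupport.mul_right)
  simp only [mul_comm (deriv χ _)] at hparts
  linarith

/-- The cross terms average to zero because `χ χ'` is the derivative of `χ² / 2`. -/
theorem integral_norm_sq_window_add (hχ : IsTestFunction χ) (hu : MemLp u 2 volume)
    (hv : MemLp v 2 volume) :
    (Integrable fun p : ℝ × (ℝ × ℝ) => ‖window χ p.1 v p.2 + window (deriv χ) p.1 u p.2‖ ^ 2) ∧
      ∫ p : ℝ × (ℝ × ℝ), ‖window χ p.1 v p.2 + window (deriv χ) p.1 u p.2‖ ^ 2 =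
        (∫ s, χ s ^ 2) * (∫ x, ‖v x‖ ^ 2) + (∫ s, deriv χ s ^ 2) * ∫ x, ‖u x‖ ^ 2 := by
  have hcont := hχ.contDiff.continuous_deriv (by simp)
  have hsupp := hχ.hasCompactSupport.deriv
  have hinner : Integrable fun x => inner ℝ (v x) (u x) := by
    simp only [real_inner_eq_norm_add_mul_self_sub_norm_mul_self_sub_norm_mul_self_div_two, ← sq]
    exact (((integrable_norm_sq (hv.add hu)).sub (integrable_norm_sq hv)).sub
      (integrable_norm_sq hu)).div_const 2
  have hcont₂ := hχ.continuous.mul hcont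
  have hint₂ := hcont₂.integrable_of_hasCompactSupport (μ := volume) hχ.hasCompactSupport.mul_right
  have hexpand (p : ℝ × (ℝ × ℝ)) : ‖window χ p.1 v p.2 + window (deriv χ) p.1 u p.2‖ ^ 2 =
      ‖window χ p.1 v p.2‖ ^ 2 +
        2 * (χ (p.2.1 - p.1) * deriv χ (p.2.1 - p.1) * inner ℝ (v p.2) (u p.2)) +
        ‖window (deriv χ) p.1 u p.2‖ ^ 2 := by
    rw [norm_add_sq_real, window, window, real_inner_smul_left, real_inner_smul_right]
    ring
  have hv' := integrable_norm_window_pow hχ.continuous hχ.hasCompactSupport even_two two_ne_zero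
    (integrable_norm_sq hv)
  have hu' := integrable_norm_window_pow hcont hsupp even_two two_ne_zero (integrable_norm_sq hu)
  have hcross : Integrable fun p : ℝ × (ℝ × ℝ) =>
      2 * (χ (p.2.1 - p.1) * deriv χ (p.2.1 - p.1) * inner ℝ (v p.2) (u p.2)) :=
    (integrable_window measurable_fst hcont₂ hint₂ hinner).const_mul 2
  simp only [hexpand]
  refine ⟨(hv'.fun_add hcross).fun_add hu', ?_⟩
  rw [integral_add (hv'.fun_add hcross) hu', integral_add hv' hcross, integral_const_mul,
    integral_norm_window_pow hχ.continuous hχ.hasCompactSupport even_two two_ne_zero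
      (integrable_norm_sq hv),
    integral_norm_window_pow hcont hsupp even_two two_ne_zero (integrable_norm_sq hu)]
  have hzero := integral_window measurable_fst hcont₂ hint₂ hinner
  simp only [Pi.mul_apply, integral_mul_deriv_eq_zero hχ, zero_mul] at hzero
  rw [Measure.volume_eq_prod ℝ (ℝ × ℝ), hzero]
  ring

end Window

section Average

variable {a b M R : ℝ} {u v₁ v₂ : ℝ × ℝ → ℂ} {χ : ℝ → ℝ}

theorem integrable_norm_smul_pow {α E : Type*} [MeasurableSpace α] {μ : Measure α}
    [NormedAddCommGroup E] [NormedSpace ℝ E] {f : α → E} {k : α → ℝ} {C : ℝ} {n : ℕ}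
    (hf : Integrable (fun x => ‖f x‖ ^ n) μ) (hk : AEStronglyMeasurable k μ)
    (hC : ∀ x, |k x| ≤ C) : Integrable (fun x => ‖k x • f x‖ ^ n) μ := by
  simp only [norm_smul, mul_pow]
  refine hf.bdd_mul (c := C ^ n) (hk.norm.pow n) (.of_forall fun x => ?_)
  simpa using pow_le_pow_left₀ (abs_nonneg _) (hC x) n

theorem IsTestFunction.exists_abs_le (hχ : IsTestFunction χ) : ∃ C, ∀ s, |χ s| ≤ C :=
  hχ.continuous.bounded_above_of_compact_support hχ.hasCompactSupport

theorem IsTestFunction.deriv (hχ : IsTestFunction χ) : IsTestFunction (deriv χ) := by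
  simpa only [fderiv_apply_one_eq_deriv] using hχ.fderiv_apply 1

theorem IsTestFunction.continuous_shift (hχ : IsTestFunction χ) (t : ℝ) :
    Continuous fun x : ℝ × ℝ => χ (x.1 - t) :=
  hχ.continuous.comp (continuous_fst.sub continuous_const)

namespace MagH1

theorem magH1_window (h : MagH1 a u v₁ v₂) (hχ : IsTestFunction χ) (t : ℝ) :
    MagH1 a (window χ t u) (fun x => window χ t v₁ x + window (deriv χ) t u x)
      (window χ t v₂) := by
  obtain ⟨C, hC⟩ := hχ.exists_abs_le
  obtain ⟨C', hC'⟩ := hχ.deriv.exists_abs_le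
  have hmag := h.smul_fst (hχ.comp_sub_right t).contDiff
    (C := max C C') (fun s => (hC _).trans (le_max_left _ _)) fun s => by
      rw [deriv_comp_sub_const]; exact (hC' _).trans (le_max_right _ _)
  simp only [deriv_comp_sub_const] at hmag
  exact hmag

end MagH1

/-- The energy of the configuration seen through the window `χ` centred at `x₁ = t`. -/
def windowEnergy (b : ℝ) (χ : ℝ → ℝ) (t : ℝ) (u v₁ v₂ : ℝ × ℝ → ℂ) : ℝ :=
  planeEnergy b (window χ t u) (fun x => window χ t v₁ x + window (deriv χ) t u x) (window χ t v₂)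

theorem MagH1.integral_windowEnergy (h : MagH1 a u v₁ v₂) (hq : Integrable fun x => ‖u x‖ ^ 4)
    (hχ : IsTestFunction χ) (b : ℝ) :
    (Integrable fun t => windowEnergy b χ t u v₁ v₂) ∧ ∫ t, windowEnergy b χ t u v₁ v₂ =
    (∫ s, χ s ^ 2) * (b * ((∫ x, ‖v₁ x‖ ^ 2) + ∫ x, ‖v₂ x‖ ^ 2) - ∫ x, ‖u x‖ ^ 2) +
      (∫ s, deriv χ s ^ 2) * (b * ∫ x, ‖u x‖ ^ 2) +
      (∫ s, χ s ^ 4) * ((1 / 2) * ∫ x, ‖u x‖ ^ 4) := by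
  obtain ⟨hi₁, he₁⟩ := integral_norm_sq_window_add hχ h.memLp h.memLp₁
  have hsq {f : ℝ × ℝ → ℂ} (hf : MemLp f 2 volume) := integrable_norm_window_pow hχ.continuous
    hχ.hasCompactSupport even_two two_ne_zero (integrable_norm_sq hf)
  have hsq' {f : ℝ × ℝ → ℂ} (hf : MemLp f 2 volume) := integral_norm_window_pow hχ.continuous
    hχ.hasCompactSupport even_two two_ne_zero (integrable_norm_sq hf)
  have hpow₄ := integrable_norm_window_pow hχ.continuous hχ.hasCompactSupport
    (by decide : Even 4) four_ne_zero hq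
  have hgrad := hi₁.fun_add (hsq h.memLp₂)
  have hquad : Integrable fun p : ℝ × (ℝ × ℝ) => b * (‖window χ p.1 v₁ p.2 +
      window (deriv χ) p.1 u p.2‖ ^ 2 + ‖window χ p.1 v₂ p.2‖ ^ 2) - ‖window χ p.1 u p.2‖ ^ 2 :=
    (hgrad.const_mul b).sub (hsq h.memLp)
  have hslice (t : ℝ) := (h.magH1_window hχ t).integral_energy (b := b) (by
    obtain ⟨C, hC⟩ := hχ.exists_abs_le
    exact integrable_norm_smul_pow hq (hχ.continuous_shift t).aestronglyMeasurable fun x => hC _)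
  simp only [windowEnergy, ← hslice]
  refine ⟨(hquad.fun_add (hpow₄.const_mul (1 / 2))).integral_prod_left,
    (integral_prod _ (hquad.fun_add (hpow₄.const_mul (1 / 2)))).symm.trans ?_⟩
  rw [← Measure.volume_eq_prod, integral_add hquad (hpow₄.const_mul _),
    integral_sub (hgrad.const_mul b) (hsq h.memLp), integral_const_mul, integral_const_mul,
    integral_add hi₁ (hsq h.memLp₂), he₁, hsq' h.memLp₂, hsq' h.memLp,
    integral_norm_window_pow hχ.continuous hχ.hasCompactSupport (by decide) four_ne_zero hq]
  ring

theorem groundEnergy_le (hbd : BddBelow (energyValues a b R)) (h : IsAdmissible a R u v₁ v₂) :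
    groundEnergy a b R ≤ planeEnergy b u v₁ v₂ :=
  csInf_le hbd h.planeEnergy_mem

theorem groundEnergy_nonpos (hbd : BddBelow (energyValues a b R)) : groundEnergy a b R ≤ 0 :=
  csInf_le hbd (zero_mem_energyValues a b R)

theorem deriv_eq_zero_of_nonneg (h0 : ∀ s, 0 ≤ χ s) {s : ℝ} (hs : χ s = 0) : deriv χ s = 0 :=
  IsLocalMin.deriv_eq_zero (.of_forall fun r => hs.trans_le (h0 r))

theorem window_eq_zero (h0 : ∀ s, 0 ≤ χ s) {t : ℝ} {x : ℝ × ℝ} (hx : χ (x.1 - t) = 0) :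
    window χ t u x = 0 ∧ window χ t v₁ x + window (deriv χ) t u x = 0 ∧ window χ t v₂ x = 0 := by
  simp [window, hx, deriv_eq_zero_of_nonneg h0 hx]

theorem MagH1.groundEnergy_le_window (h : MagH1 a u v₁ v₂) (hq : Integrable fun x => ‖u x‖ ^ 4)
    (hbd : BddBelow (energyValues a b R)) (hχ : IsTestFunction χ) (h0 : ∀ s, 0 ≤ χ s)
    (hz : ∀ s, R / 2 ≤ |s| → χ s = 0) (t : ℝ) :
    groundEnergy a b R ≤ windowEnergy b χ t u v₁ v₂ := by
  obtain ⟨C, hC⟩ := hχ.exists_abs_le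
  have hq' := integrable_norm_smul_pow hq (hχ.continuous_shift t).aestronglyMeasurable
    fun x => hC _
  rw [windowEnergy, ← planeEnergy_comp_add b _ _ _ (t, 0)]
  refine groundEnergy_le hbd ⟨(h.magH1_window hχ t).comp_add_fst t, fun x hx => ?_,
    hq'.comp_add_right (t, 0)⟩
  refine window_eq_zero h0 (hz _ ?_)
  rw [Prod.fst_add, add_sub_cancel_right]
  by_contra! hlt
  exact hx (mem_strip.2 (by simpa only [neg_div] using abs_lt.1 hlt))

theorem IsAdmissible.windowEnergy_eq_zero (h : IsAdmissible a M u v₁ v₂)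
    (h0 : ∀ s, 0 ≤ χ s) (hz : ∀ s, R / 2 ≤ |s| → χ s = 0) {t : ℝ} (ht : (M + R) / 2 < |t|) :
    windowEnergy b χ t u v₁ v₂ = 0 := by
  have hzero (x : ℝ × ℝ) : window χ t u x = 0 ∧ window χ t v₁ x + window (deriv χ) t u x = 0 ∧
      window χ t v₂ x = 0 := by
    by_cases hx : x ∈ strip M
    · rw [mem_strip, neg_div, ← abs_lt] at hx
      refine window_eq_zero h0 (hz _ ?_)
      rw [abs_sub_comm]
      linarith [abs_sub_abs_le_abs_sub t x.1]
    · simp [window, h.eq_zero x hx]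
  simp [windowEnergy, planeEnergy, hzero]

/-- Averaging over all positions of the window: a window meets the strip of width `M` for `t` in
an interval of length `M + R`, and each time yields a configuration on the strip of width `R`. -/
theorem IsAdmissible.add_mul_groundEnergy_le (h : IsAdmissible a M u v₁ v₂)
    (hMR : 0 ≤ M + R) (hbd : BddBelow (energyValues a b R)) (hχ : IsTestFunction χ)
    (h0 : ∀ s, 0 ≤ χ s) (h1 : ∀ s, χ s ≤ 1) (hz : ∀ s, R / 2 ≤ |s| → χ s = 0) :
    (M + R) * groundEnergy a b R ≤
      (∫ s, χ s ^ 2) * planeEnergy b u v₁ v₂ + (∫ s, deriv χ s ^ 2) * (b * ∫ x, ‖u x‖ ^ 2) := by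
  obtain ⟨hint, htotal⟩ := h.magH1.integral_windowEnergy h.quartic hχ b
  have hlow : (M + R) * groundEnergy a b R ≤ ∫ t, windowEnergy b χ t u v₁ v₂ := by
    rw [← setIntegral_eq_integral_of_forall_compl_eq_zero
      (s := Icc (-((M + R) / 2)) ((M + R) / 2)) fun t ht =>
        h.windowEnergy_eq_zero h0 hz (not_le.1 (mt abs_le.1 ht))]
    calc (M + R) * groundEnergy a b R
        = ∫ _ in Icc (-((M + R) / 2)) ((M + R) / 2), groundEnergy a b R := by
          rw [setIntegral_const, Real.volume_real_Icc_of_le (by linarith), smul_eq_mul]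
          ring
      _ ≤ _ := setIntegral_mono_on continuous_const.integrableOn_Icc hint.integrableOn
          measurableSet_Icc fun t _ =>
            h.magH1.groundEnergy_le_window h.quartic hbd hχ h0 hz t
  have hpow : ∫ s, χ s ^ 4 ≤ ∫ s, χ s ^ 2 := by
    have hpow_int {n : ℕ} (hn : n ≠ 0) : Integrable fun s => χ s ^ n :=
      (hχ.continuous.pow n).integrable_of_hasCompactSupport
        (hχ.hasCompactSupport.comp_left (zero_pow hn))
    exact integral_mono (hpow_int four_ne_zero) (hpow_int two_ne_zero) fun s =>
      pow_le_pow_of_le_one (h0 s) (h1 s) (by norm_num)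
  have hquartic := mul_le_mul_of_nonneg_right hpow
    (by positivity : 0 ≤ (1 / 2) * ∫ x, ‖u x‖ ^ 4)
  rw [htotal] at hlow
  unfold planeEnergy
  linarith

end Average

section Cell

variable {R : ℝ}

/-- A smooth cutoff equal to `1` on `[1 - R/2, R/2 - 1]` and to `0` off `(-R/2, R/2)`. -/
def cell (R s : ℝ) : ℝ :=
  Real.smoothTransition (s + R / 2) * Real.smoothTransition (R / 2 - s)

theorem cell_nonneg (R s : ℝ) : 0 ≤ cell R s :=
  mul_nonneg (Real.smoothTransition.nonneg _) (Real.smoothTransition.nonneg _)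

theorem cell_le_one (R s : ℝ) : cell R s ≤ 1 :=
  mul_le_one₀ (Real.smoothTransition.le_one _) (Real.smoothTransition.nonneg _)
    (Real.smoothTransition.le_one _)

theorem cell_eq_zero {s : ℝ} (h : R / 2 ≤ |s|) : cell R s = 0 := by
  rcases le_abs'.1 h with h | h
  · rw [cell, Real.smoothTransition.zero_of_nonpos (by linarith), zero_mul]
  · rw [cell, Real.smoothTransition.zero_of_nonpos (x := R / 2 - s) (by linarith), mul_zero]

theorem cell_eq_one {s : ℝ} (h : |s| ≤ R / 2 - 1) : cell R s = 1 := by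
  obtain ⟨hlower, hupper⟩ := abs_le.1 h
  rw [cell, Real.smoothTransition.one_of_one_le (by linarith),
    Real.smoothTransition.one_of_one_le (by linarith), one_mul]

theorem isTestFunction_cell (R : ℝ) : IsTestFunction (cell R) where
  contDiff := (Real.smoothTransition.contDiff.comp (contDiff_id.add contDiff_const)).mul
    (Real.smoothTransition.contDiff.comp (contDiff_const.sub contDiff_id))
  hasCompactSupport := HasCompactSupport.intro (isCompact_Icc (a := -(R / 2)) (b := R / 2))
    fun _ hs => cell_eq_zero (not_le.1 (mt abs_le.1 hs)).le

theorem integrable_cell_sq (R : ℝ) : Integrable fun s => cell R s ^ 2 :=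
  ((isTestFunction_cell R).continuous.pow 2).integrable_of_hasCompactSupport
    ((isTestFunction_cell R).hasCompactSupport.comp_left (zero_pow two_ne_zero))

theorem integral_cell_sq_le (hR : 0 ≤ R) : ∫ s, cell R s ^ 2 ≤ R := by
  rw [← setIntegral_eq_integral_of_forall_compl_eq_zero (s := Icc (-(R / 2)) (R / 2)) fun s hs => by
    rw [cell_eq_zero (not_le.1 (mt abs_le.1 hs)).le, zero_pow two_ne_zero]]
  calc ∫ s in Icc (-(R / 2)) (R / 2), cell R s ^ 2 ≤ ∫ _ in Icc (-(R / 2)) (R / 2), (1 : ℝ) :=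
        setIntegral_mono (integrable_cell_sq R).integrableOn continuous_const.integrableOn_Icc
          fun s => pow_le_one₀ (cell_nonneg R s) (cell_le_one R s)
    _ = R := by
        rw [setIntegral_const, Real.volume_real_Icc_of_le (by linarith), smul_eq_mul]
        ring

theorem le_integral_cell_sq (hR : 2 ≤ R) : R - 2 ≤ ∫ s, cell R s ^ 2 := by
  calc R - 2 = ∫ _ in Icc (-(R / 2 - 1)) (R / 2 - 1), (1 : ℝ) := by
        rw [setIntegral_const, Real.volume_real_Icc_of_le (by linarith), smul_eq_mul]
        ring
    _ = ∫ s in Icc (-(R / 2 - 1)) (R / 2 - 1), cell R s ^ 2 :=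
        setIntegral_congr_fun measurableSet_Icc fun s hs => by
          simp [cell_eq_one (abs_le.2 hs)]
    _ ≤ ∫ s, cell R s ^ 2 := setIntegral_le_integral (integrable_cell_sq R)
        (.of_forall fun s => sq_nonneg _)

/-- The Dirichlet energy of the smooth transition from `0` to `1`. -/
def transitionEnergy : ℝ := ∫ t, deriv Real.smoothTransition t ^ 2

theorem transitionEnergy_nonneg : 0 ≤ transitionEnergy :=
  integral_nonneg fun _ => sq_nonneg _

theorem integrable_deriv_smoothTransition_sq :
    Integrable fun t => deriv Real.smoothTransition t ^ 2 :=
  (continuous_deriv_smoothTransition.pow 2).integrable_of_hasCompactSupport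
    (hasCompactSupport_deriv_smoothTransition.comp_left (zero_pow two_ne_zero))

theorem deriv_cell (R s : ℝ) :
    deriv (cell R) s = deriv Real.smoothTransition (s + R / 2) * Real.smoothTransition (R / 2 - s)
      - Real.smoothTransition (s + R / 2) * deriv Real.smoothTransition (R / 2 - s) := by
  have hφ (t : ℝ) := (differentiable_smoothTransition t).hasDerivAt
  exact (((hφ _).comp_add_const s (R / 2)).fun_mul
    ((hφ _).comp_const_sub (R / 2) s)).deriv.trans (by ring)

theorem deriv_cell_sq_le (R s : ℝ) :
    deriv (cell R) s ^ 2 ≤ 2 * deriv Real.smoothTransition (s + R / 2) ^ 2 +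
      2 * deriv Real.smoothTransition (R / 2 - s) ^ 2 := by
  have hfactor (x t : ℝ) : (x * Real.smoothTransition t) ^ 2 ≤ x ^ 2 := by
    rw [mul_pow]
    exact mul_le_of_le_one_right (sq_nonneg x) (pow_le_one₀ (Real.smoothTransition.nonneg t)
      (Real.smoothTransition.le_one t))
  have hleft := hfactor (deriv Real.smoothTransition (s + R / 2)) (R / 2 - s)
  have hright := hfactor (deriv Real.smoothTransition (R / 2 - s)) (s + R / 2)
  rw [deriv_cell, mul_comm (Real.smoothTransition (s + R / 2))]
  linarith [sq_nonneg (deriv Real.smoothTransition (s + R / 2) * Real.smoothTransition (R / 2 - s) +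
    deriv Real.smoothTransition (R / 2 - s) * Real.smoothTransition (s + R / 2))]

theorem integral_deriv_cell_sq_le (R : ℝ) : ∫ s, deriv (cell R) s ^ 2 ≤ 4 * transitionEnergy := by
  have hcell := (isTestFunction_cell R).deriv
  have hright := (integrable_deriv_smoothTransition_sq.comp_add_right (R / 2)).const_mul 2
  have hleft := (integrable_deriv_smoothTransition_sq.comp_sub_left (R / 2)).const_mul 2
  refine (integral_mono ((hcell.continuous.pow 2).integrable_of_hasCompactSupport
    (hcell.hasCompactSupport.comp_left (zero_pow two_ne_zero))) (hright.fun_add hleft)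
    (deriv_cell_sq_le R)).trans_eq ?_
  rw [integral_add hright hleft, integral_const_mul, integral_const_mul,
    integral_add_right_eq_self fun t => deriv Real.smoothTransition t ^ 2,
    integral_sub_left_eq_self fun t => deriv Real.smoothTransition t ^ 2, transitionEnergy]
  ring

end Cell

section LongStrip

variable {a b C L M R : ℝ} {u v₁ v₂ : ℝ × ℝ → ℂ} {θ : ℝ → ℝ}

theorem le_groundEnergy {c : ℝ}
    (h : ∀ u v₁ v₂, IsAdmissible a R u v₁ v₂ → c ≤ planeEnergy b u v₁ v₂) :
    c ≤ groundEnergy a b R := by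
  refine le_csInf ⟨0, zero_mem_energyValues a b R⟩ fun E hE => ?_
  obtain ⟨u, v₁, v₂, hu, rfl⟩ := mem_energyValues_iff.1 hE
  exact h u v₁ v₂ hu

theorem bddBelow_energyValues (ha : |a| ≤ 1) (hb : 0 ≤ b) (hab : 1 ≤ b * |a|) (hR : 0 < R) :
    BddBelow (energyValues a b R) :=
  ⟨_, neg_mem_lowerBounds_energyValues ha hb hab hR⟩

theorem groundEnergy_add_le (ha : |a| ≤ 1) (hb : 0 ≤ b) (hab : 1 ≤ b * |a|) (hR : 0 < R)
    (hM : 0 < M) : groundEnergy a b (R + M) ≤ groundEnergy a b R + groundEnergy a b M := by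
  rw [← sub_le_iff_le_add]
  refine le_groundEnergy fun u v₁ v₂ h => ?_
  rw [sub_le_comm]
  refine le_groundEnergy fun u' v₁' v₂' h' => ?_
  obtain ⟨w, w₁, w₂, hw, henergy⟩ := h.exists_add (b := b) h' hR hM
  linarith [groundEnergy_le (bddBelow_energyValues ha hb hab (add_pos hR hM)) hw]

theorem groundEnergy_natCast_mul_le (ha : |a| ≤ 1) (hb : 0 ≤ b) (hab : 1 ≤ b * |a|) (hM : 0 < M)
    (n : ℕ) : groundEnergy a b ((n + 1) * M) ≤ (n + 1) * groundEnergy a b M := by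
  induction n with
  | zero => simp
  | succ n ih =>
    have hstep := groundEnergy_add_le ha hb hab (R := (n + 1) * M) (by positivity) hM
    push_cast
    rw [show ((n : ℝ) + 1 + 1) * M = (n + 1) * M + M by ring]
    linarith

namespace IsAdmissible

theorem cos_smul (h : IsAdmissible a R u v₁ v₂) (hθ : ContDiff ℝ ∞ θ)
    (hC : ∀ t, |deriv θ t| ≤ C) :
    IsAdmissible a R (fun x => Real.cos (θ x.2) • u x) (fun x => Real.cos (θ x.2) • v₁ x)
      (fun x => Real.cos (θ x.2) • v₂ x - (Real.sin (θ x.2) * deriv θ x.2) • u x) where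
  magH1 := h.magH1.cos_smul hθ hC
  eq_zero x hx := by simp [h.eq_zero x hx]
  quartic := integrable_norm_smul_pow h.quartic
    (Real.continuous_cos.comp (hθ.continuous.comp continuous_snd)).aestronglyMeasurable
    fun _ => Real.abs_cos_le_one _

theorem planeEnergy_cos_cutAngle_le (h : IsAdmissible a R u v₁ v₂) (ha : |a| ≤ 1) (hb : 0 ≤ b)
    (hab : 1 ≤ b * |a|) (hL : 0 < L) :
    planeEnergy b (fun x => Real.cos (cutAngle L x.2) • u x)
      (fun x => Real.cos (cutAngle L x.2) • v₁ x) (fun x => Real.cos (cutAngle L x.2) • v₂ x -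
        (Real.sin (cutAngle L x.2) * deriv (cutAngle L) x.2) • u x) ≤
    planeEnergy b u v₁ v₂ + b * ((angleSlope / L) ^ 2 * ∫ x in box R L, ‖u x‖ ^ 2) := by
  have hθ := contDiff_cutAngle L
  have hC := abs_deriv_cutAngle_le hL
  have hquad := h.magH1.quadratic_cos_smul_le ha hb hab hθ hC hL fun t => cutAngle_eq_zero hL
  have hslope := mul_le_mul_of_nonneg_left (h.integral_deriv_cutAngle_le_box hL) hb
  have hquartic : ∫ x, ‖Real.cos (cutAngle L x.2) • u x‖ ^ 4 ≤ ∫ x, ‖u x‖ ^ 4 := by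
    refine integral_mono (h.cos_smul hθ hC).quartic h.quartic fun x => ?_
    simp only [norm_smul, Real.norm_eq_abs]
    gcongr
    exact mul_le_of_le_one_left (norm_nonneg _) (Real.abs_cos_le_one _)
  unfold planeEnergy
  linarith

theorem integral_box_le_of_planeEnergy_nonpos (h : IsAdmissible a M u v₁ v₂) (ha : |a| ≤ 1)
    (hb : 0 ≤ b) (hab : 1 ≤ b * |a|) (hM : 0 < M) (hL : 1 ≤ L)
    (hE : planeEnergy b u v₁ v₂ ≤ 0) :
    ∫ x in box M L, ‖u x‖ ^ 2 ≤ (4 * lowerConst + 1) * b * M * L := by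
  have hb0 : 0 < b := one_pos.trans_le (one_le_of_one_le_mul_abs ha hb hab)
  have hconst := sixteen_le_lowerConst
  calc ∫ x in box M L, ‖u x‖ ^ 2
      ≤ 1 / b * (∫ x, ‖u x‖ ^ 4) + 1 / (1 / b) * (M * L) :=
        setIntegral_box_norm_sq_le h.magH1.memLp h.quartic hM (by linarith) (by positivity)
    _ ≤ 1 / b * (4 * (lowerConst * b ^ 2 * M)) + 1 / (1 / b) * (M * L) := by
        gcongr
        linarith [h.lower_bound ha hb hab hM]
    _ = 4 * lowerConst * b * M * 1 + b * M * L := by field_simp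
    _ ≤ 4 * lowerConst * b * M * L + b * M * L := by gcongr
    _ = (4 * lowerConst + 1) * b * M * L := by ring

end IsAdmissible

/-- The constant in the comparison of the ground state energies on two strips. -/
def longConst : ℝ := (angleSlope ^ 2 + 4 * transitionEnergy) * (4 * lowerConst + 1)

theorem longConst_nonneg : 0 ≤ longConst := by
  have := sixteen_le_lowerConst
  have := transitionEnergy_nonneg
  unfold longConst; positivity

/-- The height `√R` balances the cost of the cutoff in `x₂` against that of averaging in `x₁`. -/
theorem IsAdmissible.add_mul_groundEnergy_le_planeEnergy (h : IsAdmissible a M u v₁ v₂)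
    (ha : |a| ≤ 1) (hb : 0 ≤ b) (hab : 1 ≤ b * |a|) (hM : 0 < M) (hR : 2 ≤ R)
    (hE : planeEnergy b u v₁ v₂ ≤ 0) :
    (M + R) * groundEnergy a b R ≤
      (R - 2) * planeEnergy b u v₁ v₂ + longConst * b ^ 2 * M * √R := by
  have hR0 : 0 < R := by linarith
  have hL : 0 < √R := Real.sqrt_pos.2 hR0
  have hbox := h.integral_box_le_of_planeEnergy_nonpos (L := √R) ha hb hab hM
    (Real.one_le_sqrt.2 (by linarith)) hE
  have hcut := h.planeEnergy_cos_cutAngle_le ha hb hab hL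
  have hmass := h.integral_cos_cutAngle_le_box hL
  have haverage := (h.cos_smul (contDiff_cutAngle √R)
    (abs_deriv_cutAngle_le hL)).add_mul_groundEnergy_le (add_pos hM hR0).le
    (bddBelow_energyValues ha hb hab hR0) (isTestFunction_cell R) (cell_nonneg R) (cell_le_one R)
    fun s => cell_eq_zero
  have hT := transitionEnergy_nonneg
  have hK := integral_cell_sq_le hR0.le
  have hK' := le_integral_cell_sq hR
  set B := ∫ x in box M √R, ‖u x‖ ^ 2
  set E := planeEnergy b u v₁ v₂
  calc (M + R) * groundEnergy a b R
      ≤ (∫ s, cell R s ^ 2) * (E + b * ((angleSlope / √R) ^ 2 * B)) +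
          4 * transitionEnergy * (b * B) := by
        refine haverage.trans ?_
        gcongr
        exact integral_deriv_cell_sq_le R
    _ ≤ (R - 2) * E + R * (b * ((angleSlope / √R) ^ 2 * B)) + 4 * transitionEnergy * (b * B) := by
        rw [mul_add]
        gcongr ?_ + ?_ + _
        · exact mul_le_mul_of_nonpos_right hK' hE
        · gcongr
    _ = (R - 2) * E + (angleSlope ^ 2 + 4 * transitionEnergy) * b * B := by
        rw [div_pow, Real.sq_sqrt hR0.le]
        field_simp
        ring
    _ ≤ (R - 2) * E + (angleSlope ^ 2 + 4 * transitionEnergy) * b *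
          ((4 * lowerConst + 1) * b * M * √R) := by gcongr
    _ = (R - 2) * E + longConst * b ^ 2 * M * √R := by rw [longConst]; ring

theorem add_mul_groundEnergy_le (ha : |a| ≤ 1) (hb : 0 ≤ b) (hab : 1 ≤ b * |a|) (hM : 0 < M)
    (hR : 2 < R) :
    (M + R) * groundEnergy a b R - longConst * b ^ 2 * M * √R ≤ (R - 2) * groundEnergy a b M := by
  have hR2 : 0 < R - 2 := by linarith
  rw [← div_le_iff₀' hR2]
  refine le_groundEnergy fun u v₁ v₂ h => ?_
  rw [div_le_iff₀' hR2]
  rcases le_or_gt (planeEnergy b u v₁ v₂) 0 with hE | hE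
  · linarith [h.add_mul_groundEnergy_le_planeEnergy ha hb hab hM hR.le hE]
  · have hR0 : 0 < R := by linarith
    have hground : (M + R) * groundEnergy a b R ≤ 0 := mul_nonpos_of_nonneg_of_nonpos
      (by linarith) (groundEnergy_nonpos (bddBelow_energyValues ha hb hab hR0))
    have herror : 0 ≤ longConst * b ^ 2 * M * √R := by
      have := longConst_nonneg
      positivity
    linarith [mul_pos hR2 hE]

end LongStrip

section Limit

variable {a b M R : ℝ}

/-- The limit `𝔢_a(b)` of `𝔤_a(b, R) / R`. By subadditivity of `𝔤_a(b, ·)` it is also the infimum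
of these quotients, which serves as the definition. -/
def limitEnergy (a b : ℝ) : ℝ := sInf ((fun R => groundEnergy a b R / R) '' Ioi 0)

theorem neg_le_groundEnergy_div (ha : |a| ≤ 1) (hb : 0 ≤ b) (hab : 1 ≤ b * |a|) (hR : 0 < R) :
    -(lowerConst * b ^ 2) ≤ groundEnergy a b R / R := by
  rw [le_div_iff₀ hR, neg_mul]
  exact le_csInf ⟨0, zero_mem_energyValues a b R⟩ (neg_mem_lowerBounds_energyValues ha hb hab hR)

theorem limitEnergy_le (ha : |a| ≤ 1) (hb : 0 ≤ b) (hab : 1 ≤ b * |a|) (hR : 0 < R) :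
    limitEnergy a b ≤ groundEnergy a b R / R := by
  refine csInf_le ⟨-(lowerConst * b ^ 2), ?_⟩ ⟨R, hR, rfl⟩
  rintro _ ⟨R, hR, rfl⟩
  exact neg_le_groundEnergy_div ha hb hab hR

theorem le_limitEnergy {c : ℝ} (h : ∀ R, 0 < R → c ≤ groundEnergy a b R / R) :
    c ≤ limitEnergy a b := by
  refine le_csInf (nonempty_Ioi.image _) ?_
  rintro _ ⟨R, hR, rfl⟩
  exact h R hR

theorem neg_le_limitEnergy (ha : |a| ≤ 1) (hb : 0 ≤ b) (hab : 1 ≤ b * |a|) :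
    -(lowerConst * b ^ 2) ≤ limitEnergy a b :=
  le_limitEnergy fun _ hR => neg_le_groundEnergy_div ha hb hab hR

theorem groundEnergy_div_nonpos (ha : |a| ≤ 1) (hb : 0 ≤ b) (hab : 1 ≤ b * |a|) (hR : 0 < R) :
    groundEnergy a b R / R ≤ 0 :=
  div_nonpos_of_nonpos_of_nonneg (groundEnergy_nonpos (bddBelow_energyValues ha hb hab hR)) hR.le

theorem limitEnergy_nonpos (ha : |a| ≤ 1) (hb : 0 ≤ b) (hab : 1 ≤ b * |a|) :
    limitEnergy a b ≤ 0 :=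
  (limitEnergy_le ha hb hab one_pos).trans (groundEnergy_div_nonpos ha hb hab one_pos)

/-- The strips of widths `(n + 1) M` are compared with the strip of width `R`, and `n → ∞`. -/
theorem groundEnergy_sub_le_mul_groundEnergy_div (ha : |a| ≤ 1) (hb : 0 ≤ b) (hab : 1 ≤ b * |a|)
    (hM : 0 < M) (hR : 2 < R) :
    groundEnergy a b R - longConst * b ^ 2 * √R ≤ (R - 2) * (groundEnergy a b M / M) := by
  set g := groundEnergy a b R
  have hmultiple (n : ℕ) : g + R * g / M * (1 / ((n : ℝ) + 1)) - longConst * b ^ 2 * √R ≤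
      (R - 2) * (groundEnergy a b M / M) := by
    have hlong := add_mul_groundEnergy_le ha hb hab (M := (n + 1) * M) (by positivity) hR
    have hsub := mul_le_mul_of_nonneg_left (groundEnergy_natCast_mul_le ha hb hab hM n)
      (by linarith : 0 ≤ R - 2)
    refine le_of_mul_le_mul_left ?_ (by positivity : 0 < ((n : ℝ) + 1) * M)
    calc (n + 1) * M * (g + R * g / M * (1 / ((n : ℝ) + 1)) - longConst * b ^ 2 * √R)
        = ((n + 1) * M + R) * g - longConst * b ^ 2 * ((n + 1) * M) * √R := by field_simp
      _ ≤ (R - 2) * ((n + 1) * groundEnergy a b M) := hlong.trans hsub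
      _ = (n + 1) * M * ((R - 2) * (groundEnergy a b M / M)) := by field_simp
  have hlim := (((tendsto_one_div_add_atTop_nhds_zero_nat (𝕜 := ℝ)).const_mul
    (R * g / M)).const_add g).sub_const (longConst * b ^ 2 * √R)
  rw [mul_zero, add_zero] at hlim
  exact le_of_tendsto' hlim hmultiple

theorem groundEnergy_sub_le_mul_limitEnergy (ha : |a| ≤ 1) (hb : 0 ≤ b) (hab : 1 ≤ b * |a|)
    (hR : 2 < R) :
    groundEnergy a b R - longConst * b ^ 2 * √R ≤ (R - 2) * limitEnergy a b := by
  have hR2 : 0 < R - 2 := by linarith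
  rw [← div_le_iff₀' hR2]
  refine le_limitEnergy fun M hM => ?_
  rw [div_le_iff₀' hR2]
  exact groundEnergy_sub_le_mul_groundEnergy_div ha hb hab hM hR

/-- The constant in the rate of convergence of `𝔤_a(b, R) / R`. -/
def rateConst : ℝ := 2 * lowerConst + longConst

theorem rateConst_pos : 0 < rateConst := by
  have := sixteen_le_lowerConst
  have := longConst_nonneg
  unfold rateConst; linarith

theorem groundEnergy_div_le (ha : |a| ≤ 1) (hb : 0 ≤ b) (hab : 1 ≤ b * |a|) (hR : 0 < R) :
    groundEnergy a b R / R ≤ limitEnergy a b + rateConst * (b ^ 2 / √R) := by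
  have hlower := neg_le_limitEnergy ha hb hab
  have hlower0 := sixteen_le_lowerConst
  have hlong0 := longConst_nonneg
  have hs : 0 < √R := Real.sqrt_pos.2 hR
  rcases le_or_gt R 4 with hR4 | hR4
  · have hs2 : √R ≤ 2 := Real.sqrt_le_iff.2 ⟨zero_le_two, by linarith⟩
    calc groundEnergy a b R / R ≤ 0 := groundEnergy_div_nonpos ha hb hab hR
      _ ≤ limitEnergy a b + lowerConst * b ^ 2 * 1 := by linarith
      _ ≤ limitEnergy a b + lowerConst * b ^ 2 * (2 / √R) := by
          gcongr
          exact (one_le_div hs).2 hs2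
      _ = limitEnergy a b + 2 * lowerConst * (b ^ 2 / √R) := by ring
      _ ≤ limitEnergy a b + rateConst * (b ^ 2 / √R) := by
          gcongr
          unfold rateConst; linarith
  · have hs1 : 1 ≤ √R := Real.one_le_sqrt.2 (by linarith)
    rw [div_le_iff₀ hR]
    calc groundEnergy a b R
        ≤ limitEnergy a b * R - 2 * limitEnergy a b + longConst * b ^ 2 * √R := by
          linarith [groundEnergy_sub_le_mul_limitEnergy ha hb hab (by linarith : 2 < R)]
      _ ≤ limitEnergy a b * R + 2 * lowerConst * b ^ 2 * 1 + longConst * b ^ 2 * √R := by linarith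
      _ ≤ limitEnergy a b * R + 2 * lowerConst * b ^ 2 * √R + longConst * b ^ 2 * √R := by gcongr
      _ = limitEnergy a b * R + rateConst * b ^ 2 * (R / √R) := by
          rw [Real.div_sqrt, rateConst]
          ring
      _ = (limitEnergy a b + rateConst * (b ^ 2 / √R)) * R := by ring

theorem tendsto_groundEnergy_div (ha : |a| ≤ 1) (hb : 0 ≤ b) (hab : 1 ≤ b * |a|) :
    Tendsto (fun R => groundEnergy a b R / R) atTop (𝓝 (limitEnergy a b)) := by
  have hupper : Tendsto (fun R : ℝ => limitEnergy a b + rateConst * (b ^ 2 / √R)) atTop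
      (𝓝 (limitEnergy a b)) := by
    have := ((Real.tendsto_sqrt_atTop.const_div_atTop (b ^ 2)).const_mul rateConst).const_add
      (limitEnergy a b)
    rwa [mul_zero, add_zero] at this
  refine tendsto_of_tendsto_of_tendsto_of_le_of_le' tendsto_const_nhds hupper ?_ ?_ <;>
    filter_upwards [eventually_gt_atTop 0] with R hR
  · exact limitEnergy_le ha hb hab hR
  · exact groundEnergy_div_le ha hb hab hR

end Limit

section Dependence

variable {a b b' R : ℝ} {u v₁ v₂ : ℝ × ℝ → ℂ}

theorem planeEnergy_mono (hb : b ≤ b') : planeEnergy b u v₁ v₂ ≤ planeEnergy b' u v₁ v₂ := by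
  unfold planeEnergy
  gcongr

theorem nonneg_and_one_le_mul_abs (ha0 : a ≠ 0) (hb : 1 / |a| ≤ b) : 0 ≤ b ∧ 1 ≤ b * |a| :=
  ⟨(by positivity : 0 ≤ 1 / |a|).trans hb, (div_le_iff₀ (abs_pos.2 ha0)).1 hb⟩

theorem monotoneOn_limitEnergy (ha0 : a ≠ 0) (ha : |a| ≤ 1) :
    MonotoneOn (limitEnergy a) (Ici (1 / |a|)) := by
  intro b hb b' _ hbb
  obtain ⟨hb0, hab⟩ := nonneg_and_one_le_mul_abs ha0 hb
  refine le_limitEnergy fun R hR => (limitEnergy_le ha hb0 hab hR).trans ?_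
  gcongr
  exact le_groundEnergy fun u v₁ v₂ h =>
    (groundEnergy_le (bddBelow_energyValues ha hb0 hab hR) h).trans (planeEnergy_mono hbb)

/-- The energy of each configuration is affine in `b`, so that `𝔢_a` is an infimum of affine
functions. -/
theorem concaveOn_limitEnergy (ha0 : a ≠ 0) (ha : |a| ≤ 1) :
    ConcaveOn ℝ (Ici (1 / |a|)) (limitEnergy a) := by
  refine ⟨convex_Ici _, fun b hb b' hb' s t hs ht hst => le_limitEnergy fun R hR => ?_⟩
  obtain ⟨hb0, hab⟩ := nonneg_and_one_le_mul_abs ha0 hb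
  obtain ⟨hb0', hab'⟩ := nonneg_and_one_le_mul_abs ha0 hb'
  have hground : s * groundEnergy a b R + t * groundEnergy a b' R ≤
      groundEnergy a (s * b + t * b') R := by
    refine le_groundEnergy fun u v₁ v₂ h => ?_
    calc s * groundEnergy a b R + t * groundEnergy a b' R
        ≤ s * planeEnergy b u v₁ v₂ + t * planeEnergy b' u v₁ v₂ := by
          gcongr
          · exact groundEnergy_le (bddBelow_energyValues ha hb0 hab hR) h
          · exact groundEnergy_le (bddBelow_energyValues ha hb0' hab' hR) h
      _ = planeEnergy (s * b + t * b') u v₁ v₂ := by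
          obtain rfl : s = 1 - t := by linarith
          unfold planeEnergy
          ring
  calc s • limitEnergy a b + t • limitEnergy a b'
      ≤ s * (groundEnergy a b R / R) + t * (groundEnergy a b' R / R) := by
        simp only [smul_eq_mul]
        gcongr
        · exact limitEnergy_le ha hb0 hab hR
        · exact limitEnergy_le ha hb0' hab' hR
    _ = (s * groundEnergy a b R + t * groundEnergy a b' R) / R := by ring
    _ ≤ groundEnergy a (s * b + t * b') R / R := by gcongr

theorem exists_planeEnergy_lt_of_limitEnergy_lt {c : ℝ} (h : limitEnergy a b < c) :
    ∃ R > 0, ∃ u v₁ v₂, IsAdmissible a R u v₁ v₂ ∧ planeEnergy b u v₁ v₂ < c * R := by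
  obtain ⟨_, ⟨R, hR, rfl⟩, hlt⟩ := exists_lt_of_csInf_lt (nonempty_Ioi.image _) h
  obtain ⟨E, hE, hlt⟩ := exists_lt_of_csInf_lt ⟨0, zero_mem_energyValues a b R⟩
    ((div_lt_iff₀ (mem_Ioi.1 hR)).1 hlt)
  obtain ⟨u, v₁, v₂, hu, rfl⟩ := mem_energyValues_iff.1 hE
  exact ⟨R, hR, u, v₁, v₂, hu, hlt⟩

theorem IsAdmissible.limitEnergy_lt {c : ℝ} (h : IsAdmissible a R u v₁ v₂) (ha : |a| ≤ 1)
    (hb : 0 ≤ b) (hab : 1 ≤ b * |a|) (hR : 0 < R) (hlt : planeEnergy b u v₁ v₂ < c * R) :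
    limitEnergy a b < c :=
  (limitEnergy_le ha hb hab hR).trans_lt ((div_lt_iff₀ hR).2
    ((groundEnergy_le (bddBelow_energyValues ha hb hab hR) h).trans_lt hlt))

theorem continuousWithinAt_limitEnergy_left (ha0 : a ≠ 0) (ha : |a| ≤ 1) :
    ContinuousWithinAt (limitEnergy a) (Ici (1 / |a|)) (1 / |a|) := by
  refine tendsto_order.2 ⟨fun c hc => ?_, fun c hc => ?_⟩
  · filter_upwards [self_mem_nhdsWithin] with b hb
    exact hc.trans_le (monotoneOn_limitEnergy ha0 ha self_mem_Ici hb hb)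
  · obtain ⟨R, hR, u, v₁, v₂, h, hlt⟩ := exists_planeEnergy_lt_of_limitEnergy_lt hc
    have hcont : Continuous fun b => planeEnergy b u v₁ v₂ := by unfold planeEnergy; fun_prop
    filter_upwards [self_mem_nhdsWithin,
      mem_nhdsWithin_of_mem_nhds (hcont.continuousAt.eventually_lt_const hlt)] with b hb hlt
    obtain ⟨hb0, hab⟩ := nonneg_and_one_le_mul_abs ha0 hb
    exact h.limitEnergy_lt ha hb0 hab hR hlt

theorem continuousOn_limitEnergy (ha0 : a ≠ 0) (ha : |a| ≤ 1) :
    ContinuousOn (limitEnergy a) (Ici (1 / |a|)) := by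
  intro b hb
  rcases (mem_Ici.1 hb).eq_or_lt with rfl | hb
  · exact continuousWithinAt_limitEnergy_left ha0 ha
  · have hinterior := (concaveOn_limitEnergy ha0 ha).continuousOn_interior
    rw [interior_Ici] at hinterior
    exact (hinterior.continuousAt (Ioi_mem_nhds hb)).continuousWithinAt

theorem limitEnergy_eq_zero (ha0 : a ≠ 0) (ha : |a| ≤ 1) (hb : 0 ≤ b) (hab : 1 ≤ b * |a|)
    (h : 1 / beta a ≤ b) : limitEnergy a b = 0 := by
  refine (limitEnergy_nonpos ha hb hab).antisymm (le_limitEnergy fun R hR => div_nonneg ?_ hR.le)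
  exact le_groundEnergy fun u v₁ v₂ hu =>
    planeEnergy_nonneg hb ((div_le_iff₀ (beta_pos ha0 ha)).1 h) hu.magH1.beta_mul_le

theorem planeEnergy_const_mul (t : ℝ) :
    planeEnergy b (fun x => (t : ℂ) * u x) (fun x => (t : ℂ) * v₁ x) (fun x => (t : ℂ) * v₂ x) =
      t ^ 2 * (b * ((∫ x, ‖v₁ x‖ ^ 2) + ∫ x, ‖v₂ x‖ ^ 2) - ∫ x, ‖u x‖ ^ 2) +
        t ^ 4 * (1 / 2 * ∫ x, ‖u x‖ ^ 4) := by
  simp only [planeEnergy, norm_mul, Complex.norm_real, Real.norm_eq_abs, mul_pow,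
    integral_const_mul, sq_abs, Even.pow_abs (by decide : Even 4)]
  ring

/-- Scaling down `u` makes the quartic term negligible. -/
theorem exists_planeEnergy_const_mul_neg
    (h : b * ((∫ x, ‖v₁ x‖ ^ 2) + ∫ x, ‖v₂ x‖ ^ 2) < ∫ x, ‖u x‖ ^ 2) :
    ∃ t : ℝ, planeEnergy b (fun x => (t : ℂ) * u x) (fun x => (t : ℂ) * v₁ x)
      (fun x => (t : ℂ) * v₂ x) < 0 := by
  simp only [planeEnergy_const_mul]
  set p := b * ((∫ x, ‖v₁ x‖ ^ 2) + ∫ x, ‖v₂ x‖ ^ 2) - ∫ x, ‖u x‖ ^ 2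
  set q := 1 / 2 * ∫ x, ‖u x‖ ^ 4
  have hp : 0 < -p := by linarith
  have hq : 0 ≤ q := by positivity
  have hs : 0 < -p / (q + 1) := by positivity
  refine ⟨√(-p / (q + 1)), ?_⟩
  calc √(-p / (q + 1)) ^ 2 * p + √(-p / (q + 1)) ^ 4 * q
      = -p / (q + 1) * p + (-p / (q + 1)) ^ 2 * q := by
        rw [show 4 = 2 * 2 by rfl, pow_mul, Real.sq_sqrt hs.le]
    _ = -(-p / (q + 1)) ^ 2 := by field_simp; ring
    _ < 0 := neg_lt_zero.2 (by positivity)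

theorem IsAdmissible.const_mul (h : IsAdmissible a R u v₁ v₂) (c : ℂ) :
    IsAdmissible a R (fun x => c * u x) (fun x => c * v₁ x) (fun x => c * v₂ x) where
  magH1 := h.magH1.const_mul c
  eq_zero x hx := by simp [h.eq_zero x hx]
  quartic := by simpa only [norm_mul, mul_pow] using h.quartic.const_mul (‖c‖ ^ 4)

theorem IsTestFunction.exists_isAdmissible {ϕ : ℝ × ℝ → ℂ} (h : IsTestFunction ϕ) (a : ℝ) :
    ∃ R > 0, IsAdmissible a R ϕ (mag1 a ϕ) (mag2 ϕ) := by
  obtain ⟨r, hr, hball⟩ :=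
    h.hasCompactSupport.isCompact.isBounded.subset_closedBall_lt 0 0
  refine ⟨4 * r, by positivity, h.magH1 a, fun x hx => ?_, ?_⟩
  · have hsupp : x ∉ tsupport ϕ := by
      intro hsupp
      have hfst := abs_le.1 ((norm_fst_le x).trans (mem_closedBall_zero_iff.1 (hball hsupp)))
      exact hx (mem_strip.2 ⟨by linarith, by linarith⟩)
    have hzero : ϕ x = 0 := image_eq_zero_of_notMem_tsupport hsupp
    have hderiv : fderiv ℝ ϕ x = 0 :=
      image_eq_zero_of_notMem_tsupport fun h => hsupp (tsupport_fderiv_subset ℝ h)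
    simp [mag1, mag2, hzero, hderiv]
  · have hcont : Continuous fun x => ‖ϕ x‖ ^ 4 := h.continuous.norm.pow 4
    exact hcont.integrable_of_hasCompactSupport
      (h.hasCompactSupport.comp_left (g := fun z : ℂ => ‖z‖ ^ 4) (by simp))

theorem limitEnergy_neg (ha0 : a ≠ 0) (ha : |a| ≤ 1) (hb : 0 ≤ b) (hab : 1 ≤ b * |a|)
    (h : b < 1 / beta a) : limitEnergy a b < 0 := by
  have hb0 : 0 < b := one_pos.trans_le (one_le_of_one_le_mul_abs ha hb hab)
  obtain ⟨ϕ, hϕ, hlt⟩ := exists_isTestFunction_lt ((lt_one_div hb0 (beta_pos ha0 ha)).1 h)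
  rw [one_div, inv_mul_eq_div, lt_div_iff₀' hb0] at hlt
  obtain ⟨R, hR, hadm⟩ := hϕ.exists_isAdmissible a
  obtain ⟨t, ht⟩ := exists_planeEnergy_const_mul_neg hlt
  exact (hadm.const_mul (t : ℂ)).limitEnergy_lt ha hb hab hR (by rwa [zero_mul])

theorem limitEnergy_eq_zero_iff (ha0 : a ≠ 0) (ha : |a| ≤ 1) (hb : 0 ≤ b) (hab : 1 ≤ b * |a|) :
    limitEnergy a b = 0 ↔ 1 / beta a ≤ b :=
  ⟨fun h => not_lt.1 fun hlt => (limitEnergy_neg ha0 ha hb hab hlt).ne h,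
    limitEnergy_eq_zero ha0 ha hb hab⟩

theorem groundEnergy_eq_zero_of_pos (ha0 : 0 < a) (ha : a ≤ 1) (hb : 0 ≤ b) (hab : 1 ≤ b * a)
    (R : ℝ) : groundEnergy a b R = 0 :=
  IsLeast.csInf_eq ⟨zero_mem_energyValues a b R,
    zero_mem_lowerBounds_energyValues ha0 ha hb hab R⟩

theorem rpow_third_le_sqrt (hR : 1 ≤ R) : R ^ ((1 : ℝ) / 3) ≤ √R := by
  rw [Real.sqrt_eq_rpow]
  exact Real.rpow_le_rpow_of_exponent_le hR (by norm_num)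

end Dependence

end StepGL

end

theorem theorem3p1_general :
    ∃ (e : ℝ → ℝ → ℝ) (C : ℝ), 0 < C ∧
      ∀ a : ℝ, a ≠ 0 → |a| ≤ 1 →
        (∀ b : ℝ, 1 / |a| ≤ b → ∀ R : ℝ, 0 < R →
          BddBelow (StepGL.energyValues a b R) ∧
          StepGL.groundEnergy a b R ≤ 0 ∧
          (0 < a → StepGL.groundEnergy a b R = 0)) ∧
        (∀ b : ℝ, 1 / |a| ≤ b →
          e a b ≤ 0 ∧
          Tendsto (fun R : ℝ => StepGL.groundEnergy a b R / R) atTop (𝓝 (e a b)) ∧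
          (e a b = 0 ↔ 1 / StepGL.beta a ≤ b)) ∧
        MonotoneOn (e a) (Ici (1 / |a|)) ∧
        ContinuousOn (e a) (Ici (1 / |a|)) ∧
        (∀ b : ℝ, 1 / |a| ≤ b → ∀ R : ℝ, 0 < R →
          e a b ≤ StepGL.groundEnergy a b R / R ∧
          StepGL.groundEnergy a b R / R ≤ e a b + C * (b ^ 2 / √R)) := by
  refine ⟨StepGL.limitEnergy, StepGL.rateConst, StepGL.rateConst_pos, fun a ha0 ha =>
    ⟨fun b hab R hR => ?_, fun b hab => ?_, StepGL.monotoneOn_limitEnergy ha0 ha,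
      StepGL.continuousOn_limitEnergy ha0 ha, fun b hab R hR => ?_⟩⟩ <;>
    obtain ⟨hb, hab⟩ := StepGL.nonneg_and_one_le_mul_abs ha0 hab
  · have hbdd := StepGL.bddBelow_energyValues ha hb hab hR
    refine ⟨hbdd, StepGL.groundEnergy_nonpos hbdd, fun hpos => ?_⟩
    rw [abs_of_pos hpos] at ha hab
    exact StepGL.groundEnergy_eq_zero_of_pos hpos ha hb hab R
  · exact ⟨StepGL.limitEnergy_nonpos ha hb hab, StepGL.tendsto_groundEnergy_div ha hb hab,
      StepGL.limitEnergy_eq_zero_iff ha0 ha hb hab⟩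
  · exact ⟨StepGL.limitEnergy_le ha hb hab hR, StepGL.groundEnergy_div_le ha hb hab hR⟩

theorem theorem3p1 :
    ∃ (e : ℝ → ℝ → ℝ) (C : ℝ), 0 < C ∧
      ∀ a : ℝ, -1 ≤ a → a < 1 → a ≠ 0 →
        (∀ b : ℝ, 1 / |a| ≤ b → ∀ R : ℝ, 0 < R →
          BddBelow (StepGL.energyValues a b R) ∧
          StepGL.groundEnergy a b R ≤ 0 ∧
          (0 < a → StepGL.groundEnergy a b R = 0)) ∧
        (a < 0 →
          (∀ b : ℝ, 1 / |a| ≤ b →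
            e a b ≤ 0 ∧
            Tendsto (fun R : ℝ => StepGL.groundEnergy a b R / R) atTop (𝓝 (e a b)) ∧
            (e a b = 0 ↔ 1 / StepGL.beta a ≤ b)) ∧
          MonotoneOn (e a) (Ici (1 / |a|)) ∧
          ContinuousOn (e a) (Ici (1 / |a|)) ∧
          (∀ b : ℝ, 1 / |a| ≤ b → ∀ R : ℝ, 4 ≤ R →
            e a b ≤ StepGL.groundEnergy a b R / R ∧
            StepGL.groundEnergy a b R / R ≤ e a b + C * (b ^ 2 / R ^ ((1 : ℝ) / 3)))) := by
  obtain ⟨e, C, hC, he⟩ := theorem3p1_general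
  refine ⟨e, C, hC, fun a ha ha' ha0 => ?_⟩
  obtain ⟨hground, hlimit, hmono, hcont, hrate⟩ := he a ha0 (abs_le.2 ⟨ha, ha'.le⟩)
  refine ⟨hground, fun _ => ⟨hlimit, hmono, hcont, fun b hb R hR => ?_⟩⟩
  refine (hrate b hb R (by linarith)).imp_right fun h => h.trans ?_
  gcongr
  exact StepGL.rpow_third_le_sqrt (by linarith)
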